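/- Let $(\mathcal M,g_{\alpha\beta})$ be a four-dimensional smooth Lorentzian manifold of signature $(+,-,-,-)$ that satisfies the vacuum Einstein equations $G_{\alpha\beta}+\lambda g_{\alpha\beta}=0$ with cosmological constant $\lambda\in\mathbb R$ (curvature convention $(\nabla_\alpha\nabla_\beta-\nabla_\beta\nabla_\alpha)V^\gamma=R_{\alpha\beta\delta}{}^{\gamma}V^\delta$, $R_{\alpha\beta}=R_{\alpha\gamma\beta}{}^{\gamma}$) and is of Petrov type D: $\mathcal M$ is covered by domains of smooth principal null tetrads $l_\alpha,n_\alpha,m_\alpha,\bar m_\alpha$ ($l_\alpha n^\alpha=1=-m_\alpha\bar m^\alpha$, all other contractions zero) for which the Weyl scalars satisfy $\Psi_0=\Psi_1=\Psi_3=\Psi_4=0$ and $\Psi_2=C_{\alpha\beta\gamma\delta}l^\alpha m^\beta\bar m^\gamma n^\delta\neq0$ everywhere, any two of them being related on overlaps by $l\mapsto|\zeta|\,l$, $n\mapsto|\zeta|^{-1}n$, $m\mapsto(\zeta/|\zeta|)\,m$ with $\zeta\in\mathbb C^\times$. Let $\Psi_2^{1/3}$ be a smooth cube root of $\Psi_2$.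 Write $\rho=m^\beta\bar m^\alpha\nabla_\alpha l_\beta$, $\tau=m^\beta n^\alpha\nabla_\alpha l_\beta$, $\tau'=\bar m^\beta l^\alpha\nabla_\alpha n_\beta$, $\epsilon=\tfrac12(n^\beta l^\alpha\nabla_\alpha l_\beta+m^\beta l^\alpha\nabla_\alpha\bar m_\beta)$, $\beta=\tfrac12(n^\beta m^\alpha\nabla_\alpha l_\beta+m^\beta m^\alpha\nabla_\alpha\bar m_\beta)$, $\epsilon'=\tfrac12(l^\beta n^\alpha\nabla_\alpha n_\beta+\bar m^\beta n^\alpha\nabla_\alpha m_\beta)$, $\beta'=\tfrac12(l^\beta\bar m^\alpha\nabla_\alpha n_\beta+\bar m^\beta\bar m^\alpha\nabla_\alpha m_\beta)$, and $$\Gamma_\alpha=(-\rho n_\alpha+\tau\bar m_\alpha)-(\epsilon n_\alpha-\epsilon' l_\alpha+\beta' m_\alpha-\beta\bar m_\alpha).$$ Put ${}^0W_{\alpha\beta\gamma\delta}={}^0M_{\alpha\beta}{}^0M_{\gamma\delta}$ and ${}^4W_{\alpha\beta\gamma\delta}={}^2M_{\alpha\beta}{}^2M_{\gamma\delta}$ with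 ${}^0M_{\alpha\beta}=2l_{[\alpha}m_{\beta]}$, ${}^2M_{\alpha\beta}=2\bar m_{[\alpha}n_{\beta]}$. Let $s\in\{2,-2\}$ and let $\Phi_s$ be a smooth weighted scalar of type $\{2s,0\}$ (a smooth function for each tetrad, with $\Phi_s\mapsto\zeta^{s}\Phi_s$ under the above change of tetrad) that solves the spin-weight $s$ Teukolsky equation $$\left[(\nabla^\alpha+2s\Gamma^\alpha)(\nabla_\alpha+2s\Gamma_\alpha)-16\Psi_2+\tfrac23\lambda\right]\Phi_s=0 .$$ Then $$h_{\alpha\beta}=\nabla_\gamma\!\left[\Psi_2^{-4/3}\,\nabla_\delta\!\left({}^{2+s}W_{(\alpha}{}^{\gamma\delta}{}_{\beta)}\,\Psi_2^{(2-s)/3}\,\Phi_s\right)\right]$$ is a smooth complex symmetric field, independent of the choice of tetrad, that solves the linearized Einstein equations $\frac{d}{d\varepsilon}\big|_{\varepsilon=0}\big(G_{\alpha\beta}[g+\varepsilon h]+\lambda(g_{\alpha\beta}+\varepsilon h_{\alpha\beta})\big)=0$ (extended complex linearly to complex $h$). Moreover, for $s=-2$ it is the Kegeles–Cohen (radiation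 gauge) perturbation with Debye potential $\Phi=\Phi_{-2}$, $$h_{\alpha\beta}=-l_\alpha l_\beta(\eth-\tau)(\eth+3\tau)\Phi-m_\alpha m_\beta(\text{þ}-\rho)(\text{þ}+3\rho)\Phi+l_{(\alpha}m_{\beta)}\left[(\text{þ}-\rho+\bar\rho)(\eth+3\tau)+(\eth-\tau+\bar\tau')(\text{þ}+3\rho)\right]\Phi ,$$ where on quantities of type $\{p,q\}$ $\text{þ}=l^\alpha\nabla_\alpha-p\epsilon-q\bar\epsilon$ and $\eth=m^\alpha\nabla_\alpha-p\beta+q\bar\beta'$; here $\Phi$, $(\text{þ}+3\rho)\Phi$ and $(\eth+3\tau)\Phi$ have types $\{-4,0\}$, $\{-3,1\}$ and $\{-3,-1\}$. -/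

import Mathlib

open scoped Manifold ContDiff

noncomputable section

namespace TypeDRec

/-! ## Tensor calculus in a coordinate domain

All component fields are complex valued functions of the coordinates; real tensors have real
components. Component indices come first, the point comes last. -/

/-- The coordinate space `ℝ⁴`. -/
abbrev E4 : Type := EuclideanSpace ℝ (Fin 4)

/-- Component arrays of scalars and of tensors with `1`, `2`, `3`, `4` indices. -/
abbrev F0 : Type := E4 → ℂ
abbrev F1 : Type := Fin 4 → F0
abbrev F2 : Type := Fin 4 → F1
abbrev F3 : Type := Fin 4 → F2
abbrev F4 : Type := Fin 4 → F3

/-- Partial derivative `∂_a f`. -/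
def pd (a : Fin 4) (f : F0) : F0 := fun y => fderiv ℝ f y (EuclideanSpace.single a 1)

/-- Components `g^{ab}` of the inverse metric. -/
def invMetric (g : F2) : F2 := fun a b y => (Matrix.of fun i j => g i j y)⁻¹ a b

/-- `christoffel g c a b` is the Christoffel symbol `Γ^c_{ab}`. -/
def christoffel (g : F2) : F3 := fun c a b y =>
  (1 / 2) * ∑ d, invMetric g c d y * (pd a (g d b) y + pd b (g d a) y - pd d (g a b) y)

/-- `cov1 g w a b = ∇_a w_b`. -/
def cov1 (g : F2) (w : F1) : F2 := fun a b y =>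
  pd a (w b) y - ∑ e, christoffel g e a b y * w e y

/-- `cov3 g T a i j k = ∇_a T_{ijk}`. -/
def cov3 (g : F2) (T : F3) : F4 := fun a i j k y =>
  pd a (T i j k) y
    - ∑ e, (christoffel g e a i y * T e j k y + christoffel g e a j y * T i e k y
        + christoffel g e a k y * T i j e y)

/-- `cov4 g T a i j k l = ∇_a T_{ijkl}`. -/
def cov4 (g : F2) (T : F4) : Fin 4 → F4 := fun a i j k l y =>
  pd a (T i j k l) y
    - ∑ e, (christoffel g e a i y * T e j k l y + christoffel g e a j y * T i e k l y
        + christoffel g e a k y * T i j e l y + christoffel g e a l y * T i j k e y)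

/-- `riemann g a b d c` is `R_{abd}{}^c`, with the convention
`(∇_a ∇_b - ∇_b ∇_a) V^c = R_{abd}{}^c V^d`. -/
def riemann (g : F2) : F4 := fun a b d c y =>
  pd a (christoffel g c b d) y - pd b (christoffel g c a d) y
    + ∑ e, (christoffel g c a e y * christoffel g e b d y
        - christoffel g c b e y * christoffel g e a d y)

/-- The Ricci tensor `R_{ab} = R_{acb}{}^c`. -/
def ricci (g : F2) : F2 := fun a b y => ∑ c, riemann g a c b c y

/-- The curvature scalar `R = g^{ab} R_{ab}`. -/
def scalarCurv (g : F2) : F0 := fun y => ∑ a, ∑ b, invMetric g a b y * ricci g a b y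

/-- The Einstein tensor `G_{ab} = R_{ab} - ½ R g_{ab}`. -/
def einstein (g : F2) : F2 := fun a b y => ricci g a b y - (1 / 2) * scalarCurv g y * g a b y

/-- The Weyl tensor
`C_{abcd} = R_{abcd} - (g_{a[c} R_{d]b} - g_{b[c} R_{d]a}) + ⅓ R g_{a[c} g_{d]b}`. -/
def weyl (g : F2) : F4 := fun a b c d y =>
  (∑ e, riemann g a b c e y * g e d y)
    - (1 / 2) * (g a c y * ricci g d b y - g a d y * ricci g c b y
        - g b c y * ricci g d a y + g b d y * ricci g c a y)
    + (1 / 6) * scalarCurv g y * (g a c y * g d b y - g a d y * g c b y)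

/-- `h` solves at `y` the linearization at `g` of the Einstein equations with cosmological
constant `lam`: `d/dε|_{ε=0} (G_{ab} + lam g_{ab}) = 0` along `g(ε) = g + ε h`. For complex `h`
this is the complex linear extension of the linearized equations for real `h`. -/
def LinEinsteinAt (g : F2) (lam : ℝ) (h : F2) (y : E4) : Prop :=
  ∀ a b, HasDerivAt (fun ε : ℝ =>
      einstein (fun i j z => g i j z + (ε : ℂ) * h i j z) a b y
        + (lam : ℂ) * (g a b y + (ε : ℂ) * h a b y)) 0 0

/-! ## Null tetrads in a coordinate domain -/

/-- Components `l_a`, `n_a`, `m_a` of a null tetrad (indices lowered). -/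
structure Tetrad where
  l : F1
  n : F1
  m : F1

namespace Tetrad

variable (g : F2) (θ : Tetrad)

/-- `\bar m_a`. -/
def mb : F1 := fun a y => starRingEnd ℂ (θ.m a y)

/-- Raising an index: `w^a = g^{ab} w_b`. -/
def up (w : F1) : F1 := fun a y => ∑ b, invMetric g a b y * w b y

/-- The full contraction `C_{abcd} X^a Y^b Z^c V^d` of the Weyl tensor. -/
def weylContr (X Y Z V : F1) : F0 := fun y =>
  ∑ a, ∑ b, ∑ c, ∑ d, weyl g a b c d y
    * up g X a y * up g Y b y * up g Z c y * up g V d y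

/-- The Weyl scalars `Ψ₀, …, Ψ₄`. -/
def Psi0 : F0 := weylContr g θ.l θ.m θ.l θ.m
def Psi1 : F0 := weylContr g θ.l θ.m θ.l θ.n
def Psi2 : F0 := weylContr g θ.l θ.m θ.mb θ.n
def Psi3 : F0 := weylContr g θ.l θ.n θ.mb θ.n
def Psi4 : F0 := weylContr g θ.mb θ.n θ.mb θ.n

/-- `rot g Y X w = Y^b X^a ∇_a w_b`. -/
def rot (Y X w : F1) : F0 := fun y => ∑ a, ∑ b, up g X a y * up g Y b y * cov1 g w a b y

/-- Spin coefficients; `D = l^a ∇_a`, `D' = n^a ∇_a`, `δ = m^a ∇_a`, `δ' = \bar m^a ∇_a`.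
`ρ = m^b δ' l_b`. -/
def rho : F0 := rot g θ.m θ.mb θ.l
/-- `τ = m^b D' l_b`. -/
def tau : F0 := rot g θ.m θ.n θ.l
/-- `τ' = \bar m^b D n_b`. -/
def tau' : F0 := rot g θ.mb θ.l θ.n
/-- `ε = ½ (n^b D l_b + m^b D \bar m_b)`. -/
def eps : F0 := fun y => (1 / 2) * (rot g θ.n θ.l θ.l y + rot g θ.m θ.l θ.mb y)
/-- `β = ½ (n^b δ l_b + m^b δ \bar m_b)`. -/
def beta : F0 := fun y => (1 / 2) * (rot g θ.n θ.m θ.l y + rot g θ.m θ.m θ.mb y)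
/-- `ε' = ½ (l^b D' n_b + \bar m^b D' m_b)`. -/
def eps' : F0 := fun y => (1 / 2) * (rot g θ.l θ.n θ.n y + rot g θ.mb θ.n θ.m y)
/-- `β' = ½ (l^b δ' n_b + \bar m^b δ' m_b)`. -/
def beta' : F0 := fun y => (1 / 2) * (rot g θ.l θ.mb θ.n y + rot g θ.mb θ.mb θ.m y)

/-- The connection form `ω_a = ε n_a - ε' l_a + β' m_a - β \bar m_a` of the weighted derivative
`∇_a - p ω_a - q \bar ω_a` on quantities of type `{p,q}`. -/
def omega : F1 := fun a y =>
  θ.eps g y * θ.n a y - θ.eps' g y * θ.l a y + θ.beta' g y * θ.m a y - θ.beta g y * θ.mb a y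

/-- `B_a = - ρ n_a + τ \bar m_a`. -/
def bForm : F1 := fun a y => - θ.rho g y * θ.n a y + θ.tau g y * θ.mb a y

/-- `Γ_a = B_a - ω_a`. -/
def gam : F1 := fun a y => θ.bForm g a y - θ.omega g a y

/-- The weighted wave operator `g^{ab} (∇_a + p Γ_a)(∇_b + p Γ_b)` on scalars. -/
def waveOp (p : ℤ) (f : F0) : F0 := fun y =>
  let w : F1 := fun b z => pd b f z + (p : ℂ) * θ.gam g b z * f z
  ∑ a, ∑ b, invMetric g a b y * (cov1 g w a b y + (p : ℂ) * θ.gam g a y * w b y)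

/-- The Teukolsky operator `O_s` for gravitational perturbations of spin weight `s = ±2`
on a background with cosmological constant `lam`. -/
def teukolsky (lam : ℝ) (s : ℤ) (f : F0) : F0 := fun y =>
  θ.waveOp g (2 * s) f y - 16 * θ.Psi2 g y * f y + (2 / 3) * (lam : ℂ) * f y

/-- `⁰M_{ab} = 2 l_{[a} m_{b]}`. -/
def M0 : F2 := fun a b y => θ.l a y * θ.m b y - θ.l b y * θ.m a y
/-- `²M_{ab} = 2 \bar m_{[a} n_{b]}`. -/
def M2 : F2 := fun a b y => θ.mb a y * θ.n b y - θ.mb b y * θ.n a y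

/-- `⁰W_{abcd} = ⁰M_{ab} ⁰M_{cd}`. -/
def W0 : F4 := fun a b c d y => θ.M0 a b y * θ.M0 c d y
/-- `⁴W_{abcd} = ²M_{ab} ²M_{cd}`. -/
def W4 : F4 := fun a b c d y => θ.M2 a b y * θ.M2 c d y

/-- The tensor `^{2+s}W` for the extreme spin weights `s = 2` and `s = -2`. -/
def WExt (s : ℤ) : F4 := if s = 2 then θ.W4 else θ.W0

/-- `W_{(a|cd|b)} Ψ₂^{(2-s)/3} Φ` with `W = ^{2+s}W`; `ψ` is the cube root `Ψ₂^{1/3}`. -/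
def hertz (ψ : F0) (s : ℤ) (f : F0) : F4 := fun a c d b y =>
  (1 / 2) * (θ.WExt s a c d b y + θ.WExt s b c d a y) * ψ y ^ (2 - s) * f y

/-- `Ψ₂^{-4/3} ∇^d (W_{(a|cd|b)} Ψ₂^{(2-s)/3} Φ)`, index order `a c b`. -/
def hertzDiv (ψ : F0) (s : ℤ) (f : F0) : F3 := fun a c b y =>
  ψ y ^ (-4 : ℤ) * ∑ d, ∑ e, invMetric g d e y * cov4 g (θ.hertz ψ s f) e a c d b y

/-- The reconstructed perturbation
`h_{ab} = ∇^c [Ψ₂^{-4/3} ∇^d (W_{(a|cd|b)} Ψ₂^{(2-s)/3} Φ)]`. -/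
def recon (ψ : F0) (s : ℤ) (f : F0) : F2 := fun a b y =>
  ∑ c, ∑ e, invMetric g c e y * cov3 g (θ.hertzDiv g ψ s f) e a c b y

/-- The weighted derivative `þ = D - p ε - q \bar ε` on quantities of type `{p,q}`. -/
def thorn (p q : ℤ) (f : F0) : F0 := fun y =>
  (∑ a, up g θ.l a y * pd a f y) - (p : ℂ) * θ.eps g y * f y
    - (q : ℂ) * starRingEnd ℂ (θ.eps g y) * f y

/-- The weighted derivative `ð = δ - p β + q \bar β'` on quantities of type `{p,q}`. -/
def eth (p q : ℤ) (f : F0) : F0 := fun y =>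
  (∑ a, up g θ.m a y * pd a f y) - (p : ℂ) * θ.beta g y * f y
    + (q : ℂ) * starRingEnd ℂ (θ.beta' g y) * f y

/-- `(þ + 3ρ) Φ`, of type `{-3,1}`, for `Φ` of type `{-4,0}`. -/
def kcA (f : F0) : F0 := fun y => θ.thorn g (-4) 0 f y + 3 * θ.rho g y * f y

/-- `(ð + 3τ) Φ`, of type `{-3,-1}`, for `Φ` of type `{-4,0}`. -/
def kcB (f : F0) : F0 := fun y => θ.eth g (-4) 0 f y + 3 * θ.tau g y * f y

/-- The (complex) Kegeles–Cohen radiation gauge perturbation generated by a Debye potential `Φ`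
of type `{-4,0}`:
`- l_a l_b (ð - τ)(ð + 3τ)Φ - m_a m_b (þ - ρ)(þ + 3ρ)Φ
  + l_{(a} m_{b)} [(þ - ρ + \bar ρ)(ð + 3τ) + (ð - τ + \bar τ')(þ + 3ρ)]Φ`. -/
def kegelesCohen (f : F0) : F2 := fun a b y =>
  - (θ.l a y * θ.l b y * (θ.eth g (-3) (-1) (θ.kcB g f) y - θ.tau g y * θ.kcB g f y))
  - θ.m a y * θ.m b y * (θ.thorn g (-3) 1 (θ.kcA g f) y - θ.rho g y * θ.kcA g f y)
  + (1 / 2) * (θ.l a y * θ.m b y + θ.m a y * θ.l b y)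
    * ((θ.thorn g (-3) (-1) (θ.kcB g f) y
          - (θ.rho g y - starRingEnd ℂ (θ.rho g y)) * θ.kcB g f y)
      + (θ.eth g (-3) 1 (θ.kcA g f) y
          - (θ.tau g y - starRingEnd ℂ (θ.tau' g y)) * θ.kcA g f y))

end Tetrad

/-! ## Spacetimes -/

section Manifold

variable {M : Type*} [TopologicalSpace M] [ChartedSpace E4 M]

/-- The coordinate vector `∂_a` of the chart `e` at the point with coordinates `y`. -/
def coordVec (e : OpenPartialHomeomorph M E4) (y : E4) (a : Fin 4) :
    TangentSpace (𝓡 4) (e.symm y) :=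
  mfderiv (𝓡 4) (𝓡 4) e.symm y (EuclideanSpace.single a (1 : ℝ) : E4)

/-- The components in the chart `e` of a real bilinear form on the tangent spaces. -/
def comp2 (T : ∀ x : M, TangentSpace (𝓡 4) x →L[ℝ] TangentSpace (𝓡 4) x →L[ℝ] ℝ)
    (e : OpenPartialHomeomorph M E4) : F2 := fun a b y =>
  ((T (e.symm y) (coordVec e y a) (coordVec e y b) : ℝ) : ℂ)

/-- A smooth Lorentzian metric of signature `(+,-,-,-)` on a four-manifold. -/
structure LorentzMetric (M : Type*) [TopologicalSpace M] [ChartedSpace E4 M] where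
  /-- the bilinear form on each tangent space -/
  val : ∀ x : M, TangentSpace (𝓡 4) x →L[ℝ] TangentSpace (𝓡 4) x →L[ℝ] ℝ
  symm : ∀ x v w, val x v w = val x w v
  signature : ∀ x, ∃ b : Module.Basis (Fin 4) ℝ (TangentSpace (𝓡 4) x), ∀ i j,
    val x (b i) (b j) = if i = j then (if i = 0 then 1 else -1) else 0
  smooth : ∀ e ∈ IsManifold.maximalAtlas (𝓡 4) ∞ M, ∀ a b,
    ContDiffOn ℝ ∞ (comp2 val e a b) e.target

/-- The components of the metric in the chart `e`. -/
def LorentzMetric.comp (g : LorentzMetric M) (e : OpenPartialHomeomorph M E4) : F2 :=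
  comp2 g.val e

/-- The vacuum Einstein equations `G_{ab} + lam g_{ab} = 0` with cosmological constant `lam`. -/
def LorentzMetric.IsVacuum (g : LorentzMetric M) (lam : ℝ) : Prop :=
  ∀ e ∈ IsManifold.maximalAtlas (𝓡 4) ∞ M, ∀ y ∈ e.target, ∀ a b,
    einstein (g.comp e) a b y + (lam : ℂ) * g.comp e a b y = 0

/-- Fields of one-forms `l_a`, `n_a` (real) and `m_a` (complex). -/
structure Coframe (M : Type*) [TopologicalSpace M] [ChartedSpace E4 M] where
  l : ∀ x : M, TangentSpace (𝓡 4) x →L[ℝ] ℝ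
  n : ∀ x : M, TangentSpace (𝓡 4) x →L[ℝ] ℝ
  m : ∀ x : M, TangentSpace (𝓡 4) x →L[ℝ] ℂ

/-- The components of a coframe in the chart `e`. -/
def Coframe.comp (θ : Coframe M) (e : OpenPartialHomeomorph M E4) : Tetrad where
  l := fun a y => ((θ.l (e.symm y) (coordVec e y a) : ℝ) : ℂ)
  n := fun a y => ((θ.n (e.symm y) (coordVec e y a) : ℝ) : ℂ)
  m := fun a y => θ.m (e.symm y) (coordVec e y a)

/-- The part of the coordinate domain of `e` that lies over `U`. -/
def chartDom (e : OpenPartialHomeomorph M E4) (U : Set M) : Set E4 :=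
  e.target ∩ e.symm ⁻¹' U

/-- `θ` is a smooth null tetrad on `U`: `g_{ab} = 2 l_{(a} n_{b)} - 2 m_{(a} \bar m_{b)}`. As `g`
is nondegenerate, this says that `l_a n^a = 1 = - m_a \bar m^a` and that all other contractions
of two of `l, n, m, \bar m` vanish. -/
structure Coframe.IsNullTetradOn (θ : Coframe M) (g : LorentzMetric M) (U : Set M) : Prop where
  smooth : ∀ e ∈ IsManifold.maximalAtlas (𝓡 4) ∞ M, ∀ a,
    ContDiffOn ℝ ∞ ((θ.comp e).l a) (chartDom e U)
      ∧ ContDiffOn ℝ ∞ ((θ.comp e).n a) (chartDom e U)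
      ∧ ContDiffOn ℝ ∞ ((θ.comp e).m a) (chartDom e U)
  metric : ∀ x ∈ U, ∀ v w, ((g.val x v w : ℝ) : ℂ)
    = (θ.l x v : ℂ) * (θ.n x w : ℂ) + (θ.n x v : ℂ) * (θ.l x w : ℂ)
      - θ.m x v * starRingEnd ℂ (θ.m x w) - starRingEnd ℂ (θ.m x v) * θ.m x w

/-- The null tetrad `θ` is principal on `U` for a Weyl tensor of Petrov type D: the only
nonvanishing Weyl scalar is `Ψ₂`, and it vanishes nowhere. -/
def Coframe.IsPrincipalOn (θ : Coframe M) (g : LorentzMetric M) (U : Set M) : Prop :=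
  ∀ e ∈ IsManifold.maximalAtlas (𝓡 4) ∞ M, ∀ y ∈ chartDom e U,
    (θ.comp e).Psi0 (g.comp e) y = 0 ∧ (θ.comp e).Psi1 (g.comp e) y = 0
      ∧ (θ.comp e).Psi2 (g.comp e) y ≠ 0
      ∧ (θ.comp e).Psi3 (g.comp e) y = 0 ∧ (θ.comp e).Psi4 (g.comp e) y = 0

/-- A Petrov type D structure on `(M, g)`: local principal null tetrads whose domains cover `M`.
On overlaps they have the same pair of principal null directions and are related by the residual
gauge freedom `o ↦ μ o`, `ι ↦ μ⁻¹ ι` of the spin dyad, written with `ζ = μ²`: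
`l ↦ |ζ| l`, `n ↦ |ζ|⁻¹ n`, `m ↦ (ζ / |ζ|) m`. -/
structure TypeD (g : LorentzMetric M) (κ : Type*) where
  dom : κ → Set M
  isOpen_dom : ∀ i, IsOpen (dom i)
  cover : ∀ x, ∃ i, x ∈ dom i
  frame : κ → Coframe M
  isNull : ∀ i, (frame i).IsNullTetradOn g (dom i)
  isPrincipal : ∀ i, (frame i).IsPrincipalOn g (dom i)
  /-- the gauge transformations `ζ` on overlaps -/
  trans : κ → κ → M → ℂ
  trans_ne_zero : ∀ i j, ∀ x ∈ dom i ∩ dom j, trans i j x ≠ 0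
  trans_l : ∀ i j, ∀ x ∈ dom i ∩ dom j, ∀ v,
    (frame i).l x v = ‖trans i j x‖ * (frame j).l x v
  trans_n : ∀ i j, ∀ x ∈ dom i ∩ dom j, ∀ v,
    (frame i).n x v = ‖trans i j x‖⁻¹ * (frame j).n x v
  trans_m : ∀ i j, ∀ x ∈ dom i ∩ dom j, ∀ v,
    (frame i).m x v = (trans i j x / (‖trans i j x‖ : ℂ)) * (frame j).m x v

variable {g : LorentzMetric M} {κ : Type*}

/-- A smooth global choice of the cube root `Ψ₂^{1/3}`. -/
structure TypeD.IsCubeRoot (D : TypeD g κ) (ψ : M → ℂ) : Prop where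
  smooth : ContMDiff (𝓡 4) 𝓘(ℝ, ℂ) ∞ ψ
  pow_three : ∀ i, ∀ e ∈ IsManifold.maximalAtlas (𝓡 4) ∞ M, ∀ y ∈ chartDom e (D.dom i),
    ψ (e.symm y) ^ 3 = ((D.frame i).comp e).Psi2 (g.comp e) y

/-- A smooth weighted scalar of type `{2s,0}` (spin weight `s`): a function for each local
tetrad, with `Φ ↦ μ^{2s} Φ = ζ^s Φ` under a change of tetrad. -/
structure WeightedScalar (D : TypeD g κ) (s : ℤ) where
  val : κ → M → ℂ
  smooth : ∀ i, ContMDiffOn (𝓡 4) 𝓘(ℝ, ℂ) ∞ (val i) (D.dom i)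
  trans : ∀ i j, ∀ x ∈ D.dom i ∩ D.dom j, val i x = D.trans i j x ^ s * val j x

/-- `Φ` solves the Teukolsky equation of spin weight `s`. -/
def WeightedScalar.SolvesTeukolsky {D : TypeD g κ} {s : ℤ} (Φ : WeightedScalar D s)
    (lam : ℝ) : Prop :=
  ∀ i, ∀ e ∈ IsManifold.maximalAtlas (𝓡 4) ∞ M, ∀ y ∈ chartDom e (D.dom i),
    ((D.frame i).comp e).teukolsky (g.comp e) lam s (Φ.val i ∘ e.symm) y = 0

/-- The components in the chart `e`, over `D.dom i`, of the reconstructed perturbation, computed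
with the `i`-th tetrad. -/
def WeightedScalar.perturbation {D : TypeD g κ} {s : ℤ} (Φ : WeightedScalar D s) (ψ : M → ℂ)
    (i : κ) (e : OpenPartialHomeomorph M E4) : F2 :=
  ((D.frame i).comp e).recon (g.comp e) (ψ ∘ e.symm) s (Φ.val i ∘ e.symm)

end Manifold

end TypeDRec

end

open TypeDRec

/-! In a vacuum type D background the Bianchi identities and `Ψ₂ ≠ 0` force both principal
congruences to be geodesic and shear free, and they express `dΨ₂` through `ρ, τ, ρ', τ'`
(`PrincipalFraming.bianchi`). With the Newman-Penrose equations this closes up into a small calculus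
of weighted derivations `þ, þ', ð, ð'`, axiomatized as `TypeDAlgebra`.

Take `s = -2`. Because `þ` and `ð` multiply `Ψ₂^{1/3}` by `ρ` and `τ`, the factor `Ψ₂^{4/3}` makes
the first divergence of the Hertz potential equal, up to that factor, to an expression in `A =
(þ+3ρ)Φ` and `B = (ð+3τ)Φ`. The factor `Ψ₂^{-4/3}` removes it again, and the second divergence gives
`h = -(x ll - y(lm+ml) + z mm)` with `x = (ð-τ)B`, `z = (þ-ρ)A` and a mixed second derivative `y`.
The commutator `[þ,ð]` relates the two mixed derivatives `ðA` and `þB`, and this identifies `h` with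
the Kegeles–Cohen form.

Such an `h` lives on the totally null plane spanned by `l, m`, so it is trace free and `h g⁻¹ h =
0`. The inverse of `g + εh` is therefore exactly affine in `ε`, the Einstein tensor along the line
is polynomial in `ε`, and only its linear coefficient has to vanish (`exists_remainder`). By
Palatini's formula for trace-free `h` this says `∇^c(∇_a h_{bc} + ∇_b h_{ac} - ∇_c h_{ab}) + 12Λ
h_{ab} = 0` with `Λ = λ/6`. The Teukolsky operator equals `2(þ'A - ð'B - ρ̄'A + τ̄B - 3Ψ₂Φ)`
(`DebyeJet.teuk_eq`). Solving the equation for `þ'A` and commuting gives `þ'z` and `þ'y`, after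
which every frame component of the linearized equation is an identity (`DebyeJet.flin_eq_zero`).

The operators `þ, ð, …` depend on the weight of their argument, so they are not derivations of the
ring of functions. They become derivations on its group algebra over `ℤ × ℤ`, graded by weight
(`PrincipalTetrad.graded`). All identities are proved there, and homogeneous coefficients are
compared afterwards. Analysis enters only through the ring `Smooth U` with its partial derivatives
and complex conjugation.

For `s = 2`, exchange `l` with `n` and `m` with its conjugate. From `dΨ₂^{1/3} = -Ψ₂^{1/3}(B + B')`
for the one-forms `B_a = -ρ n_a + τ m̄_a` and its primed version, the scalar `Ψ₂^{-4/3}Φ` is a spin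
weight `-2` solution for the exchanged tetrad (`teuk_prime`), and its Hertz potential is the given
one. Tetrad independence holds because a gauge change multiplies `⁰M`, `²M` by `ζ`, `ζ⁻¹`, which the
weight of `Φ` compensates. -/

set_option linter.unusedSimpArgs false
set_option linter.unusedTactic false
set_option linter.unreachableTactic false

/-! ### The linearized equation in the weighted calculus of a type D background -/

namespace TypeDRec

/-- Trace of a bilinear expression in the frame metric of a null tetrad. -/
def etaTr {G : Type*} [CommRing G] (t : Fin 4 → Fin 4 → G) : G := t 0 1 + t 1 0 - t 2 3 - t 3 2

/-- The connection term `Σ_m (ω_k)_i{}^m t_m`. -/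
def conn {G : Type*} [CommRing G] (r : Fin 4 → Fin 4 → Fin 4 → G) (k i : Fin 4) (t : Fin 4 → G) : G :=
  r k i 1 * t 0 + r k i 0 * t 1 - r k i 3 * t 2 - r k i 2 * t 3

section FrameCov

variable {G : Type*} [CommRing G] (X : Fin 4 → Derivation ℤ G G) (r : Fin 4 → Fin 4 → Fin 4 → G)

/-- The direction of differentiation is the first index, and all indices are lower frame indices.
When the `X k` are weighted derivatives, `r` keeps only the part of the connection not absorbed by
the weights. -/
def fcov1 (t : Fin 4 → G) (k i : Fin 4) : G := X k (t i) - conn r k i t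
def fcov2 (t : Fin 4 → Fin 4 → G) (k i j : Fin 4) : G :=
  X k (t i j) - conn r k i (fun m => t m j) - conn r k j (fun m => t i m)
def fcov3 (t : Fin 4 → Fin 4 → Fin 4 → G) (k i j p : Fin 4) : G :=
  X k (t i j p) - conn r k i (fun m => t m j p) - conn r k j (fun m => t i m p)
    - conn r k p (fun m => t i j m)
def fcov4 (t : Fin 4 → Fin 4 → Fin 4 → Fin 4 → G) (k i j p q : Fin 4) : G :=
  X k (t i j p q) - conn r k i (fun m => t m j p q) - conn r k j (fun m => t i m p q)
    - conn r k p (fun m => t i j m q) - conn r k q (fun m => t i j p m)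

/-- This is twice the variation of the Christoffel symbols with lowered first index. Its divergence
`flin` is `-2` times the variation of the Ricci tensor when `h` is trace free. -/
def fdh (h : Fin 4 → Fin 4 → G) (c a b : Fin 4) : G :=
    fcov2 X r h a b c + fcov2 X r h b a c - fcov2 X r h c a b
def flin (h : Fin 4 → Fin 4 → G) (a b : Fin 4) : G :=
  etaTr fun e c => fcov3 X r (fdh X r h) e c a b

variable {t : Fin 4 → Fin 4 → G}

theorem fcov2_symm (hs : ∀ i j, t i j = t j i) (k i j : Fin 4) :
    fcov2 X r t k i j = fcov2 X r t k j i := by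
  unfold fcov2
  rw [hs i j, show (fun m => t m j) = fun m => t j m from funext fun m => hs m j,
    show (fun m => t m i) = fun m => t i m from funext fun m => hs m i]
  ring

theorem fdh_symm (hs : ∀ i j, t i j = t j i) (c i j : Fin 4) :
    fdh X r t c i j = fdh X r t c j i := by
  unfold fdh
  rw [fcov2_symm X r hs c i j]
  ring

theorem flin_symm (hs : ∀ i j, t i j = t j i) (a b : Fin 4) : flin X r t a b = flin X r t b a := by
  have h3 := fdh_symm X r hs
  unfold flin
  congr 1
  funext e c
  unfold fcov3
  rw [h3 c a b, show (fun m => fdh X r t m a b) = fun m => fdh X r t m b a from funext fun m => h3 m a b,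
    show (fun m => fdh X r t c m b) = fun m => fdh X r t c b m from funext fun m => h3 c m b,
    show (fun m => fdh X r t c m a) = fun m => fdh X r t c a m from funext fun m => h3 c m a]
  ring
end FrameCov

/-- The weighted calculus of a vacuum type D background in a principal null tetrad: the derivations
`X 0, X 1, X 2, X 3` are `þ, þ', ð, ð'`, the derivations `P`, `Q` multiply a quantity of type
`{p,q}` by `p`, `q`. -/
structure TypeDAlgebra (G : Type*) [CommRing G] where
  X : Fin 4 → Derivation ℤ G G
  P : Derivation ℤ G G
  Q : Derivation ℤ G G
  (ρ ρ' τ τ' ρt ρt' τt τt' Ψ Ψt Λ : G)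
  x0_rho : X 0 ρ = ρ * ρ
  x2_rho : X 2 ρ = τ * (ρ - ρt)
  x0_tau : X 0 τ = ρ * (τ - τt')
  x2_tau : X 2 τ = τ * τ
  x1_rho : X 1 ρ = X 3 τ + ρ * ρt' - τ * τt - Ψ - 2 * Λ
  x1_rho' : X 1 ρ' = ρ' * ρ'
  x3_rho' : X 3 ρ' = τ' * (ρ' - ρt')
  x1_tau' : X 1 τ' = ρ' * (τ' - τt)
  x3_tau' : X 3 τ' = τ' * τ'
  x0_rho' : X 0 ρ' = X 2 τ' + ρ' * ρt - τ' * τt' - Ψ - 2 * Λ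
  x0_rhot : X 0 ρt = ρt * ρt
  x3_rhot : X 3 ρt = τt * (ρt - ρ)
  x0_taut : X 0 τt = ρt * (τt - τ')
  x3_taut : X 3 τt = τt * τt
  x1_rhot : X 1 ρt = X 2 τt + ρt * ρ' - τt * τ - Ψt - 2 * Λ
  x1_rhot' : X 1 ρt' = ρt' * ρt'
  x2_rhot' : X 2 ρt' = τt' * (ρt' - ρ')
  x1_taut' : X 1 τt' = ρt' * (τt' - τ)
  x2_taut' : X 2 τt' = τt' * τt'
  x0_rhot' : X 0 ρt' = X 3 τt' + ρt' * ρ - τt' * τ' - Ψt - 2 * Λ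
  x0_psi : X 0 Ψ = 3 * ρ * Ψ
  x1_psi : X 1 Ψ = 3 * ρ' * Ψ
  x2_psi : X 2 Ψ = 3 * τ * Ψ
  x3_psi : X 3 Ψ = 3 * τ' * Ψ
  x_lam : ∀ k, X k Λ = 0
  comm01 : ∀ f, X 1 (X 0 f) = X 0 (X 1 f) - ((τt - τ') * X 2 f + (τ - τt') * X 3 f
    - (Ψ - Λ - τ * τ') * P f - (Ψt - Λ - τt * τt') * Q f)
  comm02 : ∀ f, X 2 (X 0 f) = X 0 (X 2 f) - (ρt * X 2 f - τt' * X 0 f + ρt * τt' * Q f)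
  comm03 : ∀ f, X 3 (X 0 f) = X 0 (X 3 f) - (ρ * X 3 f - τ' * X 0 f + ρ * τ' * P f)
  comm12 : ∀ f, X 2 (X 1 f) = X 1 (X 2 f) - (ρ' * X 2 f - τ * X 1 f - ρ' * τ * P f)
  comm13 : ∀ f, X 3 (X 1 f) = X 1 (X 3 f) - (ρt' * X 3 f - τt * X 1 f - ρt' * τt * Q f)
  comm23 : ∀ f, X 3 (X 2 f) = X 2 (X 3 f) - ((ρt' - ρ') * X 0 f + (ρ - ρt) * X 1 f
    + (ρ * ρ' + Ψ - Λ) * P f - (ρt * ρt' + Ψt - Λ) * Q f)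
  p_x0 : ∀ f, P (X 0 f) = X 0 (P f) + X 0 f
  p_x1 : ∀ f, P (X 1 f) = X 1 (P f) - X 1 f
  p_x2 : ∀ f, P (X 2 f) = X 2 (P f) + X 2 f
  p_x3 : ∀ f, P (X 3 f) = X 3 (P f) - X 3 f
  q_x0 : ∀ f, Q (X 0 f) = X 0 (Q f) + X 0 f
  q_x1 : ∀ f, Q (X 1 f) = X 1 (Q f) - X 1 f
  q_x2 : ∀ f, Q (X 2 f) = X 2 (Q f) - X 2 f
  q_x3 : ∀ f, Q (X 3 f) = X 3 (Q f) + X 3 f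
  p_rho : P ρ = ρ
  p_tau : P τ = τ
  p_rho' : P ρ' = -ρ'
  p_tau' : P τ' = -τ'
  p_rhot : P ρt = ρt
  p_taut : P τt = -τt
  p_rhot' : P ρt' = -ρt'
  p_taut' : P τt' = τt'
  q_rho : Q ρ = ρ
  q_tau : Q τ = -τ
  q_rho' : Q ρ' = -ρ'
  q_tau' : Q τ' = τ'
  q_rhot : Q ρt = ρt
  q_taut : Q τt = τt
  q_rhot' : Q ρt' = -ρt'
  q_taut' : Q τt' = -τt'
  p_psi : P Ψ = 0
  q_psi : Q Ψ = 0

namespace TypeDAlgebra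

variable {G : Type*} [CommRing G] (T : TypeDAlgebra G)

/-- The rotation coefficients in the frame `l, n, m, mt`. -/
def rot : Fin 4 → Fin 4 → Fin 4 → G :=
  ![![![0, 0, 0, 0], ![0, 0, T.τt', T.τ'], ![0, -T.τt', 0, 0], ![0, -T.τ', 0, 0]],
    ![![0, 0, T.τ, T.τt], ![0, 0, 0, 0], ![-T.τ, 0, 0, 0], ![-T.τt, 0, 0, 0]],
    ![![0, 0, 0, T.ρt], ![0, 0, 0, T.ρ'], ![0, 0, 0, 0], ![-T.ρt, -T.ρ', 0, 0]],
    ![![0, 0, T.ρ, 0], ![0, 0, T.ρt', 0], ![-T.ρ, -T.ρt', 0, 0], ![0, 0, 0, 0]]]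

/-- A symmetric tensor `x l l - y (l m + m l) + z m m` by its frame components. -/
def nullTensor (x y z : G) : Fin 4 → Fin 4 → G :=
  ![![0, 0, 0, 0], ![0, x, 0, y], ![0, 0, 0, 0], ![0, y, 0, z]]


/-- The Teukolsky operator of spin weight `-2`. -/
def teuk (f : G) : G :=
  let B : Fin 4 → G := ![-T.ρ, 0, -T.τ, 0]
  let w : Fin 4 → G := fun k => T.X k f - 4 * B k * f
  etaTr (fun k j => fcov1 T.X T.rot w k j - 4 * B k * w j) - 16 * T.Ψ * f + 4 * T.Λ * f

/-- A Debye potential `f` together with its iterated twisted derivatives along `l` and `m`: the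
first derivatives `A`, `B` and the second derivatives `z`, `y`, `x`. -/
structure DebyeJet (f A B x y z : G) : Prop where
  p_f : T.P f = -4 * f
  q_f : T.Q f = 0
  x0_f : T.X 0 f = A - 3 * T.ρ * f
  x2_f : T.X 2 f = B - 3 * T.τ * f
  x0_a : T.X 0 A = z + T.ρ * A
  x2_a : T.X 2 A = y - (T.ρt - 2 * T.ρ) * B - T.τ * A
  x2_b : T.X 2 B = x + T.τ * B

theorem der_two (D : Derivation ℤ G G) : D (2 : G) = 0 := D.map_natCast 2
theorem der_three (D : Derivation ℤ G G) : D (3 : G) = 0 := D.map_natCast 3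
theorem der_four (D : Derivation ℤ G G) : D (4 : G) = 0 := D.map_natCast 4

variable {T} {f A B x y z : G}

namespace DebyeJet

/-- The operators `X k` shift the weights by fixed amounts, so the weights of the whole jet are
forced by those of `f`. They are needed whenever a commutator is applied to a jet variable. -/
theorem p_a (h : T.DebyeJet f A B x y z) : T.P A = -3 * A := by
  have e := T.p_x0 f
  rw [h.x0_f, h.p_f] at e
  simp only [map_sub, map_mul, map_neg, Derivation.leibniz, smul_eq_mul, der_two, der_three, der_four, T.p_rho, h.p_f, h.x0_f] at e
  linear_combination e

theorem q_a (h : T.DebyeJet f A B x y z) : T.Q A = A := by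
  have e := T.q_x0 f
  rw [h.x0_f, h.q_f] at e
  simp only [map_sub, map_zero, Derivation.leibniz, smul_eq_mul, der_two, der_three, der_four, T.q_rho, h.q_f] at e
  linear_combination e

theorem p_b (h : T.DebyeJet f A B x y z) : T.P B = -3 * B := by
  have e := T.p_x2 f
  rw [h.x2_f, h.p_f] at e
  simp only [map_sub, map_neg, Derivation.leibniz, smul_eq_mul, der_two, der_three, der_four, T.p_tau, h.p_f, h.x2_f] at e
  linear_combination e

theorem q_b (h : T.DebyeJet f A B x y z) : T.Q B = -B := by
  have e := T.q_x2 f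
  rw [h.x2_f, h.q_f] at e
  simp only [map_sub, map_zero, Derivation.leibniz, smul_eq_mul, der_two, der_three, der_four, T.q_tau, h.q_f] at e
  linear_combination e

/-- Integrability of the first-order jet: `[þ, ð]` on `f` expresses `þB` through the same `y` that
was introduced for `ðA`. Hence one mixed second derivative suffices. -/
theorem x0_b (h : T.DebyeJet f A B x y z) :
    T.X 0 B = y - T.ρ * B + (2 * T.τ - T.τt') * A := by
  have e := T.comm02 f
  rw [h.x0_f, h.x2_f, h.q_f] at e
  simp only [map_sub, Derivation.leibniz, smul_eq_mul, der_two, der_three, der_four, T.x2_rho, T.x0_tau, h.x0_f, h.x2_f,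
    h.x2_a] at e
  linear_combination -e

theorem q_z (h : T.DebyeJet f A B x y z) : T.Q z = 2 * z := by
  have e := T.q_x0 A
  rw [h.x0_a, h.q_a] at e
  simp only [map_add, Derivation.leibniz, smul_eq_mul, T.q_rho, h.q_a, h.x0_a] at e
  linear_combination e

theorem p_z (h : T.DebyeJet f A B x y z) : T.P z = -2 * z := by
  have e := T.p_x0 A
  rw [h.x0_a, h.p_a] at e
  simp only [map_add, map_neg, Derivation.leibniz, smul_eq_mul, T.p_rho, h.p_a, h.x0_a,
    der_three] at e
  linear_combination e

theorem q_y (h : T.DebyeJet f A B x y z) : T.Q y = 0 := by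
  have e := T.q_x0 B
  rw [h.x0_b, h.q_b] at e
  simp only [map_add, map_sub, map_neg, Derivation.leibniz, smul_eq_mul, T.q_rho, T.q_tau, T.q_taut',
    h.q_a, h.q_b, h.x0_b, der_two] at e
  linear_combination e

theorem p_y (h : T.DebyeJet f A B x y z) : T.P y = -2 * y := by
  have e := T.p_x0 B
  rw [h.x0_b, h.p_b] at e
  simp only [map_add, map_sub, map_neg, Derivation.leibniz, smul_eq_mul, T.p_rho, T.p_tau, T.p_taut',
    h.p_a, h.p_b, h.x0_b, der_two, der_three] at e
  linear_combination e

theorem q_x (h : T.DebyeJet f A B x y z) : T.Q x = -2 * x := by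
  have e := T.q_x2 B
  rw [h.x2_b, h.q_b] at e
  simp only [map_add, map_neg, Derivation.leibniz, smul_eq_mul, T.q_tau, h.q_b, h.x2_b] at e
  linear_combination e

theorem p_x (h : T.DebyeJet f A B x y z) : T.P x = -2 * x := by
  have e := T.p_x2 B
  rw [h.x2_b, h.p_b] at e
  simp only [map_add, map_neg, Derivation.leibniz, smul_eq_mul, T.p_tau, h.p_b, h.x2_b,
    der_three] at e
  linear_combination e

/-- Integrability one order higher: `[þ, ð]` on `A` ties `ðz` to `þy`. The same commutator on `B`
ties `ðy` to `þx` in `x2_y`. -/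
theorem x2_z (h : T.DebyeJet f A B x y z) : T.X 2 z = T.X 0 y + 2 * A * T.ρ * T.τ
    - 2 * B * T.ρ * T.ρ + T.τt' * z + T.ρ * y - 2 * T.ρt * y - T.τ * z := by
  have e := T.comm02 A
  rw [h.x0_a, h.x2_a, h.q_a] at e
  simp only [map_sub, map_add, Derivation.leibniz, smul_eq_mul, der_two, der_three, der_four, T.x2_rho, T.x0_tau, T.x0_rho,
    T.x0_rhot, h.x0_a, h.x2_a, h.x0_b] at e
  linear_combination e

theorem x2_y (h : T.DebyeJet f A B x y z) : T.X 2 y = T.X 0 x + 2 * A * T.τ * T.τ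
    - 2 * B * T.ρ * T.τ + 2 * T.τt' * y + T.ρ * x - T.ρt * x - T.τ * y := by
  have e := T.comm02 B
  rw [h.x0_b, h.x2_b, h.q_b] at e
  simp only [map_sub, map_add, Derivation.leibniz, smul_eq_mul, der_two, der_three, der_four, T.x2_rho, T.x0_tau,
    T.x2_tau, T.x2_taut', h.x0_b, h.x2_b, h.x2_a] at e
  linear_combination e

/-- The wave operator contains `þþ' + þ'þ - ðð' - ð'ð`. The commutators `[þ,þ']` and `[ð,ð']` reduce
this to twice `þ'þ - ð'ð`, which factors through `A` and `B`. -/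
theorem teuk_eq (h : T.DebyeJet f A B x y z) : T.teuk f
    = 2 * (T.X 1 A - T.X 3 B - T.ρt' * A + T.τt * B - 3 * T.Ψ * f) := by
  have e1 := T.comm01 f
  have e2 := T.comm23 f
  rw [h.x0_f] at e1
  rw [h.x2_f] at e2
  simp only [map_sub, Derivation.leibniz, smul_eq_mul, der_two, der_three, der_four, T.x1_rho, h.x0_f, h.x2_f, h.p_f,
    h.q_f] at e1 e2
  simp only [teuk, etaTr, fcov1, conn, rot, Matrix.cons_val, h.x0_f, h.x2_f, map_add, map_sub, map_neg, map_zero,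
    Derivation.leibniz, smul_eq_mul, der_two, der_three, der_four, T.x1_rho]
  linear_combination e2 - e1

theorem x1_a (h : T.DebyeJet f A B x y z) (h0 : T.teuk f = 0) (h2 : ∀ u : G, 2 * u = 0 → u = 0) :
    T.X 1 A = T.X 3 B + T.ρt' * A - T.τt * B + 3 * T.Ψ * f := by
  rw [h.teuk_eq] at h0
  linear_combination h2 _ h0

/-- Prolongation of the Teukolsky equation: `þ'` is commuted past `þ` in the second-order quantity
`z`, and `[þ, ð']` on `B` converts the result into `ð'y`. The analogue for `y` uses `[þ', ð]` on `A`
and `[ð, ð']` on `B`. -/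
theorem x1_z (h : T.DebyeJet f A B x y z)
    (h1 : T.X 1 A = T.X 3 B + T.ρt' * A - T.τt * B + 3 * T.Ψ * f) :
    T.X 1 z = T.X 3 y + 2 * A * T.Λ + A * T.Ψ + A * T.X 3 T.τ + T.X 3 A * T.τ - B * T.X 3 T.ρ
      - T.X 3 B * T.ρ + T.ρt' * z - 3 * T.Ψ * T.ρ * f - 2 * T.τt * y := by
  have e := T.comm01 A
  have e' := T.comm03 B
  rw [h.x0_a, h1, h.q_a, h.p_a] at e
  rw [h.x0_b, h.p_b] at e'
  simp only [map_sub, map_add, Derivation.leibniz, smul_eq_mul, der_two, der_three, der_four, T.x1_rho,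
    T.x0_taut, T.x0_rhot', T.x0_psi, h.x0_a, h.x2_a, h.x0_b, h.x0_f, h1] at e e'
  linear_combination e - e'

theorem x1_y (h : T.DebyeJet f A B x y z)
    (h1 : T.X 1 A = T.X 3 B + T.ρt' * A - T.τt * B + 3 * T.Ψ * f) :
    T.X 1 y = T.X 3 x + A * T.ρt' * T.τ + A * T.X 1 T.τ + 4 * B * T.Λ - B * T.ρt' * T.ρ
      + 2 * B * T.Ψ - B * T.X 3 T.τ + T.X 3 B * T.τ - T.X 1 B * T.ρ + 2 * T.ρt' * y - T.τt * x := by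
  have e := T.comm12 A
  have e' := T.comm23 B
  rw [h.x2_a, h1, h.p_a] at e
  rw [h.x2_b, h.p_b, h.q_b] at e'
  simp only [map_sub, map_add, Derivation.leibniz, smul_eq_mul, der_two, der_three, der_four, T.x1_rho,
    T.x1_rhot, T.x2_rhot', T.x2_psi, h.x0_b, h.x2_a, h.x2_b, h.x2_f, h1] at e e'
  linear_combination -e - e'

end DebyeJet

theorem nullTensor_symm (x y z : G) (i j : Fin 4) :
    nullTensor x y z i j = nullTensor x y z j i := by
  fin_cases i <;> fin_cases j <;> rfl

set_option maxHeartbeats 4000000 in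
-- The core computation. The Teukolsky equation and its prolongations eliminate `þ'A`, `þ'z`, `þ'y`;
-- the integrability conditions eliminate `ðz`, `ðy`; the spin equations eliminate derivatives of
-- the coefficients. Once mixed derivatives stand in a fixed order, each component is a polynomial
-- identity.
theorem DebyeJet.flin_eq_zero (h : T.DebyeJet f A B x y z)
    (h1 : T.X 1 A = T.X 3 B + T.ρt' * A - T.τt * B + 3 * T.Ψ * f) (a b : Fin 4) :
    flin T.X T.rot (nullTensor x y z) a b + 12 * T.Λ * nullTensor x y z a b = 0 := by
  -- Symmetry leaves ten of the sixteen components.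
  wlog hab : a ≤ b generalizing a b
  · have := this b a (le_of_not_ge hab)
    rwa [nullTensor_symm x y z b a,
      flin_symm T.X T.rot (nullTensor_symm x y z) b a] at this
  have y2 := h.x2_y
  have z2 := h.x2_z
  have y1 := h.x1_y h1
  have z1 := h.x1_z h1
  -- The commutators are also needed in the opposite direction, so that `þ` and `ð` act first on the
  -- variables where their effect is already known.
  have hc03 : ∀ u, T.X 0 (T.X 3 u) = _ := fun u => sub_eq_iff_eq_add.1 (T.comm03 u).symm
  have hc23 : ∀ u, T.X 2 (T.X 3 u) = _ := fun u => sub_eq_iff_eq_add.1 (T.comm23 u).symm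
  have hc01 : ∀ u, T.X 0 (T.X 1 u) = _ := fun u => sub_eq_iff_eq_add.1 (T.comm01 u).symm
  have t03 := hc03 T.τ
  have t23 := hc23 T.τ
  have t01 := hc01 T.τ
  have r03 := hc03 T.ρ
  have r23 := hc23 T.ρ
  have a03 := hc03 A
  have b03 := hc03 B
  have b01 := hc01 B
  have a23 := hc23 A
  have b23 := hc23 B
  have y23 := hc23 y
  have z23 := hc23 z
  simp only [T.x0_tau, T.x2_tau, T.x0_rho, T.x2_rho, h.x0_a, h.x2_a, h.x0_b, h.x2_b, y2, z2, T.p_tau,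
    T.q_tau, T.p_rho, T.q_rho, h.p_a, h.q_a, h.p_b, h.q_b, h.p_y, h.q_y, h.p_z, h.q_z, map_sub, map_add,
    map_neg, map_zero,
    Derivation.leibniz, smul_eq_mul, der_two] at t03 t23 t01 r03 r23 a03 b03 b01 a23 b23 y23 z23
  clear hc03 hc23 hc01
  fin_cases a <;> fin_cases b <;> first | (exact absurd hab (by decide)) | skip
  all_goals
    simp only [Fin.isValue, Fin.zero_eta, Fin.mk_one, Fin.reduceFinMk, flin, etaTr, fcov3, fdh, fcov2, conn, rot,
      nullTensor, Matrix.cons_val, map_zero, mul_zero,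
      zero_mul, sub_zero, add_zero, zero_add, zero_sub, neg_mul, sub_neg_eq_add, neg_zero]
  all_goals
    try simp only [map_add, map_sub, map_neg, map_zero, Derivation.leibniz, smul_eq_mul, der_two,
      der_three, der_four, T.x0_rho, T.x2_rho, T.x0_tau, T.x2_tau, T.x1_rho, T.x1_rho', T.x3_rho',
      T.x1_tau', T.x3_tau', T.x0_rho', T.x0_rhot, T.x3_rhot, T.x0_taut, T.x3_taut, T.x1_rhot,
      T.x1_rhot', T.x2_rhot', T.x1_taut', T.x2_taut', T.x0_rhot', T.x0_psi, T.x1_psi, T.x2_psi,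
      T.x3_psi, T.x_lam, T.comm01, T.comm02, T.comm12, h.x0_f, h.x2_f, h.x0_a, h.x2_a,
      h.x0_b, h.x2_b, h1, y2, z2, y1, z1, t03, t23, t01, r03, r23, a03, b03, b01, a23, b23, y23, z23,
      T.p_tau, T.q_tau, T.p_rho, T.q_rho, h.p_a, h.q_a, h.p_b, h.q_b, h.p_y, h.q_y, h.p_z, h.q_z, h.p_x, h.q_x]
  -- The mixed derivatives still present are put into one fixed order; what remains is for `ring`.
  all_goals try simp only [T.comm03, T.comm23 x, h.p_x, h.q_x, h.p_y, h.q_y]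
  all_goals try ring

end TypeDAlgebra
end TypeDRec

/-! ### Frame divergences of the Hertz potential -/

namespace TypeDRec
namespace TypeDAlgebra
variable {G : Type*} [CommRing G] {T : TypeDAlgebra G} {f A B x y z : G}
/-- The frame components of the two-form `l ∧ m`. -/
def nullForm : Fin 4 → Fin 4 → G :=
  ![![0, 0, 0, 0], ![0, 0, 0, -1], ![0, 0, 0, 0], ![0, 1, 0, 0]]

/-- Twice the symmetrized Hertz potential with scalar factor `F`. -/
def hertzPot (F : G) (a c d b : Fin 4) : G :=
  (nullForm a c * nullForm d b + nullForm b c * nullForm d a) * F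

/-- Frame components of the divergence of `hertzPot`. -/
def hertzDer (v w : G) : Fin 4 → Fin 4 → Fin 4 → G :=
  ![![![0, 0, 0, 0], ![0, 0, 0, 0], ![0, 0, 0, 0], ![0, 0, 0, 0]],
    ![![0, 0, 0, 0], ![0, 0, 0, -w], ![0, 0, 0, 0], ![0, 2 * w, 0, v]],
    ![![0, 0, 0, 0], ![0, 0, 0, 0], ![0, 0, 0, 0], ![0, 0, 0, 0]],
    ![![0, 0, 0, 0], ![0, -w, 0, -(2 * v)], ![0, 0, 0, 0], ![0, v, 0, 0]]]

set_option maxHeartbeats 4000000 in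
-- For `F = Ψ^{4/3} f` the combinations `þF - ρF` and `ðF - τF` are `Ψ^{4/3}` times `(þ+3ρ)f` and
-- `(ð+3τ)f`. This is where the power of `Ψ` in the Hertz potential comes from.
theorem div_hertzPot (F : G) (a c b : Fin 4) :
    etaTr (fun e d => fcov4 T.X T.rot (hertzPot F) e a c d b)
      = hertzDer (T.X 0 F - T.ρ * F) (T.X 2 F - T.τ * F) a c b := by
  fin_cases a <;> fin_cases c <;> fin_cases b <;>
  · simp only [Fin.isValue, Fin.zero_eta, Fin.mk_one, Fin.reduceFinMk, etaTr, fcov4, conn, rot, hertzPot,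
      nullForm, hertzDer, Matrix.cons_val, map_zero, map_add, mul_zero, Derivation.leibniz, smul_eq_mul,
      map_neg, Derivation.map_one_eq_zero, zero_mul, sub_zero, add_zero, zero_add, zero_sub, neg_mul,
      sub_neg_eq_add, neg_zero, mul_one, one_mul, mul_neg, sub_self, neg_neg]
    try ring

/-- The mixed components involve both `ðA` and `þB`, and `x0_b` merges them into `y`. The `2` in
`-2` reflects that `hertzPot` is twice the symmetrization. -/
theorem div_hertzDer (h : T.DebyeJet f A B x y z) (a b : Fin 4) :
    etaTr (fun e c => fcov3 T.X T.rot (hertzDer A B) e a c b) = -2 * nullTensor x y z a b := by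
  fin_cases a <;> fin_cases b <;>
  · simp only [Fin.isValue, Fin.zero_eta, Fin.mk_one, Fin.reduceFinMk, etaTr, fcov3, conn, rot, nullTensor,
      hertzDer, Matrix.cons_val, map_zero, mul_zero, Derivation.leibniz, smul_eq_mul,
      map_neg, zero_mul, sub_zero, add_zero, zero_add, zero_sub, neg_mul, der_two, h.x0_a, h.x2_a,
      h.x0_b, h.x2_b,
      sub_neg_eq_add, neg_zero, mul_neg, sub_self, neg_neg]
    try ring
end TypeDAlgebra
end TypeDRec

/-! ### Null coframes: from coordinate to frame components -/

namespace TypeDRec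

/-- The frame metric of a null tetrad `l, n, m, mt`. -/
def eta {G : Type*} [CommRing G] : Fin 4 → Fin 4 → G :=
  ![![0, 1, 0, 0], ![1, 0, 0, 0], ![0, 0, 0, -1], ![0, 0, -1, 0]]

/-- Coordinate derivations, a null coframe `E i a`, the dual vectors `V i a` with raised frame
index, and the Levi-Civita connection coefficients `Γ c a b`. -/
structure Framing (G : Type*) [CommRing G] where
  D : Fin 4 → Derivation ℤ G G
  E : Fin 4 → Fin 4 → G
  V : Fin 4 → Fin 4 → G
  Γ : Fin 4 → Fin 4 → Fin 4 → G
  dual : ∀ i j, ∑ a, E i a * V j a = eta i j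
  symm : ∀ c a b, Γ c a b = Γ c b a
  compat : ∀ c a b, D c (etaTr fun i j => E i a * E j b)
    = ∑ e, Γ e c a * (etaTr fun i j => E i e * E j b)
      + ∑ e, Γ e c b * (etaTr fun i j => E i a * E j e)

section Cov

variable {G : Type*} [CommRing G] (D : Fin 4 → Derivation ℤ G G) (Γ : Fin 4 → Fin 4 → Fin 4 → G)

def ccov1 (t : Fin 4 → G) (c a : Fin 4) : G := D c (t a) - ∑ e, Γ e c a * t e
def ccov2 (t : Fin 4 → Fin 4 → G) (c a b : Fin 4) : G :=
  D c (t a b) - ∑ e, Γ e c a * t e b - ∑ e, Γ e c b * t a e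
def ccov3 (t : Fin 4 → Fin 4 → Fin 4 → G) (c i j k : Fin 4) : G :=
  D c (t i j k) - ∑ e, Γ e c i * t e j k - ∑ e, Γ e c j * t i e k - ∑ e, Γ e c k * t i j e
def ccov4 (t : Fin 4 → Fin 4 → Fin 4 → Fin 4 → G) (c i j k l : Fin 4) : G :=
  D c (t i j k l) - ∑ e, Γ e c i * t e j k l - ∑ e, Γ e c j * t i e k l - ∑ e, Γ e c k * t i j e l
    - ∑ e, Γ e c l * t i j k e

end Cov

namespace Framing

variable {G : Type*} [CommRing G] (F : Framing G)

/-- Duality exhibits a right inverse of the square coframe matrix; over a commutative ring it is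
also a left inverse, and that is completeness. -/
theorem eta_completeness (a b : Fin 4) :
    etaTr (fun i j => F.V i a * F.E j b) = if a = b then 1 else 0 := by
  have h : (Matrix.of fun i a => F.E i a) * (Matrix.of fun a i => ∑ k, F.V k a * eta k i) = 1 := by
    ext i j
    have h0 : ((Matrix.of fun i a => F.E i a) * (Matrix.of fun a i => ∑ k, F.V k a * eta k i)) i j
        = ∑ k, (∑ a, F.E i a * F.V k a) * eta k j := by
      simp only [Matrix.mul_apply, Matrix.of_apply, Fin.sum_univ_four]
      ring
    rw [h0]
    simp only [F.dual]
    fin_cases i <;> fin_cases j <;> simp [eta, Fin.sum_univ_four]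
  have hc := mul_eq_one_comm.1 h
  have h' := congrFun (congrFun hc a) b
  simp only [Matrix.mul_apply, Matrix.of_apply, Fin.sum_univ_four, etaTr, eta, Matrix.cons_val,
    Matrix.one_apply] at h' ⊢
  rw [← h']
  ring

/-- A vector is determined by its contractions with the coframe. -/
theorem eq_of_contr {u v : Fin 4 → G} (h : ∀ i, ∑ a, F.E i a * u a = ∑ a, F.E i a * v a) : u = v := by
  have key : ∀ (w : Fin 4 → G) (a : Fin 4),
      w a = etaTr fun k j => F.V k a * ∑ b, F.E j b * w b := by
    intro w a
    have : w a = ∑ b, (if a = b then 1 else 0) * w b := by simp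
    rw [this]
    simp only [← F.eta_completeness a, etaTr, Fin.sum_univ_four]
    ring
  funext a
  rw [key u a, key v a]
  simp only [h]

/-- A covector is determined by its contractions with the frame vectors. -/
theorem eq_of_contr' {u v : Fin 4 → G} (h : ∀ i, ∑ a, F.V i a * u a = ∑ a, F.V i a * v a) :
    u = v := by
  have key : ∀ (w : Fin 4 → G) (b : Fin 4),
      w b = etaTr fun k j => (∑ a, F.V k a * w a) * F.E j b := by
    intro w b
    have : w b = ∑ a, (if a = b then 1 else 0) * w a := by simp
    rw [this]
    simp only [← fun a => F.eta_completeness a b, etaTr, Fin.sum_univ_four]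
    ring
  funext a
  rw [key u a, key v a]
  simp only [h]

/-- The frame derivations. -/
def X (k : Fin 4) : Derivation ℤ G G :=
  F.V k 0 • F.D 0 + F.V k 1 • F.D 1 + F.V k 2 • F.D 2 + F.V k 3 • F.D 3

theorem X_apply (k : Fin 4) (f : G) : F.X k f = ∑ a, F.V k a * F.D a f := by
  simp [X, Fin.sum_univ_four]

/-- The rotation coefficients `V_k^c V_j^b ∇_c E_{ib}`. -/
def rot (k i j : Fin 4) : G :=
  ∑ c, ∑ b, F.V k c * F.V j b * ccov1 F.D F.Γ (F.E i) c b

theorem etaTr_eta (t : Fin 4 → G) (q : Fin 4) : etaTr (fun i j => t i * eta j q) = t q := by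
  fin_cases q <;> simp [etaTr, eta]

theorem etaTr_eta' (t : Fin 4 → G) (q : Fin 4) : etaTr (fun i j => eta i q * t j) = t q := by
  fin_cases q <;> simp [etaTr, eta]

/-- Metric compatibility, contracted with `V k`, `V p` and `V q`. -/
theorem rot_antisymm (k p q : Fin 4) : F.rot k p q = -F.rot k q p := by
  have hc : ∀ c a b, etaTr (fun i j => ccov1 F.D F.Γ (F.E i) c a * F.E j b
      + F.E i a * ccov1 F.D F.Γ (F.E j) c b) = 0 := by
    intro c a b
    have h := F.compat c a b
    simp only [etaTr, ccov1, map_add, map_sub, Derivation.leibniz, smul_eq_mul,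
      Fin.sum_univ_four] at h ⊢
    linear_combination h
  have h0 : ∑ c, F.V k c * ∑ a, F.V p a * ∑ b, F.V q b * etaTr (fun i j =>
      ccov1 F.D F.Γ (F.E i) c a * F.E j b + F.E i a * ccov1 F.D F.Γ (F.E j) c b) = 0 := by
    simp [hc]
  have h1 : ∑ c, F.V k c * ∑ a, F.V p a * ∑ b, F.V q b * etaTr (fun i j =>
      ccov1 F.D F.Γ (F.E i) c a * F.E j b + F.E i a * ccov1 F.D F.Γ (F.E j) c b)
      = etaTr (fun i j => F.rot k i p * ∑ b, F.E j b * F.V q b)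
        + etaTr (fun i j => (∑ b, F.E i b * F.V p b) * F.rot k j q) := by
    simp only [rot, etaTr, Fin.sum_univ_four]
    ring
  simp only [F.dual] at h1
  rw [etaTr_eta, etaTr_eta', h0] at h1
  linear_combination -h1

/-- `∇_k V_i` in the frame. -/
theorem X_V (k i a : Fin 4) : F.X k (F.V i a) + ∑ c, F.V k c * ∑ e, F.Γ a c e * F.V i e
    = conn F.rot k i (fun m => F.V m a) := by
  revert a
  rw [← funext_iff]
  apply F.eq_of_contr
  intro j
  have h1 : F.X k (∑ a, F.E j a * F.V i a) = 0 := by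
    rw [F.dual]
    fin_cases i <;> fin_cases j <;> simp [eta]
  have h2 : F.rot k j i = ∑ c, ∑ b, F.V k c * F.V i b * ccov1 F.D F.Γ (F.E j) c b := rfl
  have h3 : ∑ a, F.E j a * conn F.rot k i (fun m => F.V m a)
      = conn F.rot k i (fun m => ∑ a, F.E j a * F.V m a) := by
    simp only [conn, Fin.sum_univ_four]
    ring
  have h4 : conn F.rot k i (fun m => eta j m) = F.rot k i j := by
    fin_cases j <;> simp [conn, eta]
  rw [h3]
  simp only [F.dual]
  rw [h4, F.rot_antisymm k i j, h2]
  simp only [X_apply, ccov1, map_add, Derivation.leibniz, smul_eq_mul, Fin.sum_univ_four] at h1 ⊢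
  linear_combination h1

/-- Contraction of one index with the frame vector `V_i`. -/
def con (i : Fin 4) (t : Fin 4 → G) : G := ∑ a, F.V i a * t a

theorem con_sub (i : Fin 4) (s t : Fin 4 → G) :
    F.con i (fun a => s a - t a) = F.con i s - F.con i t := by
  simp [con, mul_sub]

theorem con_add (i : Fin 4) (s t : Fin 4 → G) :
    F.con i (fun a => s a + t a) = F.con i s + F.con i t := by
  simp [con, mul_add, Finset.sum_add_distrib]

theorem con_conn (i : Fin 4) (r : Fin 4 → Fin 4 → Fin 4 → G) (k p : Fin 4)
    (t : Fin 4 → Fin 4 → G) :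
    F.con i (fun a => conn r k p (fun m => t m a)) = conn r k p (fun m => F.con i (t m)) := by
  simp only [con, conn, Fin.sum_univ_four]
  ring

theorem con_mul_sum (i : Fin 4) (g : Fin 4 → G) (t : Fin 4 → Fin 4 → G) :
    F.con i (fun a => ∑ e, g e * t a e) = ∑ e, g e * F.con i (fun a => t a e) := by
  simp only [con, Fin.sum_univ_four]
  ring

/-- The connection coefficients with the derivative index contracted with `V_k`. -/
def gam (k e a : Fin 4) : G := ∑ c, F.V k c * F.Γ e c a

/-- The whole passage to frame components rests on this one-slot identity. The derivative of the
frame vector, computed by `X_V`, trades the connection coefficient for a rotation coefficient. -/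
theorem con_slot (k i : Fin 4) (t : Fin 4 → G) :
    F.con i (fun a => F.X k (t a) - ∑ e, F.gam k e a * t e)
      = F.X k (F.con i t) - conn F.rot k i (fun m => F.con m t) := by
  have h : conn F.rot k i (fun m => F.con m t)
      = ∑ a, conn F.rot k i (fun m => F.V m a) * t a := by
    simp only [con, conn, Fin.sum_univ_four]
    ring
  rw [h]
  simp only [← F.X_V]
  have h2 : F.X k (F.con i t) = ∑ a, (F.V i a * F.X k (t a) + t a * F.X k (F.V i a)) := by
    simp [con, map_sum, Derivation.leibniz]
  rw [h2]
  simp only [con, gam, Fin.sum_univ_four]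
  ring

/-- Frame components. -/
def fr2 (t : Fin 4 → Fin 4 → G) (i j : Fin 4) : G := F.con j fun b => F.con i fun a => t a b
def fr3 (t : Fin 4 → Fin 4 → Fin 4 → G) (i j p : Fin 4) : G :=
  F.con p fun c => F.fr2 (fun a b => t a b c) i j
def fr4 (t : Fin 4 → Fin 4 → Fin 4 → Fin 4 → G) (i j p q : Fin 4) : G :=
  F.con q fun d => F.fr3 (fun a b c => t a b c d) i j p
def fr5 (t : Fin 4 → Fin 4 → Fin 4 → Fin 4 → Fin 4 → G) (i j p q s : Fin 4) : G :=
  F.con s fun d => F.fr4 (fun a b c e => t a b c e d) i j p q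

theorem fr2_sub (s t : Fin 4 → Fin 4 → G) (i j : Fin 4) :
    F.fr2 (fun a b => s a b - t a b) i j = F.fr2 s i j - F.fr2 t i j := by
  simp [fr2, con_sub]

theorem fr2_mul_sum (i j : Fin 4) (g : Fin 4 → G) (t : Fin 4 → Fin 4 → Fin 4 → G) :
    F.fr2 (fun a b => ∑ e, g e * t a b e) i j = ∑ e, g e * F.fr2 (fun a b => t a b e) i j := by
  simp only [fr2, con_mul_sum]

theorem fr3_sub (s t : Fin 4 → Fin 4 → Fin 4 → G) (i j p : Fin 4) :
    F.fr3 (fun a b c => s a b c - t a b c) i j p = F.fr3 s i j p - F.fr3 t i j p := by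
  simp [fr3, fr2_sub, con_sub]

theorem fr3_mul_sum (i j p : Fin 4) (g : Fin 4 → G) (t : Fin 4 → Fin 4 → Fin 4 → Fin 4 → G) :
    F.fr3 (fun a b c => ∑ e, g e * t a b c e) i j p
      = ∑ e, g e * F.fr3 (fun a b c => t a b c e) i j p := by
  simp only [fr3, fr2_mul_sum, con_mul_sum]

/-- Coordinate components of the covariant derivative in the direction `V_k`. -/
def dcov2 (k : Fin 4) (t : Fin 4 → Fin 4 → G) (a b : Fin 4) : G :=
  (F.X k (t a b) - ∑ e, F.gam k e a * t e b) - ∑ e, F.gam k e b * t a e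
def dcov3 (k : Fin 4) (t : Fin 4 → Fin 4 → Fin 4 → G) (a b c : Fin 4) : G :=
  F.dcov2 k (fun a b => t a b c) a b - ∑ e, F.gam k e c * t a b e
def dcov4 (k : Fin 4) (t : Fin 4 → Fin 4 → Fin 4 → Fin 4 → G) (a b c d : Fin 4) : G :=
  F.dcov3 k (fun a b c => t a b c d) a b c - ∑ e, F.gam k e d * t a b c e

/-- Here and for more indices the argument is an induction on slots: `con_slot` handles one slot,
while the connection terms of the others commute with its contraction. -/
theorem fr2_dcov2 (k : Fin 4) (t : Fin 4 → Fin 4 → G) (i j : Fin 4) :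
    F.fr2 (F.dcov2 k t) i j = fcov2 F.X F.rot (F.fr2 t) k i j := by
  have h : ∀ b, F.con i (fun a => F.dcov2 k t a b)
      = (F.X k (F.con i fun a => t a b) - ∑ e, F.gam k e b * F.con i fun a => t a e)
        - conn F.rot k i (fun m => F.con m fun a => t a b) := by
    intro b
    unfold dcov2
    rw [con_sub, con_slot, con_mul_sum]
    ring
  simp only [fr2, fcov2, h]
  rw [con_sub, con_slot, con_conn]
  ring

theorem fr3_dcov3 (k : Fin 4) (t : Fin 4 → Fin 4 → Fin 4 → G) (i j p : Fin 4) :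
    F.fr3 (F.dcov3 k t) i j p = fcov3 F.X F.rot (F.fr3 t) k i j p := by
  have h : ∀ c, F.fr2 (fun a b => F.dcov3 k t a b c) i j
      = (F.X k (F.fr2 (fun a b => t a b c) i j)
          - ∑ e, F.gam k e c * F.fr2 (fun a b => t a b e) i j)
        - conn F.rot k i (fun m => F.fr2 (fun a b => t a b c) m j)
        - conn F.rot k j (fun m => F.fr2 (fun a b => t a b c) i m) := by
    intro c
    unfold dcov3
    rw [fr2_sub, fr2_dcov2, fr2_mul_sum]
    unfold fcov2
    ring
  simp only [fr3, fcov3, h]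
  rw [con_sub, con_sub, con_slot, con_conn, con_conn]
  ring

theorem fr4_dcov4 (k : Fin 4) (t : Fin 4 → Fin 4 → Fin 4 → Fin 4 → G) (i j p q : Fin 4) :
    F.fr4 (F.dcov4 k t) i j p q = fcov4 F.X F.rot (F.fr4 t) k i j p q := by
  have h : ∀ d, F.fr3 (fun a b c => F.dcov4 k t a b c d) i j p
      = (F.X k (F.fr3 (fun a b c => t a b c d) i j p)
          - ∑ e, F.gam k e d * F.fr3 (fun a b c => t a b c e) i j p)
        - conn F.rot k i (fun m => F.fr3 (fun a b c => t a b c d) m j p)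
        - conn F.rot k j (fun m => F.fr3 (fun a b c => t a b c d) i m p)
        - conn F.rot k p (fun m => F.fr3 (fun a b c => t a b c d) i j m) := by
    intro d
    unfold dcov4
    rw [fr3_sub, fr3_dcov3, fr3_mul_sum]
    unfold fcov3
    ring
  simp only [fr4, fcov4, h]
  rw [con_sub, con_sub, con_sub, con_slot, con_conn, con_conn, con_conn]
  ring

theorem fr2_ccov1 (t : Fin 4 → G) (k i : Fin 4) :
    F.fr2 (ccov1 F.D F.Γ t) k i = fcov1 F.X F.rot (fun i => F.con i t) k i := by
  have h : ∀ a, F.con k (fun c => ccov1 F.D F.Γ t c a) = F.X k (t a) - ∑ e, F.gam k e a * t e := by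
    intro a
    simp only [con, ccov1, gam, X_apply, Fin.sum_univ_four]
    ring
  unfold fr2 fcov1
  simp only [h]
  exact F.con_slot k i t

theorem fr3_ccov2 (t : Fin 4 → Fin 4 → G) (k i j : Fin 4) :
    F.fr3 (ccov2 F.D F.Γ t) k i j = fcov2 F.X F.rot (F.fr2 t) k i j := by
  rw [← fr2_dcov2]
  have h : ∀ a b, F.con k (fun c => ccov2 F.D F.Γ t c a b) = F.dcov2 k t a b := by
    intro a b
    simp only [con, ccov2, dcov2, gam, X_apply, Fin.sum_univ_four]
    ring
  simp only [fr3, fr2, h]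

theorem fr4_ccov3 (t : Fin 4 → Fin 4 → Fin 4 → G) (k i j p : Fin 4) :
    F.fr4 (ccov3 F.D F.Γ t) k i j p = fcov3 F.X F.rot (F.fr3 t) k i j p := by
  rw [← fr3_dcov3]
  have h : ∀ a b d, F.con k (fun c => ccov3 F.D F.Γ t c a b d) = F.dcov3 k t a b d := by
    intro a b d
    simp only [con, ccov3, dcov3, dcov2, gam, X_apply, Fin.sum_univ_four]
    ring
  simp only [fr4, fr3, fr2, h]

theorem fr5_ccov4 (t : Fin 4 → Fin 4 → Fin 4 → Fin 4 → G) (k i j p q : Fin 4) :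
    F.fr5 (ccov4 F.D F.Γ t) k i j p q = fcov4 F.X F.rot (F.fr4 t) k i j p q := by
  rw [← fr4_dcov4]
  have h : ∀ a b d f, F.con k (fun c => ccov4 F.D F.Γ t c a b d f) = F.dcov4 k t a b d f := by
    intro a b d f
    simp only [con, ccov4, dcov4, dcov3, dcov2, gam, X_apply, Fin.sum_univ_four]
    ring
  simp only [fr5, fr4, fr3, fr2, h]

end Framing
end TypeDRec

/-! ### Curvature identities for a torsion-free metric connection -/

namespace TypeDRec

section Curvature

variable {G : Type*} [CommRing G] (D : Fin 4 → Derivation ℤ G G) (Γ : Fin 4 → Fin 4 → Fin 4 → G)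

/-- `riem D Γ a b d c = R_{abd}{}^c`. -/
def riem (a b d c : Fin 4) : G :=
  D a (Γ c b d) - D b (Γ c a d) + ∑ e, (Γ c a e * Γ e b d - Γ c b e * Γ e a d)

/-- The curvature tensor with all indices lowered. -/
def rlow (g : Fin 4 → Fin 4 → G) (a b c d : Fin 4) : G := ∑ e, riem D Γ a b c e * g e d

theorem riem_antisymm (a b d c : Fin 4) : riem D Γ a b d c = -riem D Γ b a d c := by
  simp only [riem, Fin.sum_univ_four]
  ring

variable {Γ}

theorem riem_cyclic (hs : ∀ c a b, Γ c a b = Γ c b a) (a b d c : Fin 4) :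
    riem D Γ a b d c + riem D Γ b d a c + riem D Γ d a b c = 0 := by
  have h1 : ∀ e, Γ e d b = Γ e b d := fun e => hs e d b
  have h2 : ∀ e, Γ e d a = Γ e a d := fun e => hs e d a
  have h3 : ∀ e, Γ e b a = Γ e a b := fun e => hs e b a
  simp only [riem, h1, h2, h3, Fin.sum_univ_four]
  ring

/-- Commutation of the derivations is required on the connection coefficients only, because on
general weighted quantities it fails. The connection terms for the form indices are left out; they
cancel cyclically by symmetry of `Γ` in `rlow_bianchi`. -/
theorem riem_bianchi (hD : ∀ a b c e f, D a (D b (Γ c e f)) = D b (D a (Γ c e f)))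
    (e a b c h : Fin 4) :
    (D e (riem D Γ a b c h) + ∑ p, (Γ h e p * riem D Γ a b c p - Γ p e c * riem D Γ a b p h))
      + (D a (riem D Γ b e c h) + ∑ p, (Γ h a p * riem D Γ b e c p - Γ p a c * riem D Γ b e p h))
      + (D b (riem D Γ e a c h) + ∑ p, (Γ h b p * riem D Γ e a c p - Γ p b c * riem D Γ e a p h))
      = 0 := by
  have h1 := hD a e h b c
  have h2 := hD b e h a c
  have h3 := hD b a h e c
  simp only [riem, map_add, map_sub, Derivation.leibniz, smul_eq_mul, Fin.sum_univ_four]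
  linear_combination -h1 + h2 - h3

/-- The Ricci identity for covectors. -/
theorem ccov2_ccov1_comm (hs : ∀ c a b, Γ c a b = Γ c b a) (t : Fin 4 → G) (a b c : Fin 4) :
    ccov2 D Γ (ccov1 D Γ t) a b c - ccov2 D Γ (ccov1 D Γ t) b a c
      = (D a (D b (t c)) - D b (D a (t c))) - ∑ e, riem D Γ a b c e * t e := by
  have h3 : ∀ e, Γ e b a = Γ e a b := fun e => hs e b a
  simp only [ccov2, ccov1, riem, map_add, map_sub, Derivation.leibniz, smul_eq_mul,
    Fin.sum_univ_four, h3]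
  ring

/-- The Ricci identity for the metric: two derivatives commute on `g c d`, and `hc` turns each of
them into connection terms. -/
theorem rlow_antisymm_last {g : Fin 4 → Fin 4 → G} (hg : ∀ a b, g a b = g b a)
    (hc : ∀ c a b, D c (g a b) = ∑ e, Γ e c a * g e b + ∑ e, Γ e c b * g a e)
    (hD : ∀ a b c e, D a (D b (g c e)) = D b (D a (g c e))) (a b c d : Fin 4) :
    rlow D Γ g a b c d = -rlow D Γ g a b d c := by
  have hc' : ∀ c a b, D c (g a b) = ∑ e, Γ e c a * g e b + ∑ e, Γ e c b * g e a := by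
    intro c a b
    rw [hc]
    simp only [hg a]
  have h := hD a b c d
  simp only [hc', map_add, Derivation.leibniz, smul_eq_mul, Fin.sum_univ_four] at h
  simp only [rlow, riem, Fin.sum_univ_four]
  simp only [hg 1 0, hg 2 0, hg 3 0, hg 2 1, hg 3 1, hg 3 2] at h
  linear_combination h

/-- Four cyclic identities combine, through the two antisymmetries, into twice the claim; hence the
need to cancel `2`. -/
theorem rlow_pair {g : Fin 4 → Fin 4 → G} (h2 : ∀ u : G, 2 * u = 0 → u = 0)
    (hs : ∀ c a b, Γ c a b = Γ c b a)
    (hl : ∀ a b c d, rlow D Γ g a b c d = -rlow D Γ g a b d c) (a b c d : Fin 4) :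
    rlow D Γ g a b c d = rlow D Γ g c d a b := by
  have hf : ∀ a b c d, rlow D Γ g a b c d = -rlow D Γ g b a c d := by
    intro a b c d
    simp only [rlow, fun e => riem_antisymm D Γ a b c e, neg_mul, Finset.sum_neg_distrib]
  have hcy : ∀ a b c d, rlow D Γ g a b c d + rlow D Γ g b c a d + rlow D Γ g c a b d = 0 := by
    intro a b c d
    simp only [rlow, ← Finset.sum_add_distrib, ← add_mul, riem_cyclic D hs, zero_mul,
      Finset.sum_const_zero]
  rw [← sub_eq_zero]
  apply h2
  linear_combination hcy a b c d + hcy b c d a - hcy c d a b - hcy d a b c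
    - hl b c d a - hl c d b a - hf d b c a + hf d a c b - hl a d c b + hf a c d b - hl c a d b
    + hf d a b c + hl a b d c + hl b d a c

/-- The second Bianchi identity for the lowered curvature tensor. -/
theorem rlow_bianchi {g : Fin 4 → Fin 4 → G} (hs : ∀ c a b, Γ c a b = Γ c b a)
    (hc : ∀ c a b, D c (g a b) = ∑ e, Γ e c a * g e b + ∑ e, Γ e c b * g a e)
    (hD : ∀ a b c e f, D a (D b (Γ c e f)) = D b (D a (Γ c e f))) (e a b c d : Fin 4) :
    ccov4 D Γ (rlow D Γ g) e a b c d + ccov4 D Γ (rlow D Γ g) a b e c d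
      + ccov4 D Γ (rlow D Γ g) b e a c d = 0 := by
  have key : ∀ e a b, ccov4 D Γ (rlow D Γ g) e a b c d
      = ∑ h, (D e (riem D Γ a b c h)
        + ∑ p, (Γ h e p * riem D Γ a b c p - Γ p e c * riem D Γ a b p h)) * g h d
        - ∑ p, Γ p e a * rlow D Γ g p b c d - ∑ p, Γ p e b * rlow D Γ g a p c d := by
    intro e a b
    simp only [ccov4, rlow, map_sum, Derivation.leibniz, smul_eq_mul, hc]
    simp only [Fin.sum_univ_four]
    ring
  have ha : ∀ p q c d, rlow D Γ g p q c d = -rlow D Γ g q p c d := by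
    intro p q c d
    simp only [rlow, fun e => riem_antisymm D Γ p q c e, neg_mul, Finset.sum_neg_distrib]
  have hB : ∀ h, _ := fun h => riem_bianchi D hD e a b c h
  rw [key, key, key]
  have h1 : ∀ p, Γ p b a = Γ p a b := fun p => hs p b a
  have h2 : ∀ p, Γ p b e = Γ p e b := fun p => hs p b e
  have h3 : ∀ p, Γ p a e = Γ p e a := fun p => hs p a e
  simp only [h1, h2, h3, fun p => ha a p c d, fun p => ha b p c d, fun p => ha e p c d]
  have := Finset.sum_eq_zero (s := Finset.univ) fun h _ => congrArg (· * g h d) (hB h) |>.trans (zero_mul _)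
  simp only [add_mul, Finset.sum_add_distrib] at this ⊢
  simp only [mul_neg, Finset.sum_neg_distrib]
  linear_combination this

end Curvature

namespace Framing

variable {G : Type*} [CommRing G] (F : Framing G)

/-- The metric of the null coframe. -/
def met (a b : Fin 4) : G := etaTr fun i j => F.E i a * F.E j b

theorem met_symm (a b : Fin 4) : F.met a b = F.met b a := by
  simp only [met, etaTr]
  ring

theorem con_met (i e : Fin 4) : F.con i (fun d => F.met e d) = F.E i e := by
  have h : F.con i (fun d => F.met e d) = etaTr fun p q => F.E p e * ∑ d, F.E q d * F.V i d := by
    simp only [con, met, etaTr, Fin.sum_univ_four]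
    ring
  rw [h]
  simp only [F.dual]
  exact etaTr_eta (fun p => F.E p e) i

theorem fr2_swap (t : Fin 4 → Fin 4 → G) (i j : Fin 4) :
    F.fr2 (fun a b => t b a) i j = F.fr2 t j i := by
  simp only [fr2, con, Fin.sum_univ_four]
  ring

theorem con_comm (p q : Fin 4) (u : Fin 4 → Fin 4 → G) :
    F.con q (fun d => F.con p (fun c => u c d)) = F.con p (fun c => F.con q (fun d => u c d)) := by
  simp only [con, Fin.sum_univ_four]
  ring

theorem fr3_swap23 (t : Fin 4 → Fin 4 → Fin 4 → G) (i j p : Fin 4) :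
    F.fr3 (fun a b c => t a c b) i j p = F.fr3 t i p j := by
  simp only [fr3, fr2]
  rw [con_comm]

theorem fr4_swap12 (t : Fin 4 → Fin 4 → Fin 4 → Fin 4 → G) (i j p q : Fin 4) :
    F.fr4 (fun a b c d => t b a c d) i j p q = F.fr4 t j i p q := by
  simp only [fr4, fr3, fun c d => F.fr2_swap (fun a b => t a b c d) i j]

theorem fr4_swap23 (t : Fin 4 → Fin 4 → Fin 4 → Fin 4 → G) (i j p q : Fin 4) :
    F.fr4 (fun a b c d => t a c b d) i j p q = F.fr4 t i p j q := by
  simp only [fr4, fun d => F.fr3_swap23 (fun a b c => t a b c d) i j p]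

theorem fr4_swap34 (t : Fin 4 → Fin 4 → Fin 4 → Fin 4 → G) (i j p q : Fin 4) :
    F.fr4 (fun a b c d => t a b d c) i j p q = F.fr4 t i j q p := by
  simp only [fr4, fr3]
  rw [con_comm]

theorem fr5_swap12 (t : Fin 4 → Fin 4 → Fin 4 → Fin 4 → Fin 4 → G) (i j p q s : Fin 4) :
    F.fr5 (fun a b c d e => t b a c d e) i j p q s = F.fr5 t j i p q s := by
  simp only [fr5, fun e => F.fr4_swap12 (fun a b c d => t a b c d e) i j p q]

theorem fr5_swap23 (t : Fin 4 → Fin 4 → Fin 4 → Fin 4 → Fin 4 → G) (i j p q s : Fin 4) :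
    F.fr5 (fun a b c d e => t a c b d e) i j p q s = F.fr5 t i p j q s := by
  simp only [fr5, fun e => F.fr4_swap23 (fun a b c d => t a b c d e) i j p q]

/-- The frame components of the curvature tensor. -/
def rm : Fin 4 → Fin 4 → Fin 4 → Fin 4 → G := F.fr4 (rlow F.D F.Γ F.met)

/-- The coordinate derivations commute on tensor components. -/
structure IsFlat : Prop where
  two : ∀ u : G, 2 * u = 0 → u = 0
  gamma : ∀ a b c e f, F.D a (F.D b (F.Γ c e f)) = F.D b (F.D a (F.Γ c e f))
  met : ∀ a b c e, F.D a (F.D b (F.met c e)) = F.D b (F.D a (F.met c e))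

theorem fr2_add (s t : Fin 4 → Fin 4 → G) (i j : Fin 4) :
    F.fr2 (fun a b => s a b + t a b) i j = F.fr2 s i j + F.fr2 t i j := by
  simp [fr2, con_add]

theorem fr3_add (s t : Fin 4 → Fin 4 → Fin 4 → G) (i j p : Fin 4) :
    F.fr3 (fun a b c => s a b c + t a b c) i j p = F.fr3 s i j p + F.fr3 t i j p := by
  simp [fr3, fr2_add, con_add]

theorem fr4_add (s t : Fin 4 → Fin 4 → Fin 4 → Fin 4 → G) (i j p q : Fin 4) :
    F.fr4 (fun a b c d => s a b c d + t a b c d) i j p q = F.fr4 s i j p q + F.fr4 t i j p q := by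
  simp [fr4, fr3_add, con_add]

theorem fr5_add (s t : Fin 4 → Fin 4 → Fin 4 → Fin 4 → Fin 4 → G) (i j p q r : Fin 4) :
    F.fr5 (fun a b c d e => s a b c d e + t a b c d e) i j p q r
      = F.fr5 s i j p q r + F.fr5 t i j p q r := by
  simp [fr5, fr4_add, con_add]

theorem fr2_con (s : Fin 4) (u : Fin 4 → Fin 4 → Fin 4 → G) (i j : Fin 4) :
    F.fr2 (fun a b => F.con s (fun d => u a b d)) i j
      = F.con s (fun d => F.fr2 (fun a b => u a b d) i j) := by
  have h : ∀ b, F.con i (fun a => F.con s (fun d => u a b d))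
      = F.con s (fun d => F.con i (fun a => u a b d)) := fun b => F.con_comm s i (fun d a => u a b d)
  simp only [fr2, h]
  exact F.con_comm s j (fun d b => F.con i fun a => u a b d)

theorem fr3_con (s : Fin 4) (u : Fin 4 → Fin 4 → Fin 4 → Fin 4 → G) (i j p : Fin 4) :
    F.fr3 (fun a b c => F.con s (fun d => u a b c d)) i j p = F.fr4 u i j p s := by
  simp only [fr4, fr3, fr2_con]
  exact F.con_comm s p (fun d c => F.fr2 (fun a b => u a b c d) i j)

theorem fr4_neg (t : Fin 4 → Fin 4 → Fin 4 → Fin 4 → G) (i j p q : Fin 4) :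
    F.fr4 (fun a b c d => -t a b c d) i j p q = -F.fr4 t i j p q := by
  simp [fr4, fr3, fr2, con]

variable {F}

theorem rm_antisymm (k l i j : Fin 4) : F.rm k l i j = -F.rm l k i j := by
  rw [rm, ← fr4_swap12, ← fr4_neg]
  congr 1
  funext a b c d
  simp only [rlow, fun e => riem_antisymm F.D F.Γ a b c e, neg_mul, Finset.sum_neg_distrib, neg_neg]

theorem rm_cyclic (k l i j : Fin 4) : F.rm k l i j + F.rm l i k j + F.rm i k l j = 0 := by
  have h1 : F.rm l i k j = F.fr4 (fun a b c d => rlow F.D F.Γ F.met b c a d) k l i j := by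
    rw [F.fr4_swap12 (fun a b c d => rlow F.D F.Γ F.met a c b d), F.fr4_swap23, rm]
  have h2 : F.rm i k l j = F.fr4 (fun a b c d => rlow F.D F.Γ F.met c a b d) k l i j := by
    rw [F.fr4_swap23 (fun a b c d => rlow F.D F.Γ F.met b a c d), F.fr4_swap12, rm]
  rw [h1, h2, rm, ← fr4_add, ← fr4_add]
  have h3 : (fun a b c d => rlow F.D F.Γ F.met a b c d + rlow F.D F.Γ F.met b c a d
      + rlow F.D F.Γ F.met c a b d) = fun _ _ _ _ => 0 := by
    funext a b c d
    simp only [rlow, ← Finset.sum_add_distrib, ← add_mul, riem_cyclic F.D F.symm, zero_mul,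
      Finset.sum_const_zero]
  rw [h3]
  simp [fr4, fr3, fr2, con]

namespace IsFlat

theorem rlow_antisymm (h : F.IsFlat) (a b c d : Fin 4) :
    rlow F.D F.Γ F.met a b c d = -rlow F.D F.Γ F.met a b d c :=
  rlow_antisymm_last F.D F.met_symm F.compat h.met a b c d

theorem rm_antisymm_last (h : F.IsFlat) (k l i j : Fin 4) : F.rm k l i j = -F.rm k l j i := by
  rw [rm, ← fr4_swap34, ← fr4_neg]
  congr 1
  funext a b c d
  exact h.rlow_antisymm a b d c

theorem rm_pair (h : F.IsFlat) (k l i j : Fin 4) : F.rm k l i j = F.rm i j k l := by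
  have h1 : F.rm i j k l = F.fr4 (fun a b c d => rlow F.D F.Γ F.met c d a b) k l i j := by
    rw [F.fr4_swap23 (fun a b c d => rlow F.D F.Γ F.met b d a c),
      F.fr4_swap12 (fun a b c d => rlow F.D F.Γ F.met a d b c),
      F.fr4_swap34 (fun a b c d => rlow F.D F.Γ F.met a c b d), F.fr4_swap23, rm]
  rw [h1, rm]
  congr 1
  funext a b c d
  exact rlow_pair F.D h.two F.symm h.rlow_antisymm a b c d

theorem rm_bianchi (h : F.IsFlat) (m k l i j : Fin 4) :
    fcov4 F.X F.rot F.rm m k l i j + fcov4 F.X F.rot F.rm k l m i j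
      + fcov4 F.X F.rot F.rm l m k i j = 0 := by
  set t := ccov4 F.D F.Γ (rlow F.D F.Γ F.met) with ht
  have h1 : fcov4 F.X F.rot F.rm k l m i j = F.fr5 (fun a b c d e => t b c a d e) m k l i j := by
    rw [F.fr5_swap12 (fun a b c d e => t a c b d e), F.fr5_swap23, ht, fr5_ccov4, rm]
  have h2 : fcov4 F.X F.rot F.rm l m k i j = F.fr5 (fun a b c d e => t c a b d e) m k l i j := by
    rw [F.fr5_swap23 (fun a b c d e => t b a c d e), F.fr5_swap12, ht, fr5_ccov4, rm]
  rw [h1, h2, rm, ← fr5_ccov4, ← ht, ← fr5_add, ← fr5_add]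
  have h3 : (fun a b c d e => t a b c d e + t b c a d e + t c a b d e) = fun _ _ _ _ _ => 0 := by
    funext a b c d e
    exact rlow_bianchi F.D F.symm F.compat h.gamma a b c d e
  rw [h3]
  simp [fr5, fr4, fr3, fr2, con]

end IsFlat

/-- The structure equations of the frame: `κ` is the curvature of the weight of `E i`. -/
theorem rot_curvature (i : Fin 4) {κ : Fin 4 → Fin 4 → G}
    (hκ : ∀ a b c, F.D a (F.D b (F.E i c)) - F.D b (F.D a (F.E i c)) = κ a b * F.E i c)
    (k l j : Fin 4) :
    fcov2 F.X F.rot (fun l j => F.rot l i j) k l j - fcov2 F.X F.rot (fun l j => F.rot l i j) l k j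
      = F.fr2 κ k l * eta i j - F.rm k l j i := by
  have hr : (fun l j => F.rot l i j) = F.fr2 (ccov1 F.D F.Γ (F.E i)) := by
    funext l j
    simp only [rot, fr2, con, Fin.sum_univ_four]
    ring
  have h2 : fcov2 F.X F.rot (fun l j => F.rot l i j) l k j
      = F.fr3 (fun a b c => ccov2 F.D F.Γ (ccov1 F.D F.Γ (F.E i)) b a c) k l j := by
    rw [hr, ← fr3_ccov2]
    simp only [fr3]
    congr 1
    funext c
    rw [← fr2_swap]
  rw [h2, hr, ← fr3_ccov2, ← fr3_sub]
  simp only [ccov2_ccov1_comm F.D F.symm, hκ]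
  have h3 : ∀ a b c, ∑ e, riem F.D F.Γ a b c e * F.E i e
      = F.con i (fun d => rlow F.D F.Γ F.met a b c d) := by
    intro a b c
    simp only [rlow, ← fun e => F.con_met i e]
    simp only [con, Fin.sum_univ_four]
    ring
  rw [fr3_sub]
  congr 1
  · rw [← F.dual i j]
    simp only [fr3, fr2, con, Fin.sum_univ_four]
    ring
  · simp only [h3, rm]
    exact F.fr3_con i _ k l j

/-- The commutators of the frame derivations. -/
theorem X_comm (f : G) {κ : Fin 4 → Fin 4 → G}
    (hκ : ∀ a b, F.D a (F.D b f) - F.D b (F.D a f) = κ a b) (k l : Fin 4) :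
    fcov1 F.X F.rot (fun l => F.X l f) k l - fcov1 F.X F.rot (fun l => F.X l f) l k
      = F.fr2 κ k l := by
  have hx : (fun l => F.X l f) = fun l => F.con l (fun a => F.D a f) := by
    funext l
    rw [X_apply, con]
  rw [hx, ← fr2_ccov1, ← fr2_ccov1, ← F.fr2_swap _ k l, ← fr2_sub]
  congr 1
  funext a b
  simp only [ccov1, ← hκ, F.symm _ b a]
  ring

/-- The frame components of the Ricci tensor. -/
theorem fr2_ric (i j : Fin 4) :
    F.fr2 (fun a b => ∑ c, riem F.D F.Γ a c b c) i j = etaTr fun p q => F.rm i p j q := by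
  have h3 : ∀ q a b c, F.con q (fun d => rlow F.D F.Γ F.met a b c d)
      = ∑ e, riem F.D F.Γ a b c e * F.E q e := by
    intro q a b c
    simp only [rlow, ← fun e => F.con_met q e]
    simp only [con, Fin.sum_univ_four]
    ring
  have h4 : ∀ p q, F.rm i p j q
      = F.fr2 (fun a c => ∑ b, ∑ e, riem F.D F.Γ a b c e * (F.V p b * F.E q e)) i j := by
    intro p q
    have h6 : ∀ a c, ∑ b, ∑ e, riem F.D F.Γ a b c e * (F.V p b * F.E q e)
        = F.con p (fun b => F.con q (fun d => rlow F.D F.Γ F.met a b c d)) := by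
      intro a c
      simp only [h3]
      simp only [con, Fin.sum_univ_four]
      ring
    simp only [h6]
    have h7 : F.rm i p j q = F.fr3 (fun a c b => F.con q (fun d => rlow F.D F.Γ F.met a b c d)) i j p := by
      rw [F.fr3_swap23 (fun a b c => F.con q (fun d => rlow F.D F.Γ F.met a b c d)), fr3_con, rm]
    rw [h7, fr2_con]
    rfl
  simp only [h4]
  have h5 : ∀ a c, ∑ b, riem F.D F.Γ a b c b
      = etaTr fun p q => ∑ b, ∑ e, riem F.D F.Γ a b c e * (F.V p b * F.E q e) := by
    intro a c
    have h8 : ∀ b, riem F.D F.Γ a b c b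
        = ∑ e, riem F.D F.Γ a b c e * etaTr (fun p q => F.V p b * F.E q e) := by
      intro b
      simp [F.eta_completeness]
    simp only [h8]
    simp only [etaTr, Fin.sum_univ_four]
    ring
  simp only [h5, etaTr, fr2_add, fr2_sub]

end Framing
end TypeDRec

/-! ### Bianchi identities and Newman-Penrose equations in a principal frame -/

namespace TypeDRec

/-- The weights `p` and `q` of the coframe `l, n, m, mt`. -/
def wtP : Fin 4 → ℤ := ![1, -1, 1, -1]
def wtQ : Fin 4 → ℤ := ![1, -1, -1, 1]

/-- A framing of a vacuum type D metric by a principal null tetrad, whose coordinate derivations act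
on weighted quantities through a connection with curvature `K`, `Kt`. -/
structure PrincipalFraming (G : Type*) [CommRing G] extends Framing G where
  P : Derivation ℤ G G
  Q : Derivation ℤ G G
  (K Kt : Fin 4 → Fin 4 → G)
  (Ψ Ψt Λ : G)
  flat : toFraming.IsFlat
  three : ∀ u : G, 3 * u = 0 → u = 0
  D_comm : ∀ a b f, D a (D b f) - D b (D a f) = -(K a b * P f + Kt a b * Q f)
  P_D : ∀ a f, P (D a f) = D a (P f)
  Q_D : ∀ a f, Q (D a f) = D a (Q f)
  P_E : ∀ i a, P (E i a) = wtP i * E i a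
  Q_E : ∀ i a, Q (E i a) = wtQ i * E i a
  P_V : ∀ i a, P (V i a) = wtP i * V i a
  Q_V : ∀ i a, Q (V i a) = wtQ i * V i a
  P_Γ : ∀ c a b, P (Γ c a b) = 0
  Q_Γ : ∀ c a b, Q (Γ c a b) = 0
  P_Ψ : P Ψ = 0
  Q_Ψ : Q Ψ = 0
  D_Λ : ∀ a, D a Λ = 0
  rot01 : ∀ k, toFraming.rot k 0 1 = 0
  rot23 : ∀ k, toFraming.rot k 2 3 = 0
  ricci : ∀ a b, ∑ c, riem D Γ a c b c = 6 * Λ * toFraming.met a b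
  rm0202 : toFraming.rm 0 2 0 2 = 0
  rm0201 : toFraming.rm 0 2 0 1 = 0
  rm0231 : toFraming.rm 0 2 3 1 = Ψ + 2 * Λ
  rm0131 : toFraming.rm 0 1 3 1 = 0
  rm3131 : toFraming.rm 3 1 3 1 = 0
  rm0303 : toFraming.rm 0 3 0 3 = 0
  rm0301 : toFraming.rm 0 3 0 1 = 0
  rm0321 : toFraming.rm 0 3 2 1 = Ψt + 2 * Λ
  rm0121 : toFraming.rm 0 1 2 1 = 0
  rm2121 : toFraming.rm 2 1 2 1 = 0
  unit_psi : IsUnit Ψ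
  unit_psit : IsUnit Ψt

namespace Framing

variable {G : Type*} [CommRing G] {F : Framing G}

theorem IsFlat.rot_diag (h : F.IsFlat) (k i : Fin 4) : F.rot k i i = 0 :=
  h.two _ (by linear_combination F.rot_antisymm k i i)

theorem IsFlat.rm_diag (h : F.IsFlat) (k i j : Fin 4) : F.rm k k i j = 0 :=
  h.two _ (by linear_combination F.rm_antisymm k k i j)

theorem IsFlat.rm_diag_last (h : F.IsFlat) (k i j : Fin 4) : F.rm i j k k = 0 :=
  h.two _ (by linear_combination h.rm_antisymm_last i j k k)

theorem fr2_met (i j : Fin 4) : F.fr2 F.met i j = eta i j := by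
  rw [← F.fr2_swap, fr2]
  simp only [con_met]
  rw [con]
  simp only [mul_comm (F.V _ _)]
  rw [F.dual]
  fin_cases i <;> fin_cases j <;> simp [eta]

end Framing

namespace PrincipalFraming

variable {G : Type*} [CommRing G] (F : PrincipalFraming G)

theorem X_weight (S : Derivation ℤ G G) (w : ℤ) (k : Fin 4) (hV : ∀ a, S (F.V k a) = w * F.V k a)
    (hS : ∀ a f, S (F.D a f) = F.D a (S f)) (f : G) :
    S (F.X k f) = F.X k (S f) + w * F.X k f := by
  simp only [Framing.X_apply, Fin.sum_univ_four, map_add, Derivation.leibniz, smul_eq_mul, hV, hS]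
  ring

theorem rot_weight (S : Derivation ℤ G G) (w : Fin 4 → ℤ) (hE : ∀ i a, S (F.E i a) = w i * F.E i a)
    (hV : ∀ i a, S (F.V i a) = w i * F.V i a) (hΓ : ∀ c a b, S (F.Γ c a b) = 0)
    (hS : ∀ a f, S (F.D a f) = F.D a (S f)) (k i j : Fin 4) :
    S (F.rot k i j) = (w k + w i + w j : ℤ) * F.rot k i j := by
  have h1 : ∀ c b, S (ccov1 F.D F.Γ (F.E i) c b) = w i * ccov1 F.D F.Γ (F.E i) c b := by
    intro c b
    simp only [ccov1, Fin.sum_univ_four, map_add, map_sub, Derivation.leibniz, smul_eq_mul, hE, hS,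
      hΓ, Derivation.map_intCast]
    ring
  simp only [Framing.rot, Finset.mul_sum, map_sum, Derivation.leibniz, smul_eq_mul, h1, hV]
  refine Finset.sum_congr rfl fun c _ => Finset.sum_congr rfl fun b _ => ?_
  push_cast
  ring

theorem ric (i j : Fin 4) : F.rm i 0 j 1 + F.rm i 1 j 0 - F.rm i 2 j 3 - F.rm i 3 j 2
    = 6 * F.Λ * eta i j := by
  have h := F.fr2_ric i j
  simp only [F.ricci] at h
  have h2 : F.fr2 (fun a b => 6 * F.Λ * F.met a b) i j = 6 * F.Λ * F.fr2 F.met i j := by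
    simp only [Framing.fr2, Framing.con, Fin.sum_univ_four]
    ring
  rw [h2, Framing.fr2_met] at h
  exact h.symm

/-- Twenty-one pair-symmetric components are determined by twenty-one linear equations: ten for the
two families of Weyl scalars, ten for the Ricci tensor, and one cyclic identity. -/
theorem rm_table :
    F.rm 0 1 0 1 = F.Ψ + F.Ψt - 2 * F.Λ ∧ F.rm 0 1 0 2 = 0 ∧ F.rm 0 1 0 3 = 0 ∧ F.rm 0 1 1 2 = 0
    ∧ F.rm 0 1 1 3 = 0 ∧ F.rm 0 1 2 3 = F.Ψt - F.Ψ ∧ F.rm 0 2 0 2 = 0 ∧ F.rm 0 2 0 3 = 0 ∧ F.rm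
    0 2 1 2 = 0 ∧ F.rm 0 2 1 3 = -(F.Ψ + 2 * F.Λ) ∧ F.rm 0 2 2 3 = 0 ∧ F.rm 0 3 0 3 = 0 ∧ F.rm 0
    3 1 2 = -(F.Ψt + 2 * F.Λ) ∧ F.rm 0 3 1 3 = 0 ∧ F.rm 0 3 2 3 = 0 ∧ F.rm 1 2 1 2 = 0 ∧ F.rm 1
    2 1 3 = 0 ∧ F.rm 1 2 2 3 = 0 ∧ F.rm 1 3 1 3 = 0 ∧ F.rm 1 3 2 3 = 0 ∧ F.rm 2 3 2 3 = F.Ψ +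
    F.Ψt - 2 * F.Λ := by
  have a := @Framing.rm_antisymm G _ F.toFraming
  have b := F.flat.rm_antisymm_last
  have d := F.flat.rm_diag
  have e := F.flat.rm_diag_last
  have p := F.flat.rm_pair
  have r := F.ric
  have r00 := r 0 0
  have r11 := r 1 1
  have r22 := r 2 2
  have r33 := r 3 3
  have r01 := r 0 1
  have r23 := r 2 3
  have r02 := r 0 2
  have r03 := r 0 3
  have r12 := r 1 2
  have r13 := r 1 3
  simp only [a 1 0, a 2 0, a 3 0, a 2 1, a 3 1, a 3 2, b _ _ 1 0, b _ _ 2 0, b _ _ 3 0, b _ _ 2 1,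
    b _ _ 3 1, b _ _ 3 2, d, e, p 0 2 0 1, p 0 3 0 1, p 1 2 0 1, p 1 3 0 1, p 2 3 0 1, p 0 3 0 2,
    p 1 2 0 2, p 1 3 0 2, p 2 3 0 2, p 1 2 0 3, p 1 3 0 3, p 2 3 0 3, p 1 3 1 2, p 2 3 1 2,
    p 2 3 1 3, eta, Matrix.cons_val] at r00 r11 r22 r33 r01 r23 r02 r03 r12 r13
  have c := @Framing.rm_cyclic G _ F.toFraming 0 1 2 3
  have h1 := F.rm0202
  have h2 := F.rm0201
  have h3 := F.rm0231
  have h4 := F.rm0131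
  have h5 := F.rm3131
  have h6 := F.rm0303
  have h7 := F.rm0301
  have h8 := F.rm0321
  have h9 := F.rm0121
  have h10 := F.rm2121
  simp only [a 2 0, a 2 1, a 3 1, b _ _ 2 1,
    b _ _ 3 1, p 0 2 0 1, p 0 3 0 1, p 1 2 0 3] at c h1 h2 h3 h4 h5 h6 h7 h8 h9 h10
  refine ⟨?_, h2, h7, ?_, ?_, ?_, h1, ?_, ?_, ?_, ?_, h6, ?_, ?_, ?_, ?_, ?_, ?_, ?_, ?_, ?_⟩
  · linear_combination -r01 + h3 + h8
  · linear_combination -h9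
  · linear_combination -h4
  · linear_combination c - h3 + h8
  · exact F.flat.two _ (by linear_combination -r00)
  · exact F.flat.two _ (by linear_combination r22)
  · linear_combination -h3
  · linear_combination -r02 - h2
  · linear_combination -h8
  · exact F.flat.two _ (by linear_combination r33)
  · linear_combination r03 + h7
  · linear_combination h10
  · exact F.flat.two _ (by linear_combination -r11)
  · linear_combination -r12 - h9
  · linear_combination h5
  · linear_combination r13 + h4
  · linear_combination r23 + h3 + h8

/-- The antisymmetric array with given entries above the diagonal. -/
def antiMat {H : Type*} [AddCommGroup H] (a b c d e f : H) : Fin 4 → Fin 4 → H :=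
  ![![0, a, b, c], ![-a, 0, d, e], ![-b, -d, 0, f], ![-c, -e, -f, 0]]

theorem eq_antiMat {H : Type*} [AddCommGroup H] {t : Fin 4 → Fin 4 → H} (h0 : ∀ i, t i i = 0)
    (h : ∀ i j, t i j = -t j i) :
    t = antiMat (t 0 1) (t 0 2) (t 0 3) (t 1 2) (t 1 3) (t 2 3) := by
  funext i j
  fin_cases i <;> fin_cases j <;> first | exact h0 _ | rfl | exact h _ _

/-- The curvature tensor of a vacuum type D metric in a principal null frame. -/
def curv (Ψ Ψt Λ : G) : Fin 4 → Fin 4 → Fin 4 → Fin 4 → G :=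
  antiMat (antiMat (Ψ + Ψt - 2 * Λ) 0 0 0 0 (Ψt - Ψ)) (antiMat 0 0 0 0 (-(Ψ + 2 * Λ)) 0)
    (antiMat 0 0 0 (-(Ψt + 2 * Λ)) 0 0) (antiMat 0 0 (-(Ψt + 2 * Λ)) 0 0 0)
    (antiMat 0 (-(Ψ + 2 * Λ)) 0 0 0 0) (antiMat (Ψt - Ψ) 0 0 0 0 (Ψ + Ψt - 2 * Λ))

theorem rm_eq : F.rm = curv F.Ψ F.Ψt F.Λ := by
  have p := F.flat.rm_pair
  obtain ⟨h1, h2, h3, h4, h5, h6, h7, h8, h9, h10, h11, h12, h13, h14, h15, h16, h17, h18, h19,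
    h20, h21⟩ := F.rm_table
  have h : ∀ k l, F.rm k l = antiMat (F.rm k l 0 1) (F.rm k l 0 2) (F.rm k l 0 3) (F.rm k l 1 2)
      (F.rm k l 1 3) (F.rm k l 2 3) := fun k l =>
    eq_antiMat (fun i => F.flat.rm_diag_last i k l) (F.flat.rm_antisymm_last k l)
  rw [eq_antiMat (t := F.rm) (fun k => funext₂ (F.flat.rm_diag k))
    (fun k l => funext₂ (Framing.rm_antisymm k l))]
  rw [h 0 1, h 0 2, h 0 3, h 1 2, h 1 3, h 2 3]
  simp only [p 0 2 0 1, p 0 3 0 1, p 1 2 0 1, p 1 3 0 1, p 2 3 0 1, p 0 3 0 2, p 1 2 0 2, p 1 3 0 2,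
    p 2 3 0 2, p 1 2 0 3, p 1 3 0 3, p 2 3 0 3, p 1 3 1 2, p 2 3 1 2, p 2 3 1 3, h1, h2, h3, h4,
    h5, h6, h7, h8, h9, h10, h11, h12, h13, h14, h15, h16, h17, h18, h19, h20, h21]
  rfl

theorem X_lam (k : Fin 4) : F.X k F.Λ = 0 := by simp [Framing.X_apply, F.D_Λ]

/-- The Bianchi identities: the congruences of `l` and `n` are geodesic and shear free, and the
derivatives of `Ψ₂` are determined by the spin coefficients. -/
theorem bianchi :
    (F.rot 0 0 2 = 0 ∧ F.rot 2 0 2 = 0 ∧ F.rot 1 1 3 = 0 ∧ F.rot 3 1 3 = 0)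
      ∧ (F.rot 0 0 3 = 0 ∧ F.rot 3 0 3 = 0 ∧ F.rot 1 1 2 = 0 ∧ F.rot 2 1 2 = 0)
      ∧ F.X 0 F.Ψ = 3 * F.rot 3 0 2 * F.Ψ ∧ F.X 1 F.Ψ = 3 * F.rot 2 1 3 * F.Ψ
      ∧ F.X 2 F.Ψ = 3 * F.rot 1 0 2 * F.Ψ ∧ F.X 3 F.Ψ = 3 * F.rot 0 1 3 * F.Ψ := by
  have hb := F.flat.rm_bianchi
  have ra := F.rot_antisymm
  have r0 := F.flat.rot_diag
  have hl := F.X_lam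
  -- The Goldberg–Sachs mechanism: with this curvature, certain Bianchi components reduce to three
  -- times `Ψ` times a single spin coefficient, and `Ψ` is invertible.
  have hu : ∀ x, 3 * (x * F.Ψ) = 0 → x = 0 := fun x hx =>
    (IsUnit.mul_left_eq_zero F.unit_psi).1 (F.three _ hx)
  have hv : ∀ x, 3 * (x * F.Ψt) = 0 → x = 0 := fun x hx =>
    (IsUnit.mul_left_eq_zero F.unit_psit).1 (F.three _ hx)
  have g1 := hb 0 1 2 0 2
  have g2 := hb 0 1 3 0 2
  have g3 := hb 0 2 3 0 2
  have g4 := hb 1 2 3 0 2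
  have g5 := hb 0 1 2 1 3
  have g6 := hb 0 1 3 1 3
  have g7 := hb 0 2 3 1 3
  have g8 := hb 1 2 3 1 3
  have t1 := hb 0 1 3 0 3
  have t3 := hb 0 2 3 0 3
  have t6 := hb 0 1 2 1 2
  have t8 := hb 1 2 3 1 2
  simp only [F.rm_eq, fcov4, conn, curv, antiMat, Matrix.cons_val, ra _ 1 0, ra _ 2 0, ra _ 2 1,
    ra _ 3 0, ra _ 3 1, ra _ 3 2, r0, F.rot01, F.rot23, Pi.zero_apply, Pi.neg_apply, map_zero,
    map_neg, mul_zero, zero_mul, sub_zero, neg_zero, add_zero, zero_add, map_add, map_sub,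
    Derivation.leibniz, smul_eq_mul, TypeDAlgebra.der_two, hl]
    at g1 g2 g3 g4 g5 g6 g7 g8 t1 t3 t6 t8
  refine ⟨⟨hu _ ?_, hu _ ?_, hu _ ?_, hu _ ?_⟩, ⟨hv _ ?_, hv _ ?_, hv _ ?_, hv _ ?_⟩, ?_, ?_, ?_, ?_⟩
  · linear_combination -g3
  · linear_combination g1
  · linear_combination g8
  · linear_combination -g6
  · linear_combination t3
  · linear_combination t1
  · linear_combination -t8
  · linear_combination -t6
  · linear_combination -g2
  · linear_combination g5
  · linear_combination g4
  · linear_combination -g7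

/-- The weights absorb the `01` and `23` components and `bianchi` removes eight more, so eight spin
coefficients remain. -/
theorem rot_eq : F.rot =
    ![![![0, 0, 0, 0], ![0, 0, F.rot 0 1 2, F.rot 0 1 3], ![0, -F.rot 0 1 2, 0, 0],
        ![0, -F.rot 0 1 3, 0, 0]],
      ![![0, 0, F.rot 1 0 2, F.rot 1 0 3], ![0, 0, 0, 0], ![-F.rot 1 0 2, 0, 0, 0],
        ![-F.rot 1 0 3, 0, 0, 0]],
      ![![0, 0, 0, F.rot 2 0 3], ![0, 0, 0, F.rot 2 1 3], ![0, 0, 0, 0],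
        ![-F.rot 2 0 3, -F.rot 2 1 3, 0, 0]],
      ![![0, 0, F.rot 3 0 2, 0], ![0, 0, F.rot 3 1 2, 0], ![-F.rot 3 0 2, -F.rot 3 1 2, 0, 0],
        ![0, 0, 0, 0]]] := by
  obtain ⟨⟨h1, h2, h3, h4⟩, ⟨h5, h6, h7, h8⟩, -⟩ := F.bianchi
  funext k
  rw [eq_antiMat (F.flat.rot_diag k) (F.rot_antisymm k), F.rot01, F.rot23]
  fin_cases k <;> simp [antiMat, h1, h2, h3, h4, h5, h6, h7, h8]

/-- The structure equations of the weighted frame. -/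
theorem structure_eq (i k l j : Fin 4) :
    fcov2 F.X F.rot (fun l j => F.rot l i j) k l j - fcov2 F.X F.rot (fun l j => F.rot l i j) l k j
      = -(wtP i * F.fr2 F.K k l + wtQ i * F.fr2 F.Kt k l) * eta i j
        - curv F.Ψ F.Ψt F.Λ k l j i := by
  rw [F.rot_curvature i (κ := fun a b => -(wtP i * F.K a b + wtQ i * F.Kt a b)), F.rm_eq]
  · congr 2
    simp only [Framing.fr2, Framing.con, Fin.sum_univ_four]
    ring
  · intro a b c
    rw [F.D_comm, F.P_E, F.Q_E]
    ring

theorem commutator (f : G) (k l : Fin 4) :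
    fcov1 F.X F.rot (fun l => F.X l f) k l - fcov1 F.X F.rot (fun l => F.X l f) l k
      = -(F.fr2 F.K k l * F.P f + F.fr2 F.Kt k l * F.Q f) := by
  rw [F.X_comm f (F.D_comm · · f)]
  simp only [Framing.fr2, Framing.con, Fin.sum_univ_four]
  ring

/-- The Newman-Penrose equations of a vacuum type D metric. -/
theorem spin_equations :
    F.X 0 (F.rot 3 0 2) = F.rot 3 0 2 * F.rot 3 0 2
      ∧ F.X 2 (F.rot 3 0 2) = F.rot 1 0 2 * (F.rot 3 0 2 - F.rot 2 0 3)
      ∧ F.X 0 (F.rot 1 0 2) = F.rot 3 0 2 * (F.rot 1 0 2 - F.rot 0 1 2)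
      ∧ F.X 2 (F.rot 1 0 2) = F.rot 1 0 2 * F.rot 1 0 2
      ∧ F.X 1 (F.rot 3 0 2) = F.X 3 (F.rot 1 0 2) + F.rot 3 0 2 * F.rot 3 1 2 - F.rot 1 0 2 * F.rot 1 0 3 - F.Ψ - 2 * F.Λ
      ∧ F.X 1 (F.rot 2 1 3) = F.rot 2 1 3 * F.rot 2 1 3
      ∧ F.X 3 (F.rot 2 1 3) = F.rot 0 1 3 * (F.rot 2 1 3 - F.rot 3 1 2)
      ∧ F.X 1 (F.rot 0 1 3) = F.rot 2 1 3 * (F.rot 0 1 3 - F.rot 1 0 3)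
      ∧ F.X 3 (F.rot 0 1 3) = F.rot 0 1 3 * F.rot 0 1 3
      ∧ F.X 0 (F.rot 2 1 3) = F.X 2 (F.rot 0 1 3) + F.rot 2 1 3 * F.rot 2 0 3 - F.rot 0 1 3 * F.rot 0 1 2 - F.Ψ - 2 * F.Λ
      ∧ F.X 0 (F.rot 2 0 3) = F.rot 2 0 3 * F.rot 2 0 3
      ∧ F.X 3 (F.rot 2 0 3) = F.rot 1 0 3 * (F.rot 2 0 3 - F.rot 3 0 2)
      ∧ F.X 0 (F.rot 1 0 3) = F.rot 2 0 3 * (F.rot 1 0 3 - F.rot 0 1 3)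
      ∧ F.X 3 (F.rot 1 0 3) = F.rot 1 0 3 * F.rot 1 0 3
      ∧ F.X 1 (F.rot 2 0 3) = F.X 2 (F.rot 1 0 3) + F.rot 2 0 3 * F.rot 2 1 3 - F.rot 1 0 3 * F.rot 1 0 2 - F.Ψt - 2 * F.Λ
      ∧ F.X 1 (F.rot 3 1 2) = F.rot 3 1 2 * F.rot 3 1 2
      ∧ F.X 2 (F.rot 3 1 2) = F.rot 0 1 2 * (F.rot 3 1 2 - F.rot 2 1 3)
      ∧ F.X 1 (F.rot 0 1 2) = F.rot 3 1 2 * (F.rot 0 1 2 - F.rot 1 0 2)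
      ∧ F.X 2 (F.rot 0 1 2) = F.rot 0 1 2 * F.rot 0 1 2
      ∧ F.X 0 (F.rot 3 1 2) = F.X 3 (F.rot 0 1 2) + F.rot 3 1 2 * F.rot 3 0 2 - F.rot 0 1 2 * F.rot 0 1 3 - F.Ψt - 2 * F.Λ := by
  have h := F.structure_eq
  have hr := F.rot_eq
  -- The right-hand side of `hr` mentions `F.rot` itself; naming its entries lets `hr` serve as a
  -- terminating rewrite rule.
  generalize F.rot 0 1 2 = r012, F.rot 0 1 3 = r013, F.rot 1 0 2 = r102, F.rot 1 0 3 = r103,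
    F.rot 2 0 3 = r203, F.rot 2 1 3 = r213, F.rot 3 0 2 = r302, F.rot 3 1 2 = r312 at hr ⊢
  simp only [hr] at h
  have e0 := h 0 0 3 2
  have e1 := h 0 2 3 2
  have e2 := h 0 0 1 2
  have e3 := h 0 1 2 2
  have e4 := h 0 1 3 2
  have e5 := h 1 1 2 3
  have e6 := h 1 2 3 3
  have e7 := h 1 0 1 3
  have e8 := h 1 0 3 3
  have e9 := h 1 0 2 3
  have e10 := h 0 0 2 3
  have e11 := h 0 2 3 3
  have e12 := h 0 0 1 3
  have e13 := h 0 1 3 3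
  have e14 := h 0 1 2 3
  have e15 := h 1 1 3 2
  have e16 := h 1 2 3 2
  have e17 := h 1 0 1 2
  have e18 := h 1 0 2 2
  have e19 := h 1 0 3 2
  simp only [fcov2, fcov1, conn, curv, antiMat, eta, wtP, wtQ, Matrix.cons_val, Pi.zero_apply, Pi.neg_apply,
    map_zero, map_neg, mul_zero, zero_mul, sub_zero, neg_zero, add_zero, zero_add, zero_sub,
    mul_one, Int.cast_one, Int.cast_neg, one_mul]
    at e0 e1 e2 e3 e4 e5 e6 e7 e8 e9
      e10 e11 e12 e13 e14 e15 e16 e17 e18 e19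
  refine ⟨?_, ?_, ?_, ?_, ?_, ?_, ?_, ?_, ?_, ?_, ?_, ?_, ?_, ?_, ?_, ?_, ?_, ?_, ?_, ?_⟩
  · linear_combination e0
  · linear_combination e1
  · linear_combination e2
  · linear_combination -e3
  · linear_combination e4
  · linear_combination e5
  · linear_combination -e6
  · linear_combination -e7
  · linear_combination -e8
  · linear_combination e9
  · linear_combination e10
  · linear_combination -e11
  · linear_combination e12
  · linear_combination -e13
  · linear_combination e14
  · linear_combination e15
  · linear_combination e16
  · linear_combination -e17
  · linear_combination -e18
  · linear_combination e19

/-- The curvature of the weight connection. -/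
theorem weight_curvature :
    (F.fr2 F.K 0 1 = F.Ψ - F.Λ - F.rot 1 0 2 * F.rot 0 1 3 ∧ F.fr2 F.Kt 0 1 = F.Ψt - F.Λ - F.rot 1 0 3 * F.rot 0 1 2)
      ∧ (F.fr2 F.K 0 2 = 0 ∧ F.fr2 F.Kt 0 2 = -(F.rot 2 0 3 * F.rot 0 1 2))
      ∧ (F.fr2 F.K 0 3 = -(F.rot 3 0 2 * F.rot 0 1 3) ∧ F.fr2 F.Kt 0 3 = 0)
      ∧ (F.fr2 F.K 1 2 = F.rot 2 1 3 * F.rot 1 0 2 ∧ F.fr2 F.Kt 1 2 = 0)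
      ∧ (F.fr2 F.K 1 3 = 0 ∧ F.fr2 F.Kt 1 3 = F.rot 3 1 2 * F.rot 1 0 3)
      ∧ (F.fr2 F.K 2 3 = -(F.rot 3 0 2 * F.rot 2 1 3 + F.Ψ - F.Λ) ∧ F.fr2 F.Kt 2 3 = F.rot 2 0 3 * F.rot 3 1 2 + F.Ψt - F.Λ) := by
  have h := F.structure_eq
  have hr := F.rot_eq
  generalize F.rot 0 1 2 = r012, F.rot 0 1 3 = r013, F.rot 1 0 2 = r102, F.rot 1 0 3 = r103,
    F.rot 2 0 3 = r203, F.rot 2 1 3 = r213, F.rot 3 0 2 = r302, F.rot 3 1 2 = r312 at hr ⊢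
  simp only [hr] at h
  -- The coframe vector `l` has weight `(1,1)` and `m` has weight `(1,-1)`. The `a` equations
  -- therefore give `K + Kt`, the `b` equations give `K - Kt` up to sign, and each is recovered
  -- after cancelling `2`.
  have a01 := h 0 0 1 1
  have b01 := h 2 0 1 3
  have a02 := h 0 0 2 1
  have b02 := h 2 0 2 3
  have a03 := h 0 0 3 1
  have b03 := h 2 0 3 3
  have a12 := h 0 1 2 1
  have b12 := h 2 1 2 3
  have a13 := h 0 1 3 1
  have b13 := h 2 1 3 3
  have a23 := h 0 2 3 1
  have b23 := h 2 2 3 3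
  simp only [fcov2, fcov1, conn, curv, antiMat, eta, wtP, wtQ, Matrix.cons_val, Pi.zero_apply, Pi.neg_apply,
    map_zero, map_neg, mul_zero, zero_mul, sub_zero, neg_zero, add_zero, zero_add, zero_sub,
    mul_one, Int.cast_one, Int.cast_neg, one_mul]
    at a01 b01 a02 b02 a03 b03 a12 b12 a13 b13 a23 b23
  refine ⟨⟨?_, ?_⟩, ⟨?_, ?_⟩, ⟨?_, ?_⟩, ⟨?_, ?_⟩, ⟨?_, ?_⟩, ⟨?_, ?_⟩⟩ <;>
    refine sub_eq_zero.1 (F.flat.two _ ?_)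
  · linear_combination a01 - b01
  · linear_combination a01 + b01
  · linear_combination a02 - b02
  · linear_combination a02 + b02
  · linear_combination a03 - b03
  · linear_combination a03 + b03
  · linear_combination a12 - b12
  · linear_combination a12 + b12
  · linear_combination a13 - b13
  · linear_combination a13 + b13
  · linear_combination a23 - b23
  · linear_combination a23 + b23

/-- The weighted calculus of a principal framing. -/
def toTypeDAlgebra : TypeDAlgebra G where
  X := F.X
  P := F.P
  Q := F.Q
  ρ := F.rot 3 0 2
  ρ' := F.rot 2 1 3
  τ := F.rot 1 0 2
  τ' := F.rot 0 1 3
  ρt := F.rot 2 0 3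
  ρt' := F.rot 3 1 2
  τt := F.rot 1 0 3
  τt' := F.rot 0 1 2
  Ψ := F.Ψ
  Ψt := F.Ψt
  Λ := F.Λ
  x0_rho := F.spin_equations.1
  x2_rho := F.spin_equations.2.1
  x0_tau := F.spin_equations.2.2.1
  x2_tau := F.spin_equations.2.2.2.1
  x1_rho := F.spin_equations.2.2.2.2.1
  x1_rho' := F.spin_equations.2.2.2.2.2.1
  x3_rho' := F.spin_equations.2.2.2.2.2.2.1
  x1_tau' := F.spin_equations.2.2.2.2.2.2.2.1
  x3_tau' := F.spin_equations.2.2.2.2.2.2.2.2.1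
  x0_rho' := F.spin_equations.2.2.2.2.2.2.2.2.2.1
  x0_rhot := F.spin_equations.2.2.2.2.2.2.2.2.2.2.1
  x3_rhot := F.spin_equations.2.2.2.2.2.2.2.2.2.2.2.1
  x0_taut := F.spin_equations.2.2.2.2.2.2.2.2.2.2.2.2.1
  x3_taut := F.spin_equations.2.2.2.2.2.2.2.2.2.2.2.2.2.1
  x1_rhot := F.spin_equations.2.2.2.2.2.2.2.2.2.2.2.2.2.2.1
  x1_rhot' := F.spin_equations.2.2.2.2.2.2.2.2.2.2.2.2.2.2.2.1
  x2_rhot' := F.spin_equations.2.2.2.2.2.2.2.2.2.2.2.2.2.2.2.2.1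
  x1_taut' := F.spin_equations.2.2.2.2.2.2.2.2.2.2.2.2.2.2.2.2.2.1
  x2_taut' := F.spin_equations.2.2.2.2.2.2.2.2.2.2.2.2.2.2.2.2.2.2.1
  x0_rhot' := F.spin_equations.2.2.2.2.2.2.2.2.2.2.2.2.2.2.2.2.2.2.2
  x0_psi := F.bianchi.2.2.1
  x1_psi := F.bianchi.2.2.2.1
  x2_psi := F.bianchi.2.2.2.2.1
  x3_psi := F.bianchi.2.2.2.2.2
  x_lam := F.X_lam
  comm01 f := by
    have h := F.commutator f 0 1
    obtain ⟨h01, h02, h03, h12, h13, h23⟩ := F.weight_curvature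
    rw [h01.1, h01.2] at h
    have hr := F.rot_eq
    generalize F.rot 0 1 2 = r012, F.rot 0 1 3 = r013, F.rot 1 0 2 = r102, F.rot 1 0 3 = r103,
      F.rot 2 0 3 = r203, F.rot 2 1 3 = r213, F.rot 3 0 2 = r302, F.rot 3 1 2 = r312 at hr h ⊢
    simp only [hr, fcov1, conn, Matrix.cons_val, mul_zero, zero_mul, sub_zero, zero_sub] at h
    linear_combination -h
  comm02 f := by
    have h := F.commutator f 0 2
    obtain ⟨h01, h02, h03, h12, h13, h23⟩ := F.weight_curvature
    rw [h02.1, h02.2] at h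
    have hr := F.rot_eq
    generalize F.rot 0 1 2 = r012, F.rot 0 1 3 = r013, F.rot 1 0 2 = r102, F.rot 1 0 3 = r103,
      F.rot 2 0 3 = r203, F.rot 2 1 3 = r213, F.rot 3 0 2 = r302, F.rot 3 1 2 = r312 at hr h ⊢
    simp only [hr, fcov1, conn, Matrix.cons_val, mul_zero, zero_mul, sub_zero, zero_sub] at h
    linear_combination -h
  comm03 f := by
    have h := F.commutator f 0 3
    obtain ⟨h01, h02, h03, h12, h13, h23⟩ := F.weight_curvature
    rw [h03.1, h03.2] at h
    have hr := F.rot_eq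
    generalize F.rot 0 1 2 = r012, F.rot 0 1 3 = r013, F.rot 1 0 2 = r102, F.rot 1 0 3 = r103,
      F.rot 2 0 3 = r203, F.rot 2 1 3 = r213, F.rot 3 0 2 = r302, F.rot 3 1 2 = r312 at hr h ⊢
    simp only [hr, fcov1, conn, Matrix.cons_val, mul_zero, zero_mul, sub_zero, zero_sub] at h
    linear_combination -h
  comm12 f := by
    have h := F.commutator f 1 2
    obtain ⟨h01, h02, h03, h12, h13, h23⟩ := F.weight_curvature
    rw [h12.1, h12.2] at h
    have hr := F.rot_eq
    generalize F.rot 0 1 2 = r012, F.rot 0 1 3 = r013, F.rot 1 0 2 = r102, F.rot 1 0 3 = r103,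
      F.rot 2 0 3 = r203, F.rot 2 1 3 = r213, F.rot 3 0 2 = r302, F.rot 3 1 2 = r312 at hr h ⊢
    simp only [hr, fcov1, conn, Matrix.cons_val, mul_zero, zero_mul, sub_zero, zero_sub] at h
    linear_combination -h
  comm13 f := by
    have h := F.commutator f 1 3
    obtain ⟨h01, h02, h03, h12, h13, h23⟩ := F.weight_curvature
    rw [h13.1, h13.2] at h
    have hr := F.rot_eq
    generalize F.rot 0 1 2 = r012, F.rot 0 1 3 = r013, F.rot 1 0 2 = r102, F.rot 1 0 3 = r103,
      F.rot 2 0 3 = r203, F.rot 2 1 3 = r213, F.rot 3 0 2 = r302, F.rot 3 1 2 = r312 at hr h ⊢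
    simp only [hr, fcov1, conn, Matrix.cons_val, mul_zero, zero_mul, sub_zero, zero_sub] at h
    linear_combination -h
  comm23 f := by
    have h := F.commutator f 2 3
    obtain ⟨h01, h02, h03, h12, h13, h23⟩ := F.weight_curvature
    rw [h23.1, h23.2] at h
    have hr := F.rot_eq
    generalize F.rot 0 1 2 = r012, F.rot 0 1 3 = r013, F.rot 1 0 2 = r102, F.rot 1 0 3 = r103,
      F.rot 2 0 3 = r203, F.rot 2 1 3 = r213, F.rot 3 0 2 = r302, F.rot 3 1 2 = r312 at hr h ⊢
    simp only [hr, fcov1, conn, Matrix.cons_val, mul_zero, zero_mul, sub_zero, zero_sub] at h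
    linear_combination -h
  p_x0 f := by
    rw [F.X_weight F.P (wtP 0) 0 (F.P_V 0) F.P_D]
    simp [wtP, sub_eq_add_neg]
  p_x1 f := by
    rw [F.X_weight F.P (wtP 1) 1 (F.P_V 1) F.P_D]
    simp [wtP, sub_eq_add_neg]
  p_x2 f := by
    rw [F.X_weight F.P (wtP 2) 2 (F.P_V 2) F.P_D]
    simp [wtP, sub_eq_add_neg]
  p_x3 f := by
    rw [F.X_weight F.P (wtP 3) 3 (F.P_V 3) F.P_D]
    simp [wtP, sub_eq_add_neg]
  p_rho := by simp [F.rot_weight F.P wtP F.P_E F.P_V F.P_Γ F.P_D, wtP]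
  p_tau := by simp [F.rot_weight F.P wtP F.P_E F.P_V F.P_Γ F.P_D, wtP]
  p_rho' := by simp [F.rot_weight F.P wtP F.P_E F.P_V F.P_Γ F.P_D, wtP]
  p_tau' := by simp [F.rot_weight F.P wtP F.P_E F.P_V F.P_Γ F.P_D, wtP]
  p_rhot := by simp [F.rot_weight F.P wtP F.P_E F.P_V F.P_Γ F.P_D, wtP]
  p_taut := by simp [F.rot_weight F.P wtP F.P_E F.P_V F.P_Γ F.P_D, wtP]
  p_rhot' := by simp [F.rot_weight F.P wtP F.P_E F.P_V F.P_Γ F.P_D, wtP]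
  p_taut' := by simp [F.rot_weight F.P wtP F.P_E F.P_V F.P_Γ F.P_D, wtP]
  q_x0 f := by
    rw [F.X_weight F.Q (wtQ 0) 0 (F.Q_V 0) F.Q_D]
    simp [wtQ, sub_eq_add_neg]
  q_x1 f := by
    rw [F.X_weight F.Q (wtQ 1) 1 (F.Q_V 1) F.Q_D]
    simp [wtQ, sub_eq_add_neg]
  q_x2 f := by
    rw [F.X_weight F.Q (wtQ 2) 2 (F.Q_V 2) F.Q_D]
    simp [wtQ, sub_eq_add_neg]
  q_x3 f := by
    rw [F.X_weight F.Q (wtQ 3) 3 (F.Q_V 3) F.Q_D]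
    simp [wtQ, sub_eq_add_neg]
  q_rho := by simp [F.rot_weight F.Q wtQ F.Q_E F.Q_V F.Q_Γ F.Q_D, wtQ]
  q_tau := by simp [F.rot_weight F.Q wtQ F.Q_E F.Q_V F.Q_Γ F.Q_D, wtQ]
  q_rho' := by simp [F.rot_weight F.Q wtQ F.Q_E F.Q_V F.Q_Γ F.Q_D, wtQ]
  q_tau' := by simp [F.rot_weight F.Q wtQ F.Q_E F.Q_V F.Q_Γ F.Q_D, wtQ]
  q_rhot := by simp [F.rot_weight F.Q wtQ F.Q_E F.Q_V F.Q_Γ F.Q_D, wtQ]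
  q_taut := by simp [F.rot_weight F.Q wtQ F.Q_E F.Q_V F.Q_Γ F.Q_D, wtQ]
  q_rhot' := by simp [F.rot_weight F.Q wtQ F.Q_E F.Q_V F.Q_Γ F.Q_D, wtQ]
  q_taut' := by simp [F.rot_weight F.Q wtQ F.Q_E F.Q_V F.Q_Γ F.Q_D, wtQ]
  p_psi := F.P_Ψ
  q_psi := F.Q_Ψ

theorem toTypeDAlgebra_rot : F.toTypeDAlgebra.rot = F.rot :=
  F.rot_eq.symm

end PrincipalFraming
end TypeDRec

/-! ### The perturbation and the Teukolsky operator of a weighted framing -/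

namespace TypeDRec

section Div

variable {G : Type*} [CommRing G] (D : Fin 4 → Derivation ℤ G G) (Γ : Fin 4 → Fin 4 → Fin 4 → G)
  (gi : Fin 4 → Fin 4 → G)

/-- `∇^d t_{acdb}` -/
def cdiv4 (t : Fin 4 → Fin 4 → Fin 4 → Fin 4 → G) (a c b : Fin 4) : G :=
  ∑ d, ∑ e, gi d e * ccov4 D Γ t e a c d b

/-- `∇^c t_{acb}` -/
def cdiv3 (t : Fin 4 → Fin 4 → Fin 4 → G) (a b : Fin 4) : G :=
  ∑ c, ∑ e, gi c e * ccov3 D Γ t e a c b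

/-- `∇_a h_{bc} + ∇_b h_{ac} - ∇_c h_{ab}`, index order `c a b`. -/
def cdh (h : Fin 4 → Fin 4 → G) (c a b : Fin 4) : G :=
  ccov2 D Γ h a b c + ccov2 D Γ h b a c - ccov2 D Γ h c a b

/-- `∇^c (∇_a h_{bc} + ∇_b h_{ac} - ∇_c h_{ab})` -/
def clin (h : Fin 4 → Fin 4 → G) (a b : Fin 4) : G :=
  ∑ c, ∑ e, gi c e * ccov3 D Γ (cdh D Γ h) e c a b

end Div

namespace Framing

variable {G : Type*} [CommRing G] (F : Framing G)

/-- The inverse metric. -/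
def gi (a b : Fin 4) : G := etaTr fun i j => F.V i a * F.V j b

theorem sum_gi (u : Fin 4 → Fin 4 → G) :
    ∑ a, ∑ b, F.gi a b * u a b = etaTr fun i j => F.con j fun b => F.con i fun a => u b a := by
  simp only [gi, etaTr, con, Fin.sum_univ_four]
  ring

theorem con_etaTr (i : Fin 4) (u : Fin 4 → Fin 4 → Fin 4 → G) :
    F.con i (fun a => etaTr (u a)) = etaTr fun p q => F.con i fun a => u a p q := by
  simp only [con, etaTr, Fin.sum_univ_four]
  ring

theorem fr2_etaTr (i j : Fin 4) (u : Fin 4 → Fin 4 → Fin 4 → Fin 4 → G) :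
    F.fr2 (fun a b => etaTr (u a b)) i j = etaTr fun p q => F.fr2 (fun a b => u a b p q) i j := by
  simp only [fr2, con_etaTr]

theorem fr3_etaTr (i j k : Fin 4) (u : Fin 4 → Fin 4 → Fin 4 → Fin 4 → Fin 4 → G) :
    F.fr3 (fun a b c => etaTr (u a b c)) i j k
      = etaTr fun p q => F.fr3 (fun a b c => u a b c p q) i j k := by
  simp only [fr3, fr2_etaTr, con_etaTr]

theorem fr2_cdiv3 (t : Fin 4 → Fin 4 → Fin 4 → G) (i j : Fin 4) :
    F.fr2 (cdiv3 F.D F.Γ F.gi t) i j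
      = etaTr fun e c => fcov3 F.X F.rot (F.fr3 t) e i c j := by
  unfold cdiv3
  simp only [F.sum_gi, fr2_etaTr]
  congr 1
  funext p q
  rw [← fr4_ccov3]
  simp only [fr4, fr3, fr2]
  simp only [F.con_comm q i, F.con_comm p i]

theorem fr3_cdiv4 (t : Fin 4 → Fin 4 → Fin 4 → Fin 4 → G) (i j k : Fin 4) :
    F.fr3 (cdiv4 F.D F.Γ F.gi t) i j k
      = etaTr fun e d => fcov4 F.X F.rot (F.fr4 t) e i j d k := by
  unfold cdiv4
  simp only [F.sum_gi, fr3_etaTr]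
  congr 1
  funext p q
  rw [← fr5_ccov4]
  simp only [fr5, fr4, fr3, fr2]
  simp only [F.con_comm q j, F.con_comm q i]

theorem fr3_cdh (h : Fin 4 → Fin 4 → G) : F.fr3 (cdh F.D F.Γ h) = fdh F.X F.rot (F.fr2 h) := by
  funext k i j
  have e : ∀ c a b, cdh F.D F.Γ h c a b
      = (fun c a b => ccov2 F.D F.Γ h a b c + ccov2 F.D F.Γ h b a c) c a b
        - ccov2 F.D F.Γ h c a b := fun _ _ _ => rfl
  rw [show cdh F.D F.Γ h = fun c a b => _ from funext fun c => funext₂ (e c), fr3_sub, fr3_add,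
    fr3_ccov2, fdh]
  congr 2
  · rw [← fr3_ccov2]
    simp only [fr3, fr2, F.con_comm k j, F.con_comm i j, F.con_comm k i]
  · rw [← fr3_ccov2]
    simp only [fr3, fr2, F.con_comm k j, F.con_comm i j, F.con_comm k i]

theorem fr2_clin (h : Fin 4 → Fin 4 → G) (i j : Fin 4) :
    F.fr2 (clin F.D F.Γ F.gi h) i j = flin F.X F.rot (F.fr2 h) i j := by
  unfold clin flin
  simp only [F.sum_gi, fr2_etaTr]
  congr 1
  funext p q
  rw [← fr3_cdh, ← fr4_ccov3]
  rfl

theorem fr4_swap14 (t : Fin 4 → Fin 4 → Fin 4 → Fin 4 → G) (i j p q : Fin 4) :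
    F.fr4 (fun a b c d => t d b c a) i j p q = F.fr4 t q j p i := by
  simp only [fr4, fr3, fr2, F.con_comm p i, F.con_comm j i, F.con_comm q i, F.con_comm p q,
    F.con_comm j q]

theorem eq_of_fr2 {s t : Fin 4 → Fin 4 → G} (h : ∀ i j, F.fr2 s i j = F.fr2 t i j) : s = t := by
  have h1 : ∀ i, (fun b => F.con i fun a => s a b) = fun b => F.con i fun a => t a b :=
    fun i => F.eq_of_contr' (h i)
  funext a b
  have h2 : (fun a => s a b) = fun a => t a b := F.eq_of_contr' fun i => congrFun (h1 i) b
  exact congrFun h2 a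

end Framing

namespace PrincipalFraming

variable {G : Type*} [CommRing G] (F : PrincipalFraming G)

open TypeDAlgebra

/-- The two-form `l ∧ m`. -/
def mForm (a b : Fin 4) : G := F.E 0 a * F.E 2 b - F.E 0 b * F.E 2 a

/-- Twice the symmetrized Hertz potential with scalar factor `u`. -/
def hertzField (u : G) (a c d b : Fin 4) : G :=
  (F.mForm a c * F.mForm d b + F.mForm b c * F.mForm d a) * u

/-- The tensor `x l l - y (l m + m l) + z m m`. -/
def nullField (x y z : G) (a b : Fin 4) : G :=
  x * (F.E 0 a * F.E 0 b) - y * (F.E 0 a * F.E 2 b + F.E 2 a * F.E 0 b) + z * (F.E 2 a * F.E 2 b)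

theorem con_E (i j : Fin 4) : F.con i (F.E j) = eta j i := by
  rw [← F.dual, Framing.con]
  simp only [mul_comm]

theorem fr2_mul (u v : Fin 4 → G) (i j : Fin 4) :
    F.fr2 (fun a b => u a * v b) i j = F.con i u * F.con j v := by
  simp only [Framing.fr2, Framing.con, Fin.sum_univ_four]
  ring

theorem fr2_mForm : F.fr2 F.mForm = nullForm := by
  funext i j
  have h := F.fr2_sub (fun a b => F.E 0 a * F.E 2 b) (fun a b => F.E 2 a * F.E 0 b) i j
  rw [fr2_mul, fr2_mul] at h
  simp only [con_E] at h
  have e : F.mForm = fun a b => F.E 0 a * F.E 2 b - F.E 2 a * F.E 0 b := by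
    funext a b
    rw [mForm, mul_comm (F.E 0 b)]
  rw [e, h]
  fin_cases i <;> fin_cases j <;> simp [eta, nullForm]

theorem fr2_nullField (x y z : G) : F.fr2 (F.nullField x y z) = nullTensor x y z := by
  funext i j
  have e : F.nullField x y z = fun a b => (fun a b => (x * F.E 0 a) * F.E 0 b) a b
      + ((fun a b => ((-y) * F.E 0 a) * F.E 2 b) a b + ((fun a b => ((-y) * F.E 2 a) * F.E 0 b) a b
      + (z * F.E 2 a) * F.E 2 b)) := by
    funext a b
    simp only [nullField]
    ring
  have hm : ∀ (c : G) (k : Fin 4) (i : Fin 4), F.con i (fun a => c * F.E k a) = c * eta k i := by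
    intro c k i
    rw [← F.con_E i k]
    simp only [Framing.con, Fin.sum_univ_four]
    ring
  rw [e]
  simp only [F.fr2_add, fr2_mul, hm, con_E]
  fin_cases i <;> fin_cases j <;> simp [eta, nullTensor]

theorem fr4_hertzField (u : G) : F.fr4 (F.hertzField u) = hertzPot u := by
  funext i j p q
  have e : F.hertzField u = fun a c d b => (fun a c d b => (F.mForm a c * F.mForm d b) * u) a c d b
      + (fun a c d b => (F.mForm b c * F.mForm d a) * u) a c d b := by
    funext a c d b
    simp only [hertzField]
    ring
  have h : ∀ s t : Fin 4 → Fin 4 → G, ∀ i j p q, F.fr4 (fun a c d b => (s a c * t d b) * u) i j p q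
      = F.fr2 s i j * F.fr2 t p q * u := by
    intro s t i j p q
    have h1 : ∀ d b, F.fr2 (fun a c => (s a c * t d b) * u) i j = F.fr2 s i j * u * t d b := by
      intro d b
      simp only [Framing.fr2, Framing.con, Fin.sum_univ_four]
      ring
    simp only [Framing.fr4, Framing.fr3, h1]
    simp only [Framing.fr2, Framing.con, Fin.sum_univ_four]
    ring
  have h' : F.fr4 (fun a c d b => (F.mForm b c * F.mForm d a) * u) i j p q
      = F.fr2 F.mForm q j * F.fr2 F.mForm p i * u := by
    rw [← h, Framing.fr4_swap14]
  rw [e, F.fr4_add, h, h', fr2_mForm, hertzPot]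
  ring

/-- The scalars `(þ + 3ρ) f`, `(ð + 3τ) f` and their second order counterparts. -/
def potA (f : G) : G := F.X 0 f + 3 * F.rot 3 0 2 * f
def potB (f : G) : G := F.X 2 f + 3 * F.rot 1 0 2 * f
def potX (f : G) : G := F.X 2 (F.potB f) - F.rot 1 0 2 * F.potB f
def potY (f : G) : G := F.X 2 (F.potA f) + (F.rot 2 0 3 - 2 * F.rot 3 0 2) * F.potB f
  + F.rot 1 0 2 * F.potA f
def potZ (f : G) : G := F.X 0 (F.potA f) - F.rot 3 0 2 * F.potA f

/-- The perturbation with Debye potential `f`. -/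
def pert (f : G) : Fin 4 → Fin 4 → G := F.nullField (F.potX f) (F.potY f) (F.potZ f)

variable {F} {f : G}

theorem debyeJet (hP : F.P f = -4 * f) (hQ : F.Q f = 0) :
    F.toTypeDAlgebra.DebyeJet f (F.potA f) (F.potB f) (F.potX f) (F.potY f) (F.potZ f) where
  p_f := hP
  q_f := hQ
  x0_f := by simp [potA, toTypeDAlgebra]
  x2_f := by simp [potB, toTypeDAlgebra]
  x0_a := by simp [potZ, toTypeDAlgebra]
  x2_a := by
    simp only [potY, toTypeDAlgebra]
    ring
  x2_b := by simp [potX, toTypeDAlgebra]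

theorem x0_potB (hP : F.P f = -4 * f) (hQ : F.Q f = 0) : F.X 0 (F.potB f)
    = F.potY f - F.rot 3 0 2 * F.potB f + (2 * F.rot 1 0 2 - F.rot 0 1 2) * F.potA f :=
  (debyeJet hP hQ).x0_b

/-- Differentiating `ψ³ = Ψ` gives `3ψ²(Xψ - uψ) = 0`, where both `3` and `ψ²` can be cancelled. -/
theorem X_cubeRoot {ψ φ : G} (hφ : φ * ψ = 1) (hψ : ψ ^ 3 = F.Ψ) {k : Fin 4} {u : G}
    (h : F.X k F.Ψ = 3 * u * F.Ψ) : F.X k ψ = u * ψ := by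
  rw [← hψ, pow_three, Derivation.leibniz, Derivation.leibniz] at h
  simp only [smul_eq_mul] at h
  have h3 := F.three (ψ ^ 2 * (F.X k ψ - u * ψ)) (by linear_combination h)
  linear_combination φ ^ 2 * h3 - (F.X k ψ - u * ψ) * (φ * ψ + 1) * hφ

/-- By `X_cubeRoot` the factor `ψ⁴` can be pulled through the first divergence, adding `4ρ` and `4τ`
to `þ` and `ð`. The factor `φ⁴` then cancels it before the second divergence is taken. -/
theorem recon_hertzField (hP : F.P f = -4 * f) (hQ : F.Q f = 0) {ψ φ : G} (hφ : φ * ψ = 1)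
    (hψ : ψ ^ 3 = F.Ψ) (a b : Fin 4) :
    cdiv3 F.D F.Γ F.gi (fun a c b => φ ^ 4 * cdiv4 F.D F.Γ F.gi (F.hertzField (ψ ^ 4 * f)) a c b) a b
      = -2 * F.pert f a b := by
  have hj := debyeJet hP hQ
  have h4 : ∀ k u, F.X k ψ = u * ψ → F.X k (ψ ^ 4 * f) = ψ ^ 4 * (F.X k f + 4 * u * f) := by
    intro k u hu
    rw [show ψ ^ 4 * f = ψ * (ψ * (ψ * (ψ * f))) by ring]
    simp only [Derivation.leibniz, smul_eq_mul, hu]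
    ring
  have hφ4 : φ ^ 4 * ψ ^ 4 = 1 := by rw [← mul_pow, hφ, one_pow]
  obtain ⟨-, -, b0, -, b2, -⟩ := F.bianchi
  have e0 := h4 0 _ (X_cubeRoot hφ hψ b0)
  have e2 := h4 2 _ (X_cubeRoot hφ hψ b2)
  have h3 : F.fr3 (fun a c b => φ ^ 4 * cdiv4 F.D F.Γ F.gi (F.hertzField (ψ ^ 4 * f)) a c b)
      = hertzDer (F.potA f) (F.potB f) := by
    funext i j k
    have hm : ∀ t : Fin 4 → Fin 4 → Fin 4 → G,
        F.fr3 (fun a c b => φ ^ 4 * t a c b) i j k = φ ^ 4 * F.fr3 t i j k := by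
      intro t
      simp only [Framing.fr3, Framing.fr2, Framing.con, Finset.mul_sum, mul_left_comm]
    rw [hm, F.fr3_cdiv4, F.fr4_hertzField, ← F.toTypeDAlgebra_rot]
    have hd := div_hertzPot (T := F.toTypeDAlgebra) (ψ ^ 4 * f) i j k
    have hx : F.toTypeDAlgebra.X = F.X := rfl
    rw [hx] at hd
    rw [hd, e0, e2]
    have hA : ψ ^ 4 * (F.X 0 f + 4 * F.rot 3 0 2 * f) - F.toTypeDAlgebra.ρ * (ψ ^ 4 * f)
        = ψ ^ 4 * F.potA f := by
      simp only [potA, toTypeDAlgebra]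
      ring
    have hB : ψ ^ 4 * (F.X 2 f + 4 * F.rot 1 0 2 * f) - F.toTypeDAlgebra.τ * (ψ ^ 4 * f)
        = ψ ^ 4 * F.potB f := by
      simp only [potB, toTypeDAlgebra]
      ring
    rw [hA, hB]
    have hs : ∀ v w : G, φ ^ 4 * hertzDer (ψ ^ 4 * v) (ψ ^ 4 * w) i j k
        = φ ^ 4 * ψ ^ 4 * hertzDer v w i j k := by
      intro v w
      fin_cases i <;> fin_cases j <;> fin_cases k <;> simp [hertzDer] <;> ring
    rw [hs, hφ4, one_mul]
  suffices h : cdiv3 F.D F.Γ F.gi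
      (fun a c b => φ ^ 4 * cdiv4 F.D F.Γ F.gi (F.hertzField (ψ ^ 4 * f)) a c b)
      = fun a b => -2 * F.pert f a b from congrFun (congrFun h a) b
  apply F.eq_of_fr2
  intro i j
  have hm : F.fr2 (fun a b => -2 * F.pert f a b) i j = -2 * F.fr2 (F.pert f) i j := by
    simp only [Framing.fr2, Framing.con, Finset.mul_sum, mul_left_comm]
  rw [hm, pert, fr2_nullField, F.fr2_cdiv3, h3, ← F.toTypeDAlgebra_rot]
  exact div_hertzDer hj i j

/-- The one-form `-ρ n + τ mt`. -/
def bField (F : PrincipalFraming G) (a : Fin 4) : G :=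
  -F.rot 3 0 2 * F.E 1 a + F.rot 1 0 2 * F.E 3 a

/-- The first order part of the Teukolsky operator. -/
def twistedGrad (F : PrincipalFraming G) (f : G) (a : Fin 4) : G := F.D a f - 4 * F.bField a * f

/-- The Teukolsky operator of spin weight `-2`. -/
def teukField (F : PrincipalFraming G) (f : G) : G :=
  (∑ a, ∑ b, F.gi a b * (ccov1 F.D F.Γ (F.twistedGrad f) a b - 4 * F.bField a * F.twistedGrad f b))
    - 16 * F.Ψ * f + 4 * F.Λ * f

/-- The one-form `bField` has `-ρ` and `-τ` as its only frame components, along `l` and `m`, which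
explains the vector in `TypeDAlgebra.teuk`. -/
theorem teukField_eq : F.teukField f = F.toTypeDAlgebra.teuk f := by
  have hB : ∀ i, F.con i F.bField = (![-F.rot 3 0 2, 0, -F.rot 1 0 2, 0] : Fin 4 → G) i := by
    intro i
    have : F.con i F.bField = -F.rot 3 0 2 * F.con i (F.E 1) + F.rot 1 0 2 * F.con i (F.E 3) := by
      simp only [Framing.con, bField, Fin.sum_univ_four]
      ring
    rw [this, con_E, con_E]
    fin_cases i <;> simp [eta]
  have hw : ∀ i, F.con i (F.twistedGrad f) = F.X i f - 4 * F.con i F.bField * f := by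
    intro i
    simp only [Framing.con, twistedGrad, Fin.sum_univ_four, Framing.X_apply]
    ring
  have hsw : ∀ t : Fin 4 → Fin 4 → G, etaTr (fun i j => t j i) = etaTr t := by
    intro t
    simp only [etaTr]
    ring
  have hu : ∀ i j, F.con j (fun b => F.con i fun a =>
      ccov1 F.D F.Γ (F.twistedGrad f) b a - 4 * F.bField b * F.twistedGrad f a)
      = fcov1 F.X F.rot (fun i => F.con i (F.twistedGrad f)) j i
        - 4 * F.con j F.bField * F.con i (F.twistedGrad f) := by
    intro i j
    rw [← F.fr2_ccov1, Framing.fr2, F.con_comm i j]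
    simp only [Framing.con, Fin.sum_univ_four]
    ring
  rw [teukField, F.sum_gi]
  simp only [hu]
  rw [hsw fun j i => fcov1 F.X F.rot (fun i => F.con i (F.twistedGrad f)) j i
    - 4 * F.con j F.bField * F.con i (F.twistedGrad f)]
  simp only [hw, hB]
  rw [← F.toTypeDAlgebra_rot]
  rfl

theorem clin_pert (hP : F.P f = -4 * f) (hQ : F.Q f = 0) (h0 : F.teukField f = 0) (a b : Fin 4) :
    clin F.D F.Γ F.gi (F.pert f) a b + 12 * F.Λ * F.pert f a b = 0 := by
  have hj := debyeJet hP hQ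
  rw [teukField_eq] at h0
  suffices h : (fun a b => clin F.D F.Γ F.gi (F.pert f) a b + 12 * F.Λ * F.pert f a b)
      = fun a b => 0 from congrFun (congrFun h a) b
  apply F.eq_of_fr2
  intro i j
  have hm : F.fr2 (fun a b => 12 * F.Λ * F.pert f a b) i j = 12 * F.Λ * F.fr2 (F.pert f) i j := by
    simp only [Framing.fr2, Framing.con, Finset.mul_sum, mul_left_comm]
  rw [F.fr2_add, hm, F.fr2_clin, pert, fr2_nullField, ← F.toTypeDAlgebra_rot]
  have := hj.flin_eq_zero (hj.x1_a h0 F.flat.two) i j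
  simp only [Framing.fr2, Framing.con, mul_zero, Finset.sum_const_zero]
  exact this

end PrincipalFraming
end TypeDRec

/-! ### The ring of quantities of all weights -/

namespace TypeDRec

open AddMonoidAlgebra

/-- Quantities of all weights with coefficients in `A`. -/
abbrev Graded (A : Type*) [CommRing A] : Type _ := AddMonoidAlgebra A (ℤ × ℤ)

/-- The derivations of a commutative ring. -/
abbrev Der (G : Type*) [CommRing G] : Type _ := Derivation ℤ G G

section Graded

variable {A : Type*} [CommRing A]

/-- The additive map acting on the weight `k` part by `x ↦ δ x + φ k * x`. -/
noncomputable def gradedHom (δ : Derivation ℤ A A) (φ : ℤ × ℤ →+ A) : Graded A →+ Graded A :=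
  (Finsupp.liftAddHom fun k => (singleAddHom k).comp
    ((δ : A →ₗ[ℤ] A).toAddMonoidHom + AddMonoidHom.mulLeft (φ k))).comp
    (coeffAddEquiv : Graded A ≃+ (ℤ × ℤ →₀ A)).toAddMonoidHom

theorem gradedHom_single (δ : Derivation ℤ A A) (φ : ℤ × ℤ →+ A) (k : ℤ × ℤ) (x : A) :
    gradedHom δ φ (single k x) = single k (δ x + φ k * x) := by
  change (Finsupp.single k x).sum _ = _
  rw [Finsupp.sum_single_index] <;> simp

/-- The derivation acting on the weight `k` part by `x ↦ δ x + φ k * x`. -/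
noncomputable def gradedDer (δ : Derivation ℤ A A) (φ : ℤ × ℤ →+ A) : Der (Graded A) :=
  Derivation.mk' (gradedHom δ φ).toIntLinearMap fun a b => by
    simp only [AddMonoidHom.coe_toIntLinearMap, smul_eq_mul]
    induction a using AddMonoidAlgebra.induction_linear with
    | zero => simp
    | add f g hf hg => simp only [add_mul, map_add, hf, hg, mul_add]; ring
    | single m r =>
      induction b using AddMonoidAlgebra.induction_linear with
      | zero => simp
      | add f g hf hg => simp only [mul_add, map_add, hf, hg, add_mul]; ring
      | single n s =>
        simp only [single_mul_single, gradedHom_single, Derivation.leibniz, smul_eq_mul, map_add]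
        rw [add_comm n m, ← single_add]
        congr 1
        ring

theorem gradedDer_single (δ : Derivation ℤ A A) (φ : ℤ × ℤ →+ A) (k : ℤ × ℤ) (x : A) :
    gradedDer δ φ (single k x) = single k (δ x + φ k * x) :=
  gradedHom_single δ φ k x

theorem graded_cancel {n : ℕ} (h : ∀ u : A, (n : A) * u = 0 → u = 0) (u : Graded A)
    (hu : (n : Graded A) * u = 0) : u = 0 := by
  ext k
  apply h
  have h1 := congrArg (fun v : Graded A => v.coeff k) hu
  simpa [natCast_def, coeff_single_zero_mul] using h1

/-- The weight map `(p, q) ↦ -(p α + q β)`. -/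
def weightHom (α β : A) : ℤ × ℤ →+ A where
  toFun k := -((k.1 : A) * α + (k.2 : A) * β)
  map_zero' := by simp
  map_add' k l := by
    simp only [Prod.fst_add, Prod.snd_add, Int.cast_add]
    ring

end Graded

section Transfer

variable {A G : Type*} [CommRing A] [CommRing G] (φ : A →+* G) {D : Fin 4 → Derivation ℤ A A}
  {D' : Fin 4 → Derivation ℤ G G} (Γ : Fin 4 → Fin 4 → Fin 4 → A)

/-- Tensor operations are polynomial in components and their derivatives, so a ring homomorphism
intertwining the derivations respects them. This is applied to the inclusion of the weight zero
part. -/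
theorem map_ccov2 (hD : ∀ a x, D' a (φ x) = φ (D a x)) (t : Fin 4 → Fin 4 → A) (c a b : Fin 4) :
    ccov2 D' (fun c a b => φ (Γ c a b)) (fun a b => φ (t a b)) c a b = φ (ccov2 D Γ t c a b) := by
  simp only [ccov2, hD, map_sub, map_sum, map_mul]

theorem map_ccov3 (hD : ∀ a x, D' a (φ x) = φ (D a x)) (t : Fin 4 → Fin 4 → Fin 4 → A)
    (c i j k : Fin 4) :
    ccov3 D' (fun c a b => φ (Γ c a b)) (fun a b c => φ (t a b c)) c i j k
      = φ (ccov3 D Γ t c i j k) := by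
  simp only [ccov3, hD, map_sub, map_sum, map_mul]

theorem map_ccov4 (hD : ∀ a x, D' a (φ x) = φ (D a x)) (t : Fin 4 → Fin 4 → Fin 4 → Fin 4 → A)
    (c i j k l : Fin 4) :
    ccov4 D' (fun c a b => φ (Γ c a b)) (fun a b c d => φ (t a b c d)) c i j k l
      = φ (ccov4 D Γ t c i j k l) := by
  simp only [ccov4, hD, map_sub, map_sum, map_mul]

theorem map_riem (hD : ∀ a x, D' a (φ x) = φ (D a x)) (a b d c : Fin 4) :
    riem D' (fun c a b => φ (Γ c a b)) a b d c = φ (riem D Γ a b d c) := by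
  simp only [riem, hD, map_sub, map_add, map_sum, map_mul]

end Transfer

/-- A vacuum type D metric with a principal null tetrad, together with the connection forms `wconn`, `wconnt`
of the weights. -/
structure PrincipalTetrad (A : Type*) [CommRing A] extends Framing A where
  (wconn wconnt : Fin 4 → A)
  (Ψ Ψt Λ : A)
  two : ∀ u : A, 2 * u = 0 → u = 0
  three : ∀ u : A, 3 * u = 0 → u = 0
  D_comm : ∀ a b f, D a (D b f) = D b (D a f)
  D_Λ : ∀ a, D a Λ = 0
  wconn_eq : ∀ k, 2 * toFraming.con k wconn = toFraming.rot k 0 1 - toFraming.rot k 2 3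
  wconnt_eq : ∀ k, 2 * toFraming.con k wconnt = toFraming.rot k 0 1 + toFraming.rot k 2 3
  ricci : ∀ a b, ∑ c, riem D Γ a c b c = 6 * Λ * toFraming.met a b
  rm0202 : toFraming.rm 0 2 0 2 = 0
  rm0201 : toFraming.rm 0 2 0 1 = 0
  rm0231 : toFraming.rm 0 2 3 1 = Ψ + 2 * Λ
  rm0131 : toFraming.rm 0 1 3 1 = 0
  rm3131 : toFraming.rm 3 1 3 1 = 0
  rm0303 : toFraming.rm 0 3 0 3 = 0
  rm0301 : toFraming.rm 0 3 0 1 = 0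
  rm0321 : toFraming.rm 0 3 2 1 = Ψt + 2 * Λ
  rm0121 : toFraming.rm 0 1 2 1 = 0
  rm2121 : toFraming.rm 2 1 2 1 = 0
  unit_psi : IsUnit Ψ
  unit_psit : IsUnit Ψt

/-- The weight of the coframe vector `E i`. -/
def wt (i : Fin 4) : ℤ × ℤ := (wtP i, wtQ i)

namespace PrincipalTetrad

variable {A : Type*} [CommRing A] (F : PrincipalTetrad A)

/-- Embedding of the functions as the quantities of weight zero. -/
noncomputable def ι (A : Type*) [CommRing A] : A →+* Graded A := singleZeroRingHom

theorem ι_apply (x : A) : ι A x = single 0 x := rfl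

theorem ι_mul (k : ℤ × ℤ) (x y : A) : ι A x * single k y = single k (x * y) := by
  simp [ι_apply, single_mul_single]

/-- The weighted coordinate derivations. -/
noncomputable def gD (a : Fin 4) : Der (Graded A) :=
  gradedDer (F.D a) (weightHom (F.wconn a) (F.wconnt a))

/-- The sign in `weightHom` is why the arguments are `-1`: the result multiplies by `+p`, and
likewise `gQ` by `+q`. -/
noncomputable def gP (A : Type*) [CommRing A] : Der (Graded A) :=
  gradedDer 0 (weightHom (-1) 0)
noncomputable def gQ (A : Type*) [CommRing A] : Der (Graded A) :=
  gradedDer 0 (weightHom 0 (-1))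

theorem gD_single (a : Fin 4) (k : ℤ × ℤ) (x : A) : F.gD a (single k x)
    = single k (F.D a x - (k.1 * F.wconn a + k.2 * F.wconnt a) * x) := by
  rw [gD, gradedDer_single, weightHom]
  congr 1
  simp only [AddMonoidHom.coe_mk, ZeroHom.coe_mk]
  ring

theorem gP_single (k : ℤ × ℤ) (x : A) : gP A (single k x) = single k (k.1 * x) := by
  rw [gP, gradedDer_single, weightHom]
  simp

theorem gQ_single (k : ℤ × ℤ) (x : A) : gQ A (single k x) = single k (k.2 * x) := by
  rw [gQ, gradedDer_single, weightHom]
  simp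

theorem gD_ι (a : Fin 4) (x : A) : F.gD a (ι A x) = ι A (F.D a x) := by
  rw [ι_apply, gD_single]
  simp [ι_apply]

theorem intCast_mul_single (n : ℤ) (k : ℤ × ℤ) (x : A) :
    (n : Graded A) * single k x = single k (n * x) := by
  rw [← ι_mul, map_intCast]

theorem single_sum {α : Type*} (s : Finset α) (k : ℤ × ℤ) (f : α → A) :
    ∑ i ∈ s, single k (f i) = (single k (∑ i ∈ s, f i) : Graded A) :=
  (map_sum (singleAddHom k) f s).symm

/-- The frame metric is nonzero only between vectors of opposite weight, so it is of weight zero.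
This makes the graded coframe dual to the graded frame. -/
theorem single_eta (i j : Fin 4) : (single (wt i + wt j) (eta i j : A) : Graded A) = eta i j := by
  fin_cases i <;> fin_cases j <;> simp [eta, wt, wtP, wtQ, one_def, Prod.mk_zero_zero]

theorem single_etaTr' (f : Fin 4 → Fin 4 → A) :
    etaTr (fun i j => (single (wt i + wt j) (f i j) : Graded A)) = ι A (etaTr f) := by
  simp [etaTr, single_add, single_sub, ι_apply, wt, wtP, wtQ, Prod.mk_zero_zero]

/-- The framing of the weighted quantities. -/
noncomputable def gFraming : Framing (Graded A) where
  D := F.gD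
  E i a := single (wt i) (F.E i a)
  V i a := single (wt i) (F.V i a)
  Γ c a b := ι A (F.Γ c a b)
  dual i j := by
    simp only [single_mul_single, single_sum, F.dual, single_eta]
  symm c a b := by rw [F.symm]
  compat c a b := by
    simp only [single_mul_single, single_etaTr', gD_ι, F.compat, map_add, map_sum, map_mul]

theorem gFraming_met (a b : Fin 4) : F.gFraming.met a b = ι A (F.met a b) := by
  simp only [Framing.met, gFraming, single_mul_single, single_etaTr']

theorem con_single (i : Fin 4) (k : ℤ × ℤ) (t : Fin 4 → A) :
    F.gFraming.con i (fun a => single k (t a)) = single (wt i + k) (F.con i t) := by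
  simp only [Framing.con, gFraming, single_mul_single, single_sum]

theorem fr4_ι (t : Fin 4 → Fin 4 → Fin 4 → Fin 4 → A) (i j p q : Fin 4) :
    F.gFraming.fr4 (fun a b c d => ι A (t a b c d)) i j p q
      = single (wt q + (wt p + (wt j + (wt i + 0)))) (F.fr4 t i j p q) := by
  simp only [Framing.fr4, Framing.fr3, Framing.fr2, ι_apply, con_single]

/-- The weight connection alters only components with `eta i j ≠ 0`. `wconn` and `wconnt` are
normalized so that exactly the `01` and `23` rotation coefficients disappear. -/
theorem gFraming_rot (k i j : Fin 4) : F.gFraming.rot k i j = single (wt k + wt j + wt i)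
    (F.rot k i j - (wtP i * F.con k F.wconn + wtQ i * F.con k F.wconnt) * eta i j) := by
  have h : ∀ c b, ccov1 F.gD (fun c a b => ι A (F.Γ c a b)) (fun a => single (wt i) (F.E i a)) c b
      = single (wt i) (ccov1 F.D F.Γ (F.E i) c b
        - (wtP i * F.wconn c + wtQ i * F.wconnt c) * F.E i b) := by
    intro c b
    simp only [ccov1, gD_single, ι_mul, single_sum, ← single_sub]
    congr 1
    simp only [wt]
    ring
  have h2 : F.gFraming.rot k i j = ∑ c, ∑ b, single (wt k) (F.V k c) * single (wt j) (F.V j b)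
      * ccov1 F.gD (fun c a b => ι A (F.Γ c a b)) (fun a => single (wt i) (F.E i a)) c b := rfl
  rw [h2]
  simp only [h, single_mul_single, single_sum]
  congr 1
  rw [← F.dual i j]
  simp only [Framing.rot, Framing.con, Fin.sum_univ_four]
  ring

theorem gFraming_rm (i j p q : Fin 4) : F.gFraming.rm i j p q
    = single (wt q + (wt p + (wt j + (wt i + 0)))) (F.rm i j p q) := by
  have h : rlow F.gFraming.D F.gFraming.Γ F.gFraming.met
      = fun a b c d => ι A (rlow F.D F.Γ F.met a b c d) := by
    funext a b c d
    have hr : ∀ e, riem F.gFraming.D F.gFraming.Γ a b c e = ι A (riem F.D F.Γ a b c e) :=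
      map_riem (ι A) F.Γ F.gD_ι a b c
    simp only [rlow, hr, gFraming_met, map_sum, map_mul]
  rw [Framing.rm, h, fr4_ι, Framing.rm]

/-- The weighted framing of a vacuum type D metric. -/
noncomputable def graded : PrincipalFraming (Graded A) where
  toFraming := F.gFraming
  P := gP A
  Q := gQ A
  -- The coordinate derivations commute before weighting, so the curvature of the weight connection
  -- is the exterior derivative of its form.
  K a b := ι A (F.D a (F.wconn b) - F.D b (F.wconn a))
  Kt a b := ι A (F.D a (F.wconnt b) - F.D b (F.wconnt a))
  Ψ := ι A F.Ψ
  Ψt := ι A F.Ψt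
  Λ := ι A F.Λ
  flat :=
    { two := graded_cancel (n := 2) (by exact_mod_cast F.two)
      gamma a b c e f := by
        have h : ∀ a x, F.gFraming.D a (ι A x) = ι A (F.D a x) := F.gD_ι
        change F.gFraming.D a (F.gFraming.D b (ι A (F.Γ c e f)))
          = F.gFraming.D b (F.gFraming.D a (ι A (F.Γ c e f)))
        rw [h, h, h, h, F.D_comm]
      met a b c e := by
        have h : ∀ a x, F.gFraming.D a (ι A x) = ι A (F.D a x) := F.gD_ι
        rw [gFraming_met, h, h, h, h, F.D_comm] }
  three := graded_cancel (n := 3) (by exact_mod_cast F.three)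
  D_comm a b f := by
    change F.gD a (F.gD b f) - F.gD b (F.gD a f) = _
    induction f using AddMonoidAlgebra.induction_linear with
    | zero => simp
    | add f g hf hg =>
      simp only [map_add]
      linear_combination hf + hg
    | single k x =>
      simp only [gD_single, gP_single, gQ_single, ι_mul, ← single_add, ← single_sub, ← single_neg]
      congr 1
      simp only [map_sub, map_add, Derivation.leibniz, smul_eq_mul, Derivation.map_intCast,
        F.D_comm a b x]
      ring
  P_D a f := by
    change gP A (F.gD a f) = F.gD a (gP A f)
    induction f using AddMonoidAlgebra.induction_linear with
    | zero => simp
    | add f g hf hg => simp only [map_add, hf, hg]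
    | single k x =>
      simp only [gD_single, gP_single, Derivation.leibniz, smul_eq_mul, Derivation.map_intCast]
      congr 1
      ring
  Q_D a f := by
    change gQ A (F.gD a f) = F.gD a (gQ A f)
    induction f using AddMonoidAlgebra.induction_linear with
    | zero => simp
    | add f g hf hg => simp only [map_add, hf, hg]
    | single k x =>
      simp only [gD_single, gQ_single, Derivation.leibniz, smul_eq_mul, Derivation.map_intCast]
      congr 1
      ring
  P_E i a := by
    change gP A (single (wt i) (F.E i a)) = wtP i * single (wt i) (F.E i a)
    rw [gP_single, intCast_mul_single, wt]
  Q_E i a := by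
    change gQ A (single (wt i) (F.E i a)) = wtQ i * single (wt i) (F.E i a)
    rw [gQ_single, intCast_mul_single, wt]
  P_V i a := by
    change gP A (single (wt i) (F.V i a)) = wtP i * single (wt i) (F.V i a)
    rw [gP_single, intCast_mul_single, wt]
  Q_V i a := by
    change gQ A (single (wt i) (F.V i a)) = wtQ i * single (wt i) (F.V i a)
    rw [gQ_single, intCast_mul_single, wt]
  P_Γ c a b := by
    change gP A (ι A (F.Γ c a b)) = 0
    simp [ι_apply, gP_single]
  Q_Γ c a b := by
    change gQ A (ι A (F.Γ c a b)) = 0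
    simp [ι_apply, gQ_single]
  P_Ψ := by simp [ι_apply, gP_single]
  Q_Ψ := by simp [ι_apply, gQ_single]
  D_Λ a := by
    change F.gD a (ι A F.Λ) = 0
    rw [gD_ι, F.D_Λ, map_zero]
  rot01 k := by
    rw [gFraming_rot, F.two (_ - _), single_zero]
    simp only [wtP, wtQ, eta, Matrix.cons_val, Int.cast_one]
    linear_combination -F.wconn_eq k - F.wconnt_eq k
  rot23 k := by
    rw [gFraming_rot, F.two (_ - _), single_zero]
    simp only [wtP, wtQ, eta, Matrix.cons_val, Int.cast_one, Int.cast_neg]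
    linear_combination F.wconn_eq k - F.wconnt_eq k
  ricci a b := by
    rw [gFraming_met]
    have hr : ∀ c, riem F.gFraming.D F.gFraming.Γ a c b c = ι A (riem F.D F.Γ a c b c) :=
      fun c => map_riem (ι A) F.Γ F.gD_ι a c b c
    simp only [hr, ← map_sum, F.ricci, map_mul, map_ofNat]
  rm0202 := by rw [gFraming_rm, F.rm0202, single_zero]
  rm0201 := by rw [gFraming_rm, F.rm0201, single_zero]
  rm0231 := by
    rw [gFraming_rm, F.rm0231, ← map_ofNat (ι A) 2, ← map_mul, ← map_add, ι_apply]
    simp [wt, wtP, wtQ, Prod.mk_zero_zero]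
  rm0131 := by rw [gFraming_rm, F.rm0131, single_zero]
  rm3131 := by rw [gFraming_rm, F.rm3131, single_zero]
  rm0303 := by rw [gFraming_rm, F.rm0303, single_zero]
  rm0301 := by rw [gFraming_rm, F.rm0301, single_zero]
  rm0321 := by
    rw [gFraming_rm, F.rm0321, ← map_ofNat (ι A) 2, ← map_mul, ← map_add, ι_apply]
    simp [wt, wtP, wtQ, Prod.mk_zero_zero]
  rm0121 := by rw [gFraming_rm, F.rm0121, single_zero]
  rm2121 := by rw [gFraming_rm, F.rm2121, single_zero]
  unit_psi := F.unit_psi.map _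
  unit_psit := F.unit_psit.map _

end PrincipalTetrad
end TypeDRec

/-! ### Reading off homogeneous coefficients -/

namespace TypeDRec

open AddMonoidAlgebra

namespace PrincipalTetrad

variable {A : Type*} [CommRing A] (F : PrincipalTetrad A)

/-- The weighted derivative in the direction of the frame vector `V k` on quantities of type
`{p,q}`. -/
def wder (k : Fin 4) (p q : ℤ) (x : A) : A :=
  F.X k x - (p * F.con k F.wconn + q * F.con k F.wconnt) * x

theorem graded_X_single (k : Fin 4) (p q : ℤ) (x : A) :
    F.graded.X k (single (p, q) x) = single (wt k + (p, q)) (F.wder k p q x) := by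
  have h : F.graded.X k (single (p, q) x) = ∑ a, single (wt k) (F.V k a)
      * F.gD a (single (p, q) x) := Framing.X_apply _ k _
  rw [h]
  simp only [gD_single, single_mul_single, single_sum]
  congr 1
  simp only [wder, Framing.X_apply, Framing.con, Fin.sum_univ_four]
  ring

theorem graded_rot (k i j : Fin 4) (h : (eta i j : A) = 0) :
    F.graded.rot k i j = single (wt k + wt j + wt i) (F.rot k i j) := by
  have := F.gFraming_rot k i j
  rw [h, mul_zero, sub_zero] at this
  exact this

/-- The scalars `(þ + 3ρ) f`, `(ð + 3τ) f` and their second order counterparts. -/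
def potA (f : A) : A := F.wder 0 (-4) 0 f + 3 * F.rot 3 0 2 * f
def potB (f : A) : A := F.wder 2 (-4) 0 f + 3 * F.rot 1 0 2 * f
def potX (f : A) : A := F.wder 2 (-3) (-1) (F.potB f) - F.rot 1 0 2 * F.potB f
def potY (f : A) : A := F.wder 2 (-3) 1 (F.potA f) + (F.rot 2 0 3 - 2 * F.rot 3 0 2) * F.potB f
  + F.rot 1 0 2 * F.potA f
def potZ (f : A) : A := F.wder 0 (-3) 1 (F.potA f) - F.rot 3 0 2 * F.potA f

theorem rho_single : F.graded.rot 3 0 2 = single (1, 1) (F.rot 3 0 2) := F.graded_rot 3 0 2 rfl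
theorem tau_single : F.graded.rot 1 0 2 = single (1, -1) (F.rot 1 0 2) := F.graded_rot 1 0 2 rfl
theorem rhot_single : F.graded.rot 2 0 3 = single (1, 1) (F.rot 2 0 3) := F.graded_rot 2 0 3 rfl
theorem taut'_single : F.graded.rot 0 1 2 = single (1, -1) (F.rot 0 1 2) := F.graded_rot 0 1 2 rfl

theorem ofNat_mul_single (n : ℕ) [n.AtLeastTwo] (k : ℤ × ℤ) (x : A) :
    (OfNat.ofNat n : Graded A) * single k x = single k (OfNat.ofNat n * x) := by
  rw [← ι_mul, map_ofNat]

theorem graded_potA (f : A) : F.graded.potA (single (-4, 0) f) = single (-3, 1) (F.potA f) := by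
  rw [PrincipalFraming.potA, graded_X_single, rho_single, ofNat_mul_single, single_mul_single, potA,
    single_add]
  rfl

theorem graded_potB (f : A) : F.graded.potB (single (-4, 0) f) = single (-3, -1) (F.potB f) := by
  rw [PrincipalFraming.potB, graded_X_single, tau_single, ofNat_mul_single, single_mul_single, potB,
    single_add]
  rfl

theorem graded_potX (f : A) : F.graded.potX (single (-4, 0) f) = single (-2, -2) (F.potX f) := by
  rw [PrincipalFraming.potX, graded_potB, graded_X_single, tau_single, single_mul_single, potX,
    single_sub]
  rfl

theorem graded_potY (f : A) : F.graded.potY (single (-4, 0) f) = single (-2, 0) (F.potY f) := by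
  rw [PrincipalFraming.potY, graded_potB, graded_potA, graded_X_single, tau_single, rho_single,
    rhot_single, ofNat_mul_single, ← single_sub, single_mul_single, single_mul_single, potY,
    single_add, single_add]
  rfl

theorem graded_potZ (f : A) : F.graded.potZ (single (-4, 0) f) = single (-2, 2) (F.potZ f) := by
  rw [PrincipalFraming.potZ, graded_potA, graded_X_single, rho_single, single_mul_single, potZ,
    single_sub]
  rfl

/-- The perturbation `x l l - y (l m + m l) + z m m` with Debye potential `f`. -/
def pert (f : A) (a b : Fin 4) : A :=
  F.potX f * (F.E 0 a * F.E 0 b) - F.potY f * (F.E 0 a * F.E 2 b + F.E 2 a * F.E 0 b)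
    + F.potZ f * (F.E 2 a * F.E 2 b)

theorem graded_E (i a : Fin 4) : F.graded.E i a = single (wt i) (F.E i a) := rfl

theorem graded_pert (f : A) (a b : Fin 4) :
    F.graded.pert (single (-4, 0) f) a b = ι A (F.pert f a b) := by
  simp only [PrincipalFraming.pert, PrincipalFraming.nullField, graded_potX, graded_potY,
    graded_potZ, graded_E, single_mul_single, pert, ι_apply]
  have e0 : ((-2, -2) : ℤ × ℤ) + (wt 0 + wt 0) = 0 := rfl
  have e1 : (wt 2 + wt 0) = (wt 0 + wt 2) := rfl
  have e2 : ((-2, 0) : ℤ × ℤ) + (wt 0 + wt 2) = 0 := rfl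
  have e3 : ((-2, 2) : ℤ × ℤ) + (wt 2 + wt 2) = 0 := rfl
  rw [e1, ← single_add, single_mul_single, e0, e2, e3, ← single_sub, ← single_add]

/-- The weight `{-4,0}` of Debye potentials. -/
theorem gP_potential (f : A) : F.graded.P (single (-4, 0) f) = -4 * single (-4, 0) f := by
  have h : F.graded.P (single (-4, 0) f) = _ := gP_single (-4, 0) f
  have h' := ofNat_mul_single 4 (-4, 0) f
  rw [h, neg_mul, h', ← single_neg]
  congr 1
  push_cast
  ring

theorem gQ_potential (f : A) : F.graded.Q (single (-4, 0) f) = 0 := by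
  have h : F.graded.Q (single (-4, 0) f) = _ := gQ_single (-4, 0) f
  rw [h]
  simp

/-- The pattern of descent: the identity holds in the graded ring for the potential placed in weight
`(-4,0)`, every term has weight `(-2,0)`, and the coefficients are compared. -/
theorem wder_potB (f : A) : F.wder 0 (-3) (-1) (F.potB f)
    = F.potY f - F.rot 3 0 2 * F.potB f + (2 * F.rot 1 0 2 - F.rot 0 1 2) * F.potA f := by
  have h := PrincipalFraming.x0_potB (F.gP_potential f) (F.gQ_potential f)
  rw [graded_potB, graded_potA, graded_potY, graded_X_single, rho_single, tau_single, taut'_single,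
    ofNat_mul_single, ← single_sub, single_mul_single, single_mul_single] at h
  have e0 : wt 0 + ((-3, -1) : ℤ × ℤ) = (-2, 0) := rfl
  have e1 : (1, 1) + ((-3, -1) : ℤ × ℤ) = (-2, 0) := rfl
  have e2 : (1, -1) + ((-3, 1) : ℤ × ℤ) = (-2, 0) := rfl
  rw [e0, e1, e2, ← single_sub, ← single_add] at h
  exact single_right_injective h

/-- The two-form `l ∧ m`. -/
def mForm (a b : Fin 4) : A := F.E 0 a * F.E 2 b - F.E 0 b * F.E 2 a

/-- Twice the symmetrized Hertz potential with scalar factor `u`. -/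
def hertzField (u : A) (a c d b : Fin 4) : A :=
  (F.mForm a c * F.mForm d b + F.mForm b c * F.mForm d a) * u

theorem graded_mForm (a b : Fin 4) : F.graded.mForm a b = single (2, 0) (F.mForm a b) := by
  rw [PrincipalFraming.mForm, graded_E, graded_E, graded_E, graded_E, single_mul_single,
    single_mul_single, ← single_sub]
  rfl

theorem graded_hertzField (u : A) (a c d b : Fin 4) :
    F.graded.hertzField (single (-4, 0) u) a c d b = ι A (F.hertzField u a c d b) := by
  simp only [PrincipalFraming.hertzField, graded_mForm, single_mul_single, ← single_add]
  rfl

theorem graded_gi (a b : Fin 4) : F.graded.gi a b = ι A (F.gi a b) := by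
  rw [Framing.gi, Framing.gi, ← single_etaTr']
  simp only [← single_mul_single]
  rfl

/-- The weight `(2,0)` of `l ∧ m`, taken twice, cancels the weight `(-4,0)` of the potential. The
Hertz potential is thus an ordinary tensor, and both divergences stay in weight zero. -/
theorem recon_hertzField (f : A) {ψ φ : A} (hφ : φ * ψ = 1) (hψ : ψ ^ 3 = F.Ψ) (a b : Fin 4) :
    cdiv3 F.D F.Γ F.gi (fun a c b => φ ^ 4 * cdiv4 F.D F.Γ F.gi (F.hertzField (ψ ^ 4 * f)) a c b) a b
      = -2 * F.pert f a b := by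
  have hφ' : ι A φ * ι A ψ = 1 := by rw [← map_mul, hφ, map_one]
  have hψ' : ι A ψ ^ 3 = F.graded.Ψ := by rw [← map_pow, hψ]; rfl
  have h := PrincipalFraming.recon_hertzField (F.gP_potential f) (F.gQ_potential f) hφ' hψ' a b
  have h4 : ι A ψ ^ 4 * single (-4, 0) f = single (-4, 0) (ψ ^ 4 * f) := by
    rw [← map_pow, ι_mul]
  have hc4 : ∀ e a c d b, ccov4 F.graded.D F.graded.Γ
      (F.graded.hertzField (single (-4, 0) (ψ ^ 4 * f))) e a c d b
      = ι A (ccov4 F.D F.Γ (F.hertzField (ψ ^ 4 * f)) e a c d b) := by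
    intro e a c d b
    rw [← map_ccov4 (ι A) F.Γ F.gD_ι, show F.graded.hertzField (single (-4, 0) (ψ ^ 4 * f))
      = fun a c d b => ι A (F.hertzField (ψ ^ 4 * f) a c d b) from
        funext fun a => funext fun c => funext₂ (F.graded_hertzField _ a c)]
    rfl
  have hd4 : ∀ a c b, cdiv4 F.graded.D F.graded.Γ F.graded.gi
      (F.graded.hertzField (single (-4, 0) (ψ ^ 4 * f))) a c b
      = ι A (cdiv4 F.D F.Γ F.gi (F.hertzField (ψ ^ 4 * f)) a c b) := by
    intro a c b
    simp only [cdiv4, hc4, graded_gi, map_sum, map_mul]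
  have hc3 : ∀ (t : Fin 4 → Fin 4 → Fin 4 → A) e a c b, ccov3 F.graded.D F.graded.Γ
      (fun a c b => ι A (t a c b)) e a c b = ι A (ccov3 F.D F.Γ t e a c b) := by
    intro t e a c b
    rw [← map_ccov3 (ι A) F.Γ F.gD_ι]
    rfl
  have hd3 : ∀ (t : Fin 4 → Fin 4 → Fin 4 → A) a b, cdiv3 F.graded.D F.graded.Γ F.graded.gi
      (fun a c b => ι A (t a c b)) a b = ι A (cdiv3 F.D F.Γ F.gi t a b) := by
    intro t a b
    simp only [cdiv3, hc3, graded_gi, map_sum, map_mul]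
  rw [h4] at h
  simp only [hd4, ← map_pow, ← map_mul] at h
  rw [hd3, graded_pert, ← map_ofNat (ι A) 2, ← map_neg, ← map_mul] at h
  exact single_right_injective h

/-- The one-form `-ρ n + τ mt`. -/
def bField (a : Fin 4) : A := -F.rot 3 0 2 * F.E 1 a + F.rot 1 0 2 * F.E 3 a

/-- The first order part of the Teukolsky operator. -/
def twistedGrad (f : A) (a : Fin 4) : A := F.D a f - 4 * (F.bField a - F.wconn a) * f

/-- The Teukolsky operator of spin weight `-2`. -/
def teuk (f : A) : A :=
  (∑ a, ∑ b, F.gi a b * (ccov1 F.D F.Γ (F.twistedGrad f) a b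
    - 4 * (F.bField a - F.wconn a) * F.twistedGrad f b)) - 16 * F.Ψ * f + 4 * F.Λ * f

/-- On weight `(-4,0)` the weighted derivative is `D + 4ω`. Together with `-4B` this is the operator
`D - 4Γ` with `Γ = B - ω`. -/
theorem graded_teuk (f : A) : F.graded.teukField (single (-4, 0) f) = single (-4, 0) (F.teuk f) := by
  have hb : ∀ a, F.graded.bField a = ι A (F.bField a) := by
    intro a
    rw [PrincipalFraming.bField, rho_single, tau_single, graded_E, graded_E, ← single_neg,
      single_mul_single, single_mul_single, ι_apply, bField, single_add]
    rfl
  have hw : F.graded.twistedGrad (single (-4, 0) f) = fun a => single (-4, 0) (F.twistedGrad f a) := by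
    funext a
    have h : F.graded.D a (single (-4, 0) f) = _ := F.gD_single a (-4, 0) f
    rw [PrincipalFraming.twistedGrad, h, hb, mul_assoc, ι_mul, ofNat_mul_single, ← single_sub]
    congr 1
    simp only [twistedGrad]
    push_cast
    ring
  have hc : ∀ a b, ccov1 F.graded.D F.graded.Γ (fun a => single (-4, 0) (F.twistedGrad f a)) a b
      = single (-4, 0) (ccov1 F.D F.Γ (F.twistedGrad f) a b + 4 * F.wconn a * F.twistedGrad f b) := by
    intro a b
    change F.gD a (single (-4, 0) (F.twistedGrad f b))
      - ∑ e, ι A (F.Γ e a b) * single (-4, 0) (F.twistedGrad f e) = _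
    simp only [gD_single, ι_mul, single_sum, ← single_sub, ccov1]
    congr 1
    push_cast
    ring
  have hΨ : F.graded.Ψ = ι A F.Ψ := rfl
  have hΛ : F.graded.Λ = ι A F.Λ := rfl
  have h4 : ∀ x : A, (4 : Graded A) * single (-4, 0) x = single (-4, 0) (4 * x) :=
    ofNat_mul_single 4 _
  have h16 : ∀ x : A, (16 : Graded A) * single (-4, 0) x = single (-4, 0) (16 * x) :=
    ofNat_mul_single 16 _
  rw [PrincipalFraming.teukField, hw]
  simp only [hc, hb, graded_gi, hΨ, hΛ, mul_assoc, ι_mul, h4, h16, ← single_sub, single_sum,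
    ← single_add]
  congr 1
  simp only [teuk, Fin.sum_univ_four]
  ring

theorem clin_pert (f : A) (h0 : F.teuk f = 0) (a b : Fin 4) :
    clin F.D F.Γ F.gi (F.pert f) a b + 12 * F.Λ * F.pert f a b = 0 := by
  have h := PrincipalFraming.clin_pert (F.gP_potential f) (F.gQ_potential f)
    (by rw [graded_teuk, h0, single_zero]) a b
  have hp : F.graded.pert (single (-4, 0) f) = fun a b => ι A (F.pert f a b) :=
    funext₂ (F.graded_pert f)
  have hc2 : ∀ c a b, ccov2 F.graded.D F.graded.Γ (fun a b => ι A (F.pert f a b)) c a b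
      = ι A (ccov2 F.D F.Γ (F.pert f) c a b) := by
    intro c a b
    rw [← map_ccov2 (ι A) F.Γ F.gD_ι]
    rfl
  have hdh : cdh F.graded.D F.graded.Γ (fun a b => ι A (F.pert f a b))
      = fun c a b => ι A (cdh F.D F.Γ (F.pert f) c a b) := by
    funext c a b
    simp only [cdh, hc2, map_add, map_sub]
  have hc3 : ∀ e c a b, ccov3 F.graded.D F.graded.Γ (fun c a b => ι A (cdh F.D F.Γ (F.pert f) c a b))
      e c a b = ι A (ccov3 F.D F.Γ (cdh F.D F.Γ (F.pert f)) e c a b) := by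
    intro e c a b
    rw [← map_ccov3 (ι A) F.Γ F.gD_ι]
    rfl
  have hl : clin F.graded.D F.graded.Γ F.graded.gi (fun a b => ι A (F.pert f a b)) a b
      = ι A (clin F.D F.Γ F.gi (F.pert f) a b) := by
    rw [clin, hdh]
    simp only [hc3, graded_gi, clin, map_sum, map_mul]
  have hΛ : F.graded.Λ = ι A F.Λ := rfl
  rw [hp, hl, hΛ, ← map_ofNat (ι A) 12, ← map_mul, ← map_mul, ← map_add] at h
  exact single_right_injective (h.trans (map_zero (ι A)).symm)

end PrincipalTetrad
end TypeDRec

/-! ### The Levi-Civita connection and the linearized Einstein tensor -/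

namespace TypeDRec

open Polynomial

section Levi

variable {G : Type*} [CommRing G] (D : Fin 4 → Derivation ℤ G G) (hf : G) (g gi : Fin 4 → Fin 4 → G)

/-- The Christoffel symbols of the metric `g` with inverse `gi`; `hf` stands for `1/2`. -/
def christ (c a b : Fin 4) : G :=
  hf * ∑ d, gi c d * (D a (g d b) + D b (g d a) - D d (g a b))

/-- The Ricci tensor. -/
def ric (Γ : Fin 4 → Fin 4 → Fin 4 → G) (a b : Fin 4) : G := ∑ c, riem D Γ a c b c

/-- The Einstein tensor. -/
def ein (a b : Fin 4) : G :=
  ric D (christ D hf g gi) a b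
    - hf * (∑ c, ∑ d, gi c d * ric D (christ D hf g gi) c d) * g a b

/-- `g` is symmetric with symmetric inverse `gi`, and `hf` is one half. -/
structure IsMetric : Prop where
  half : 2 * hf = 1
  symm : ∀ a b, g a b = g b a
  symm_inv : ∀ a b, gi a b = gi b a
  inv : ∀ a b, ∑ c, gi a c * g c b = if a = b then 1 else 0

variable {D hf g gi}

namespace IsMetric

theorem christ_symm (H : IsMetric hf g gi) (c a b : Fin 4) :
    christ D hf g gi c a b = christ D hf g gi c b a := by
  simp only [christ]
  congr 1
  refine Finset.sum_congr rfl fun d _ => ?_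
  rw [H.symm a b]
  ring

theorem christ_lower (H : IsMetric hf g gi) (e a b : Fin 4) :
    2 * ∑ c, g e c * christ D hf g gi c a b = D a (g e b) + D b (g e a) - D e (g a b) := by
  have h : ∀ k : Fin 4 → G, ∑ c, g e c * (hf * ∑ d, gi c d * k d) = hf * k e := by
    intro k
    have h1 : ∀ d, ∑ c, g e c * gi c d = if d = e then 1 else 0 := by
      intro d
      rw [← H.inv d e]
      refine Finset.sum_congr rfl fun c _ => ?_
      rw [H.symm e c, H.symm_inv c d, mul_comm]
    have h2 : ∑ c, g e c * (hf * ∑ d, gi c d * k d) = hf * ∑ d, (∑ c, g e c * gi c d) * k d := by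
      simp only [Fin.sum_univ_four]
      ring
    rw [h2]
    simp [h1]
  simp only [christ]
  rw [h fun d => D a (g d b) + D b (g d a) - D d (g a b)]
  linear_combination (D a (g e b) + D b (g e a) - D e (g a b)) * H.half

theorem christ_compat (H : IsMetric hf g gi) (c a b : Fin 4) : D c (g a b)
    = ∑ e, christ D hf g gi e c a * g e b + ∑ e, christ D hf g gi e c b * g a e := by
  have h1 := H.christ_lower (D := D) b c a
  have h2 := H.christ_lower (D := D) a c b
  have e1 : ∑ e, christ D hf g gi e c a * g e b = ∑ e, g b e * christ D hf g gi e c a := by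
    refine Finset.sum_congr rfl fun e _ => ?_
    rw [H.symm e b, mul_comm]
  have e2 : ∑ e, christ D hf g gi e c b * g a e = ∑ e, g a e * christ D hf g gi e c b :=
    Finset.sum_congr rfl fun e _ => mul_comm _ _
  rw [e1, e2]
  rw [H.symm b a, H.symm b c] at h1
  rw [H.symm a c] at h2
  linear_combination (-hf) * h1 - hf * h2
    + (∑ e, g b e * christ D hf g gi e c a + ∑ e, g a e * christ D hf g gi e c b - D c (g a b))
      * H.half

/-- The inverse metric is covariantly constant. -/
theorem D_inv (H : IsMetric hf g gi) (e a b : Fin 4) : D e (gi a b)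
    = -∑ c, christ D hf g gi a e c * gi c b - ∑ c, christ D hf g gi b e c * gi a c := by
  set Γ := christ D hf g gi with hΓ
  have hc : ∀ c a b, D c (g a b) = ∑ e, Γ e c a * g e b + ∑ e, Γ e c b * g a e := H.christ_compat
  have hi' : ∀ a b, ∑ c, g a c * gi c b = if a = b then 1 else 0 := by
    intro a b
    rw [show (if a = b then (1 : G) else 0) = if b = a then 1 else 0 by simp [eq_comm], ← H.inv b a]
    refine Finset.sum_congr rfl fun c _ => ?_
    rw [H.symm a c, H.symm_inv c b, mul_comm]
  have h1 : ∀ p, ∑ q, D e (gi a q) * g q p = -∑ q, gi a q * D e (g q p) := by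
    intro p
    have h := congrArg (D e) (H.inv a p)
    have hz : D e (if a = p then (1 : G) else 0) = 0 := by split_ifs <;> simp
    rw [hz] at h
    simp only [map_sum, Derivation.leibniz, smul_eq_mul, Finset.sum_add_distrib] at h
    rw [← add_eq_zero_iff_eq_neg, add_comm, ← h]
    congr 1
    exact Finset.sum_congr rfl fun q _ => mul_comm _ _
  have h2 : D e (gi a b) = ∑ p, (∑ q, D e (gi a q) * g q p) * gi p b := by
    have : ∑ p, (∑ q, D e (gi a q) * g q p) * gi p b
        = ∑ q, D e (gi a q) * ∑ p, g q p * gi p b := by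
      simp only [Fin.sum_univ_four]
      ring
    rw [this]
    simp [hi']
  rw [h2]
  simp only [h1, hc]
  have h3 : ∑ p, (-∑ q, gi a q * (∑ r, Γ r e q * g r p + ∑ r, Γ r e p * g q r)) * gi p b
      = -(∑ r, (∑ q, gi a q * Γ r e q) * ∑ p, g r p * gi p b)
        - ∑ r, (∑ q, gi a q * g q r) * ∑ p, Γ r e p * gi p b := by
    simp only [Fin.sum_univ_four]
    ring
  rw [h3]
  simp only [hi', H.inv]
  simp only [mul_ite, mul_one, mul_zero, Finset.sum_ite_eq, Finset.sum_ite_eq', ite_mul, one_mul,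
    zero_mul, Finset.mem_univ, if_true]
  have e1 : ∑ q, gi a q * Γ b e q = ∑ q, Γ b e q * gi a q :=
    Finset.sum_congr rfl fun q _ => mul_comm _ _
  rw [e1]
  ring

end IsMetric

variable {h : Fin 4 → Fin 4 → G}

/-- The first variation of the Christoffel symbols. -/
def dchrist (D : Fin 4 → Derivation ℤ G G) (hf : G) (Γ : Fin 4 → Fin 4 → Fin 4 → G)
    (gi h : Fin 4 → Fin 4 → G) (c a b : Fin 4) : G :=
  hf * ∑ d, gi c d * cdh D Γ h d a b

/-- `h^{ab}` -/
def raise (gi h : Fin 4 → Fin 4 → G) (a b : Fin 4) : G := ∑ c, ∑ d, gi a c * h c d * gi d b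

/-- The left side varies `g` by `h` and the inverse metric by minus the raised `h`. The
non-tensorial terms recombine into covariant derivatives of `h`. -/
theorem IsMetric.dchrist_eq (H : IsMetric hf g gi) (hs : ∀ a b, h a b = h b a) (c a b : Fin 4) :
    hf * (∑ d, gi c d * (D a (h d b) + D b (h d a) - D d (h a b)))
      - hf * (∑ d, raise gi h c d * (D a (g d b) + D b (g d a) - D d (g a b)))
      = dchrist D hf (christ D hf g gi) gi h c a b := by
  set Γ := christ D hf g gi with hΓ
  have hdh : ∀ d, cdh D Γ h d a b = D a (h d b) + D b (h d a) - D d (h a b)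
      - 2 * ∑ e, h d e * Γ e a b := by
    intro d
    have e1 : ∑ e, Γ e a b * h e d = ∑ e, h d e * Γ e a b :=
      Finset.sum_congr rfl fun e _ => by rw [hs e d, mul_comm]
    have e2 : ∑ e, Γ e b a * h e d = ∑ e, h d e * Γ e a b :=
      Finset.sum_congr rfl fun e _ => by rw [hs e d, mul_comm, hΓ, H.christ_symm e b a]
    have e3 : ∑ e, Γ e a d * h b e = ∑ e, Γ e d a * h e b :=
      Finset.sum_congr rfl fun e _ => by rw [hs b e, hΓ, H.christ_symm e a d]
    have e4 : ∑ e, Γ e b d * h a e = ∑ e, Γ e d b * h a e :=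
      Finset.sum_congr rfl fun e _ => by rw [hΓ, H.christ_symm e b d]
    rw [cdh, ccov2, ccov2, ccov2, e1, e2, e3, e4, hs b d, hs a d]
    ring
  have hr : hf * (∑ d, raise gi h c d * (D a (g d b) + D b (g d a) - D d (g a b)))
      = ∑ d, gi c d * ∑ e, h d e * Γ e a b := by
    simp only [hΓ, christ, raise]
    generalize (fun d => D a (g d b) + D b (g d a) - D d (g a b)) = k
    simp only [Fin.sum_univ_four]
    ring
  rw [hr, dchrist]
  simp only [hdh, mul_sub, Finset.sum_sub_distrib, mul_left_comm _ (2 : G), ← Finset.mul_sum]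
  linear_combination (∑ d, gi c d * ∑ e, h d e * Γ e a b) * H.half

/-- The first variation of the trace of the Christoffel symbols vanishes for traceless `h`. -/
theorem IsMetric.dchrist_trace (H : IsMetric hf g gi) (hs : ∀ a b, h a b = h b a)
    (ht : ∑ a, ∑ b, gi a b * h a b = 0) (b : Fin 4) :
    ∑ c, dchrist D hf (christ D hf g gi) gi h c c b = 0 := by
  set Γ := christ D hf g gi with hΓ
  -- Two of the three terms of `cdh` cancel in the trace by symmetry; the survivor is the derivative
  -- of the trace of `h`.
  have h1 : ∑ c, ∑ d, gi c d * cdh D Γ h d c b = ∑ c, ∑ d, gi c d * ccov2 D Γ h b c d := by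
    have hsw : ∑ c, ∑ d, gi c d * ccov2 D Γ h c b d = ∑ c, ∑ d, gi c d * ccov2 D Γ h d c b := by
      rw [Finset.sum_comm]
      refine Finset.sum_congr rfl fun c _ => Finset.sum_congr rfl fun d _ => ?_
      rw [H.symm_inv d c]
      congr 1
      have e1 : ∑ e, Γ e d b * h e c = ∑ e, Γ e d b * h c e :=
        Finset.sum_congr rfl fun e _ => by rw [hs e c]
      have e2 : ∑ e, Γ e d c * h b e = ∑ e, Γ e d c * h e b :=
        Finset.sum_congr rfl fun e _ => by rw [hs b e]
      rw [ccov2, ccov2, hs b c, e1, e2]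
      ring
    simp only [cdh, mul_add, mul_sub, Finset.sum_add_distrib, Finset.sum_sub_distrib, hsw]
    ring
  have h2 : ∑ c, ∑ d, gi c d * ccov2 D Γ h b c d = D b (∑ a, ∑ b, gi a b * h a b) := by
    simp only [map_sum, Derivation.leibniz, smul_eq_mul, H.D_inv, ccov2, ← hΓ]
    simp only [Fin.sum_univ_four]
    ring
  have h3 : ∑ c, dchrist D hf Γ gi h c c b = hf * ∑ c, ∑ d, gi c d * cdh D Γ h d c b := by
    simp only [dchrist, Finset.mul_sum]
  rw [h3, h1, h2, ht, map_zero, mul_zero]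

theorem IsMetric.D_half (H : IsMetric hf g gi) (δ : Derivation ℤ G G) : δ hf = 0 := by
  have h := congrArg δ H.half
  rw [Derivation.leibniz, smul_eq_mul, smul_eq_mul, TypeDAlgebra.der_two,
    Derivation.map_one_eq_zero] at h
  linear_combination hf * h - δ hf * H.half

/-- The divergence of a tensor in terms of the tensor with raised first index. -/
theorem IsMetric.raise_div (H : IsMetric hf g gi) (t : Fin 4 → Fin 4 → Fin 4 → G) (a b : Fin 4)
    {Γ C : Fin 4 → Fin 4 → Fin 4 → G} (hΓ : Γ = christ D hf g gi)
    (hC : ∀ c a b, C c a b = hf * ∑ d, gi c d * t d a b) :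
    hf * (∑ c, ∑ e, gi c e * ccov3 D Γ t e c a b) = ∑ c, D c (C c a b)
      - ∑ c, ∑ e, (C c a e * Γ e c b + Γ c e a * C e c b - Γ c c e * C e a b) := by
  have hi := H.D_inv (D := D)
  rw [← hΓ] at hi
  have hg := H.symm_inv
  simp only [hC, ccov3, Derivation.leibniz, smul_eq_mul, H.D_half, hi, Fin.sum_univ_four,
    map_add, hg 1 0, hg 2 0, hg 3 0, hg 2 1, hg 3 1, hg 3 2]
  ring

/-- Palatini's formula for traceless `h`. -/
theorem IsMetric.dric_eq (H : IsMetric hf g gi) (hs : ∀ a b, h a b = h b a)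
    (ht : ∑ a, ∑ b, gi a b * h a b = 0) (a b : Fin 4) {Γ C : Fin 4 → Fin 4 → Fin 4 → G}
    (hΓ : Γ = christ D hf g gi) (hC : C = dchrist D hf Γ gi h) :
    ∑ c, (D a (C c c b) - D c (C c a b)
      + ∑ e, (C c a e * Γ e c b + Γ c a e * C e c b - (C c c e * Γ e a b + Γ c c e * C e a b)))
      = -(hf * clin D Γ gi h a b) := by
  have hsy : ∀ c a b, Γ c a b = Γ c b a := fun c a b => by rw [hΓ, H.christ_symm]
  have h0 : ∀ b, ∑ c, C c c b = 0 := fun b => by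
    rw [hC, hΓ]
    exact H.dchrist_trace hs ht b
  have h1 : ∑ c, D a (C c c b) = 0 := by rw [← map_sum, h0, map_zero]
  have h2 : ∑ c, ∑ e, C c c e * Γ e a b = 0 := by
    rw [Finset.sum_comm]
    simp only [← Finset.sum_mul, h0, zero_mul, Finset.sum_const_zero]
  have hd : hf * clin D Γ gi h a b = ∑ c, D c (C c a b)
      - ∑ c, ∑ e, (C c a e * Γ e c b + Γ c a e * C e c b - Γ c c e * C e a b) := by
    rw [clin, H.raise_div (C := C) (cdh D Γ h) a b hΓ (fun c a b => by rw [hC, dchrist])]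
    simp only [hsy _ a]
  rw [hd]
  simp only [Finset.sum_add_distrib, Finset.sum_sub_distrib, h1, h2]
  ring

end Levi

section Linearization

variable {A : Type*} [CommRing A]

/-- The extension of a derivation to polynomials that annihilates the variable. -/
noncomputable def polyDer (δ : Derivation ℤ A A) : Der A[X] :=
  letI : Differential A := ⟨δ⟩
  Differential.mapCoeffs

theorem coeff_polyDer (δ : Derivation ℤ A A) (p : A[X]) (n : ℕ) :
    (polyDer δ p).coeff n = δ (p.coeff n) := rfl

/-- `polyDer` treats the variable as a constant, so only constants may be substituted for it. -/
theorem eval_polyDer (δ : Derivation ℤ A A) {r : A} (hr : δ r = 0) (p : A[X]) :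
    (polyDer δ p).eval r = δ (p.eval r) := by
  have hm : ∀ n x, polyDer δ (monomial n x) = monomial n (δ x) := by
    intro n x
    ext k
    rw [coeff_polyDer, coeff_monomial, coeff_monomial]
    split_ifs <;> simp
  induction p using Polynomial.induction_on' with
  | add p q hp hq => simp only [map_add, eval_add, hp, hq]
  | monomial n x =>
    rw [hm, eval_monomial, eval_monomial, Derivation.leibniz, Derivation.leibniz_pow, hr]
    simp [mul_comm]

/-- Since `ein` takes the inverse metric as a separate argument, it is polynomial in its data.
Homomorphisms preserve it even when that argument is not an actual inverse. -/
theorem map_ein {G : Type*} [CommRing G] (φ : A →+* G) {D : Fin 4 → Derivation ℤ A A}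
    {D' : Fin 4 → Derivation ℤ G G} (hD : ∀ a x, D' a (φ x) = φ (D a x)) (hf : A)
    (g gi : Fin 4 → Fin 4 → A) (a b : Fin 4) :
    ein D' (φ hf) (fun a b => φ (g a b)) (fun a b => φ (gi a b)) a b = φ (ein D hf g gi a b) := by
  have hc : christ D' (φ hf) (fun a b => φ (g a b)) (fun a b => φ (gi a b))
      = fun c a b => φ (christ D hf g gi c a b) := by
    funext c a b
    simp only [christ, hD, map_mul, map_sum, map_add, map_sub]
  have hr : ∀ a b, ric D' (fun c a b => φ (christ D hf g gi c a b)) a b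
      = φ (ric D (christ D hf g gi) a b) := by
    intro a b
    simp only [ric, map_riem φ _ hD, map_sum]
  simp only [ein, hc, hr, map_mul, map_sum, map_sub]

/-- Along the line `g + r h` in a null direction `h` that solves the linearized equations, the Einstein
equations hold up to a multiple of `r²`. -/
theorem exists_remainder {D : Fin 4 → Derivation ℤ A A} {hf : A} {g gi h : Fin 4 → Fin 4 → A}
    (H : IsMetric hf g gi) (hs : ∀ a b, h a b = h b a) (ht : ∑ a, ∑ b, gi a b * h a b = 0) {Λ : A}
    (hric : ∀ a b, ric D (christ D hf g gi) a b = 6 * Λ * g a b)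
    (hlin : ∀ a b, clin D (christ D hf g gi) gi h a b + 12 * Λ * h a b = 0) (a b : Fin 4) :
    ∃ p : A[X], ∀ r : A, (∀ a, D a r = 0) →
      ein D hf (fun a b => g a b + r * h a b) (fun a b => gi a b - r * raise gi h a b) a b
        + 6 * Λ * (g a b + r * h a b) = r ^ 2 * p.eval r := by
  -- The variable stands for the parameter of the line. `pgi` needs to be the inverse only to first
  -- order here.
  set pg : Fin 4 → Fin 4 → A[X] := fun a b => C (g a b) + X * C (h a b) with hpg
  set pgi : Fin 4 → Fin 4 → A[X] := fun a b => C (gi a b) - X * C (raise gi h a b) with hpgi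
  set pD : Fin 4 → Der A[X] := fun a => polyDer (D a) with hpD
  have g0 : ∀ a b, (pg a b).coeff 0 = g a b := fun a b => by simp [hpg]
  have g1 : ∀ a b, (pg a b).coeff 1 = h a b := fun a b => by simp [hpg, coeff_C]
  have i0 : ∀ a b, (pgi a b).coeff 0 = gi a b := fun a b => by simp [hpgi]
  have i1 : ∀ a b, (pgi a b).coeff 1 = -raise gi h a b := fun a b => by simp [hpgi, coeff_C]
  have d0 : ∀ a p n, (pD a p).coeff n = D a (p.coeff n) := fun a p n => rfl
  set Γ := christ D hf g gi with hΓ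
  set P := christ pD (C hf) pg pgi with hP
  have c0 : ∀ c a b, (P c a b).coeff 0 = Γ c a b := by
    intro c a b
    simp only [hP, christ, coeff_C_zero, finsetSum_coeff, mul_coeff_zero, coeff_add, coeff_sub, d0,
      g0, i0, hΓ]
  have c1 : ∀ c a b, (P c a b).coeff 1 = dchrist D hf Γ gi h c a b := by
    intro c a b
    rw [hΓ, ← H.dchrist_eq hs]
    simp only [hP, christ,  finsetSum_coeff, mul_coeff_zero, mul_coeff_one,
      coeff_C_zero, coeff_C_succ, coeff_add, coeff_sub, d0, g0, i0, g1, i1, Finset.sum_add_distrib,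
      neg_mul, Finset.sum_neg_distrib]
    ring
  have r0 : ∀ a b, (ric pD P a b).coeff 0 = 6 * Λ * g a b := by
    intro a b
    rw [← hric]
    simp only [ric, riem, coeff_add, coeff_sub, finsetSum_coeff, mul_coeff_zero, d0, c0]
  have r1 : ∀ a b, (ric pD P a b).coeff 1 = 6 * Λ * h a b := by
    intro a b
    have h1 := H.dric_eq (D := D) hs ht a b hΓ rfl
    have h2 := hlin a b
    have h3 : (ric pD P a b).coeff 1 = -(hf * clin D Γ gi h a b) := by
      rw [← h1]
      simp only [ric, riem, coeff_add, coeff_sub, finsetSum_coeff, mul_coeff_one, d0, c0, c1]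
      refine Finset.sum_congr rfl fun c _ => ?_
      congr 1
      refine Finset.sum_congr rfl fun e _ => ?_
      ring
    rw [h3]
    linear_combination (-hf) * h2 + 6 * Λ * h a b * H.half
  have t4 : ∑ c, ∑ d, gi c d * g c d = 4 := by
    have : ∀ c, ∑ d, gi c d * g c d = 1 := by
      intro c
      have := H.inv c c
      rw [if_pos rfl] at this
      rw [← this]
      exact Finset.sum_congr rfl fun d _ => by rw [H.symm c d]
    simp [this]
  have tr : ∑ c, ∑ d, raise gi h c d * g c d = 0 := by
    have e : ∀ c, ∑ d, raise gi h c d * g c d = ∑ p, gi c p * ∑ q, h p q * ∑ d, gi q d * g d c := by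
      intro c
      simp only [raise, fun d => H.symm c d, Fin.sum_univ_four]
      ring
    simp only [e, H.inv]
    simpa [hs] using ht
  -- The coefficient of degree zero is the background equation and that of degree one the linearized
  -- equation; both vanish.
  have hz : X ^ 2 ∣ ein pD (C hf) pg pgi a b + C (6 * Λ) * pg a b := by
    rw [X_pow_dvd_iff]
    intro n hn
    interval_cases n
    · simp only [ein, ← hP, coeff_add, coeff_sub, finsetSum_coeff, mul_coeff_zero,
        g0, i0, r0, coeff_C_zero]
      have e : ∑ c, ∑ d, gi c d * (6 * Λ * g c d) = 6 * Λ * 4 := by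
        rw [← t4]
        simp only [Finset.mul_sum, mul_left_comm]
      rw [e]
      linear_combination (-12 * Λ * g a b) * H.half
    · simp only [ein, ← hP, coeff_add, coeff_sub, finsetSum_coeff, mul_coeff_zero,
        mul_coeff_one, g0, i0, r0, g1, i1, r1, coeff_C_zero, coeff_C_succ]
      have e : ∑ c, ∑ d, gi c d * (6 * Λ * g c d) = 6 * Λ * 4 := by
        rw [← t4]
        simp only [Finset.mul_sum, mul_left_comm]
      have e1 : ∑ c, ∑ d, (gi c d * (6 * Λ * h c d) + -raise gi h c d * (6 * Λ * g c d))
          = 6 * Λ * (∑ a, ∑ b, gi a b * h a b) - 6 * Λ * ∑ c, ∑ d, raise gi h c d * g c d := by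
        simp only [Finset.mul_sum, Finset.sum_add_distrib, neg_mul, mul_neg,
          Finset.sum_neg_distrib, mul_left_comm, sub_eq_add_neg]
      rw [e, e1, ht, tr]
      linear_combination (-12 * Λ * h a b) * H.half
  obtain ⟨p, hp⟩ := hz
  refine ⟨p, fun r hr => ?_⟩
  have he := congrArg (eval r) hp
  rw [eval_add, eval_mul, eval_mul, eval_pow, eval_X, eval_C] at he
  rw [← he]
  have hm := map_ein (evalRingHom r) (D := pD) (D' := D)
    (fun a x => (eval_polyDer (D a) (hr a) x).symm) (C hf) pg pgi a b
  simp only [coe_evalRingHom] at hm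
  rw [← hm]
  simp [hpg, hpgi, mul_comm r]

end Linearization
end TypeDRec

/-! ### The differential ring of smooth functions on an open set -/

namespace TypeDRec

section Pd

variable {U : Set E4} {f f' : F0}

theorem pd_congr (hU : IsOpen U) (h : ∀ y ∈ U, f y = f' y) (a : Fin 4) {y : E4} (hy : y ∈ U) :
    pd a f y = pd a f' y := by
  have : f =ᶠ[nhds y] f' := Filter.eventually_of_mem (hU.mem_nhds hy) h
  rw [pd, pd, this.fderiv_eq]

theorem differentiableAt_of_contDiffOn (hU : IsOpen U) (h : ContDiffOn ℝ ∞ f U) {y : E4}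
    (hy : y ∈ U) : DifferentiableAt ℝ f y :=
  ((h y hy).contDiffAt (hU.mem_nhds hy)).differentiableAt (by simp)

theorem contDiffOn_pd (hU : IsOpen U) (h : ContDiffOn ℝ ∞ f U) (a : Fin 4) :
    ContDiffOn ℝ ∞ (pd a f) U :=
  (h.fderiv_of_isOpen hU (by simp)).clm_apply contDiffOn_const

theorem pd_comm (hU : IsOpen U) (h : ContDiffOn ℝ ∞ f U) (a b : Fin 4) {y : E4} (hy : y ∈ U) :
    pd a (pd b f) y = pd b (pd a f) y := by
  have hc : ContDiffAt ℝ ∞ f y := (h y hy).contDiffAt (hU.mem_nhds hy)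
  have hs : IsSymmSndFDerivAt ℝ f y := hc.isSymmSndFDerivAt (by simpa using ENat.LEInfty.out)
  have hd : DifferentiableAt ℝ (fderiv ℝ f) y :=
    ((h.fderiv_of_isOpen hU (m := ∞) (by simp) y hy).contDiffAt
      (hU.mem_nhds hy)).differentiableAt (by simp)
  have key : ∀ a b, pd a (pd b f) y = fderiv ℝ (fderiv ℝ f) y (EuclideanSpace.single a 1)
      (EuclideanSpace.single b 1) := by
    intro a b
    change fderiv ℝ (fun z => fderiv ℝ f z (EuclideanSpace.single b 1)) y _ = _
    rw [fderiv_clm_apply hd (differentiableAt_const _)]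
    simp
  rw [key, key]
  exact hs _ _

end Pd

/-- The algebra of smooth complex functions on `U`. -/
def smoothOn (U : Set E4) : Subalgebra ℂ (U → ℂ) where
  carrier := {x | ∃ f : F0, ContDiffOn ℝ ∞ f U ∧ ∀ y : U, x y = f y}
  mul_mem' := by
    rintro x y ⟨f, hf, hx⟩ ⟨g, hg, hy⟩
    exact ⟨fun z => f z * g z, hf.mul hg, fun z => by simp [hx, hy]⟩
  add_mem' := by
    rintro x y ⟨f, hf, hx⟩ ⟨g, hg, hy⟩
    exact ⟨fun z => f z + g z, hf.add hg, fun z => by simp [hx, hy]⟩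
  algebraMap_mem' c := ⟨fun _ => c, contDiffOn_const, fun _ => rfl⟩

/-- The ring of smooth complex functions on `U`. -/
abbrev Smooth (U : Set E4) : Type := smoothOn U

/-- The function `f` restricts to `x` on `U`. -/
def Rep {U : Set E4} (f : F0) (x : Smooth U) : Prop := ∀ y : U, f y = x.1 y

/-- The restriction of a function that is smooth on `U`. -/
def restr {U : Set E4} (f : F0) (h : ContDiffOn ℝ ∞ f U) : Smooth U :=
  ⟨fun y => f y, f, h, fun _ => rfl⟩

theorem rep_restr {U : Set E4} {f : F0} (h : ContDiffOn ℝ ∞ f U) : Rep f (restr f h) :=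
  fun _ => rfl

namespace Rep

variable {U : Set E4} {f f' : F0} {x x' : Smooth U}

theorem contDiffOn (h : Rep f x) : ContDiffOn ℝ ∞ f U := by
  obtain ⟨f', hf', hx⟩ := x.2
  exact hf'.congr fun y hy => (h ⟨y, hy⟩).trans (hx ⟨y, hy⟩)

theorem ext (h : ∀ y : U, x.1 y = x'.1 y) : x = x' := Subtype.ext (funext h)

theorem unique (h : Rep f x) (h' : Rep f' x') (hf : ∀ y ∈ U, f y = f' y) : x = x' :=
  ext fun y => by rw [← h y, ← h' y, hf y y.2]

theorem eq (h : Rep f x) (h' : Rep f' x) {y : E4} (hy : y ∈ U) : f y = f' y :=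
  (h ⟨y, hy⟩).trans (h' ⟨y, hy⟩).symm

theorem add (h : Rep f x) (h' : Rep f' x') : Rep (fun y => f y + f' y) (x + x') := fun y => by
  simp [h y, h' y]

theorem sub (h : Rep f x) (h' : Rep f' x') : Rep (fun y => f y - f' y) (x - x') := fun y => by
  simp [h y, h' y]

theorem mul (h : Rep f x) (h' : Rep f' x') : Rep (fun y => f y * f' y) (x * x') := fun y => by
  simp [h y, h' y]

theorem neg (h : Rep f x) : Rep (fun y => -f y) (-x) := fun y => by simp [h y]

theorem const (c : ℂ) : Rep (fun _ => c) (algebraMap ℂ (Smooth U) c) := fun _ => rfl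

theorem pow (h : Rep f x) (n : ℕ) : Rep (fun y => f y ^ n) (x ^ n) := fun y => by simp [h y]

theorem sum {α : Type*} {s : Finset α} {f : α → F0} {x : α → Smooth U} (h : ∀ i, Rep (f i) (x i)) :
    Rep (fun y => ∑ i ∈ s, f i y) (∑ i ∈ s, x i) := fun y => by
  simp [fun i => h i y]

end Rep

/-- The extension of a smooth function by zero. -/
noncomputable def extend {U : Set E4} (x : Smooth U) : F0 := by
  classical
  exact fun y => if h : y ∈ U then x.1 ⟨y, h⟩ else 0

theorem rep_extend {U : Set E4} (x : Smooth U) : Rep (extend x) x := fun y => by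
  simp [extend]

variable {U : Set E4} (hU : IsOpen U)

/-- The partial derivatives of smooth functions. -/
noncomputable def pdFun (a : Fin 4) (x : Smooth U) : Smooth U :=
  ⟨fun y => pd a (extend x) y, pd a (extend x), contDiffOn_pd hU (rep_extend x).contDiffOn a,
    fun _ => rfl⟩

/-- At a point of the open set `U` a derivative sees only values on `U`, so the possibly
discontinuous extension by zero is harmless. -/
theorem Rep.pdFun {f : F0} {x : Smooth U} (h : Rep f x) (a : Fin 4) :
    Rep (pd a f) (pdFun hU a x) := fun y =>
  pd_congr hU (fun _ hz => h.eq (rep_extend x) hz) a y.2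

/-- The partial derivatives as derivations. -/
noncomputable def pdDer (a : Fin 4) : Der (Smooth U) :=
  Derivation.mk' (AddMonoidHom.toIntLinearMap
    { toFun := pdFun hU a
      map_zero' := (Rep.pdFun hU (f := fun _ => 0) (x := 0) (fun _ => rfl) a).unique
        (f' := fun _ => 0) (fun _ => rfl) (fun y _ => by simp [pd])
      map_add' := fun x x' => ((rep_extend x).add (rep_extend x') |>.pdFun hU a).unique
        (((rep_extend x).pdFun hU a).add ((rep_extend x').pdFun hU a)) fun y hy => by
          have h1 := differentiableAt_of_contDiffOn hU (rep_extend x).contDiffOn hy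
          have h2 := differentiableAt_of_contDiffOn hU (rep_extend x').contDiffOn hy
          simp only [pd]
          rw [show (fun y => extend x y + extend x' y) = extend x + extend x' from rfl,
            fderiv_add h1 h2]
          rfl }) fun x x' => ((rep_extend x).mul (rep_extend x') |>.pdFun hU a).unique
        (((rep_extend x).mul ((rep_extend x').pdFun hU a)).add
          ((rep_extend x').mul ((rep_extend x).pdFun hU a))) fun y hy => by
          have h1 := differentiableAt_of_contDiffOn hU (rep_extend x).contDiffOn hy
          have h2 := differentiableAt_of_contDiffOn hU (rep_extend x').contDiffOn hy
          simp only [pd]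
          rw [show (fun y => extend x y * extend x' y) = extend x * extend x' from rfl,
            fderiv_mul h1 h2]
          simp

theorem Rep.pd {f : F0} {x : Smooth U} (h : Rep f x) (a : Fin 4) :
    Rep (pd a f) (pdDer hU a x) := h.pdFun hU a

theorem pdDer_comm (a b : Fin 4) (x : Smooth U) :
    pdDer hU a (pdDer hU b x) = pdDer hU b (pdDer hU a x) :=
  (((rep_extend x).pd hU b).pd hU a).unique (((rep_extend x).pd hU a).pd hU b) fun _ hy =>
    pd_comm hU (rep_extend x).contDiffOn a b hy

theorem pdDer_const (a : Fin 4) (c : ℂ) : pdDer hU a (algebraMap ℂ (Smooth U) c) = 0 :=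
  ((Rep.const c).pd hU a).unique (f' := fun _ => 0) (fun _ => rfl) fun y _ => by simp [TypeDRec.pd]

/-- Complex conjugation of smooth functions. -/
noncomputable def conjHom (U : Set E4) : Smooth U →+* Smooth U where
  toFun x := ⟨fun y => starRingEnd ℂ (x.1 y), fun y => starRingEnd ℂ (extend x y),
    Complex.conjCLE.contDiff.comp_contDiffOn (rep_extend x).contDiffOn,
    fun y => congrArg _ (rep_extend x y).symm⟩
  map_one' := Rep.ext fun y => by simp
  map_mul' x x' := Rep.ext fun y => by simp
  map_zero' := Rep.ext fun y => by simp
  map_add' x x' := Rep.ext fun y => by simp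

theorem Rep.conj {f : F0} {x : Smooth U} (h : Rep f x) :
    Rep (fun y => starRingEnd ℂ (f y)) (conjHom U x) := fun y => by
  simp [conjHom, h y]

theorem pdDer_conj (a : Fin 4) (x : Smooth U) :
    pdDer hU a (conjHom U x) = conjHom U (pdDer hU a x) :=
  ((rep_extend x).conj.pd hU a).unique ((rep_extend x).pd hU a).conj fun y hy => by
    have h := differentiableAt_of_contDiffOn hU (rep_extend x).contDiffOn hy
    have hc := (Complex.conjCLE.toContinuousLinearMap.hasFDerivAt (x := extend x y)).comp y
      h.hasFDerivAt
    have e : (fun y => starRingEnd ℂ (extend x y))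
      = (⇑Complex.conjCLE.toContinuousLinearMap) ∘ extend x := by
      funext z
      simp
    rw [TypeDRec.pd, TypeDRec.pd, e, hc.fderiv]
    simp

theorem isUnit_smooth {x : Smooth U} (h : ∀ y : U, x.1 y ≠ 0) : IsUnit x := by
  have hz : ContDiffOn ℝ ∞ (fun y => (extend x y)⁻¹) U :=
    (rep_extend x).contDiffOn.inv fun y hy => by
      rw [rep_extend x ⟨y, hy⟩]
      exact h ⟨y, hy⟩
  refine IsUnit.of_mul_eq_one (restr _ hz) (Rep.ext fun y => ?_)
  have : (restr _ hz).1 y = (extend x y)⁻¹ := rfl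
  rw [rep_extend x y] at this
  simp [this, h y]

theorem smooth_cancel {n : ℕ} (hn : n ≠ 0) (u : Smooth U) (h : (n : Smooth U) * u = 0) : u = 0 :=
  Rep.ext fun y => by
    have h1 := congrArg (fun v : Smooth U => v.1 y) h
    simpa [hn] using h1

end TypeDRec

/-! ### The prime symmetry and spin weight two -/

namespace TypeDRec

open AddMonoidAlgebra

/-- Exchange of `m` and `mt`. -/
def swapM : Fin 4 → Fin 4 := ![0, 1, 3, 2]

/-- Exchange of `l` with `n` and of `m` with `mt`. -/
def swapLN : Fin 4 → Fin 4 := ![1, 0, 3, 2]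

namespace Framing

variable {A : Type*} [CommRing A] (F : Framing A)

/-- The frame with `l, n` and `m, mt` exchanged. -/
def prime : Framing A where
  D := F.D
  E i := F.E (swapLN i)
  V i := F.V (swapLN i)
  Γ := F.Γ
  dual i j := by
    rw [F.dual]
    fin_cases i <;> fin_cases j <;> rfl
  symm := F.symm
  compat c a b := by
    have h : ∀ a b, etaTr (fun i j => F.E (swapLN i) a * F.E (swapLN j) b)
        = etaTr fun i j => F.E i a * F.E j b := by
      intro a b
      simp only [etaTr, swapLN, Matrix.cons_val]
      ring
    simp only [h]
    exact F.compat c a b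

theorem prime_met : F.prime.met = F.met := by
  funext a b
  simp only [met, prime, etaTr, swapLN, Matrix.cons_val]
  ring

theorem prime_gi : F.prime.gi = F.gi := by
  funext a b
  simp only [gi, prime, etaTr, swapLN, Matrix.cons_val]
  ring

theorem prime_rm (i j p q : Fin 4) :
    F.prime.rm i j p q = F.rm (swapLN i) (swapLN j) (swapLN p) (swapLN q) := by
  rw [rm, rm, prime_met]
  rfl

theorem prime_rot (k i j : Fin 4) :
    F.prime.rot k i j = F.rot (swapLN k) (swapLN i) (swapLN j) := rfl

end Framing

namespace PrincipalTetrad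

variable {A : Type*} [CommRing A] (F : PrincipalTetrad A)

theorem isFlat : F.toFraming.IsFlat where
  two := F.two
  gamma a b _ _ _ := F.D_comm a b _
  met a b _ _ := F.D_comm a b _

/-- The principal tetrad with `l, n` and `m, mt` exchanged. -/
def prime : PrincipalTetrad A where
  toFraming := F.toFraming.prime
  wconn a := -F.wconn a
  wconnt a := -F.wconnt a
  Ψ := F.Ψ
  Ψt := F.Ψt
  Λ := F.Λ
  two := F.two
  three := F.three
  D_comm := F.D_comm
  D_Λ := F.D_Λ
  wconn_eq k := by
    have h := F.wconn_eq (swapLN k)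
    have e : F.toFraming.prime.con k (fun a => -F.wconn a) = -F.con (swapLN k) F.wconn := by
      simp [Framing.con, Framing.prime]
    rw [e, Framing.prime_rot, Framing.prime_rot, F.rot_antisymm _ (swapLN 0),
      F.rot_antisymm _ (swapLN 2)]
    simp only [swapLN, Matrix.cons_val] at h ⊢
    linear_combination -h
  wconnt_eq k := by
    have h := F.wconnt_eq (swapLN k)
    have e : F.toFraming.prime.con k (fun a => -F.wconnt a) = -F.con (swapLN k) F.wconnt := by
      simp [Framing.con, Framing.prime]
    rw [e, Framing.prime_rot, Framing.prime_rot, F.rot_antisymm _ (swapLN 0),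
      F.rot_antisymm _ (swapLN 2)]
    simp only [swapLN, Matrix.cons_val] at h ⊢
    linear_combination -h
  ricci a b := by
    rw [Framing.prime_met]
    exact F.ricci a b
  rm0202 := by
    rw [Framing.prime_rm]
    change F.rm 1 3 1 3 = 0
    rw [Framing.rm_antisymm, F.isFlat.rm_antisymm_last, F.rm3131]
    simp
  rm0201 := by
    rw [Framing.prime_rm]
    change F.rm 1 3 1 0 = 0
    rw [Framing.rm_antisymm, F.isFlat.rm_antisymm_last, F.isFlat.rm_pair, F.rm0131]
    simp
  rm0231 := by
    rw [Framing.prime_rm]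
    change F.rm 1 3 2 0 = _
    rw [Framing.rm_antisymm, F.isFlat.rm_antisymm_last, F.isFlat.rm_pair, F.rm0231]
    simp
  rm0131 := by
    rw [Framing.prime_rm]
    change F.rm 1 0 2 0 = 0
    rw [Framing.rm_antisymm, F.isFlat.rm_antisymm_last, F.isFlat.rm_pair, F.rm0201]
    simp
  rm3131 := by
    rw [Framing.prime_rm]
    change F.rm 2 0 2 0 = 0
    rw [Framing.rm_antisymm, F.isFlat.rm_antisymm_last, F.rm0202]
    simp
  rm0303 := by
    rw [Framing.prime_rm]
    change F.rm 1 2 1 2 = 0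
    rw [Framing.rm_antisymm, F.isFlat.rm_antisymm_last, F.rm2121]
    simp
  rm0301 := by
    rw [Framing.prime_rm]
    change F.rm 1 2 1 0 = 0
    rw [Framing.rm_antisymm, F.isFlat.rm_antisymm_last, F.isFlat.rm_pair, F.rm0121]
    simp
  rm0321 := by
    rw [Framing.prime_rm]
    change F.rm 1 2 3 0 = _
    rw [Framing.rm_antisymm, F.isFlat.rm_antisymm_last, F.isFlat.rm_pair, F.rm0321]
    simp
  rm0121 := by
    rw [Framing.prime_rm]
    change F.rm 1 0 3 0 = 0
    rw [Framing.rm_antisymm, F.isFlat.rm_antisymm_last, F.isFlat.rm_pair, F.rm0301]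
    simp
  rm2121 := by
    rw [Framing.prime_rm]
    change F.rm 3 0 3 0 = 0
    rw [Framing.rm_antisymm, F.isFlat.rm_antisymm_last, F.rm0303]
    simp
  unit_psi := F.unit_psi
  unit_psit := F.unit_psit

/-- The derivatives of a cube root of `Ψ₂`. -/
theorem D_cubeRoot {ψ φ : A} (hφ : φ * ψ = 1) (hψ : ψ ^ 3 = F.Ψ) (a : Fin 4) :
    F.D a ψ = -ψ * (F.bField a + F.prime.bField a) := by
  have hφ' : ι A φ * ι A ψ = 1 := by rw [← map_mul, hφ, map_one]
  have hψ' : ι A ψ ^ 3 = F.graded.Ψ := by rw [← map_pow, hψ]; rfl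
  have key : ∀ k (u : A) (hu : F.graded.X k F.graded.Ψ
      = 3 * single (wt k) u * F.graded.Ψ), F.X k ψ = u * ψ := by
    intro k u hu
    have h := PrincipalFraming.X_cubeRoot hφ' hψ' hu
    have e : ι A ψ = single (0, 0) ψ := rfl
    rw [e, graded_X_single, single_mul_single] at h
    have h' := single_right_injective h
    simpa [wder] using h'
  -- The four frame derivatives of `Ψ` are `3ρΨ`, `3ρ'Ψ`, `3τΨ`, `3τ'Ψ`. After division by three
  -- they assemble into the one-form `-(B + B')`.
  obtain ⟨-, -, b0, b1, b2, b3⟩ := F.graded.bianchi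
  have r1 : F.graded.rot 2 1 3 = single (-1, -1) (F.rot 2 1 3) := F.graded_rot 2 1 3 rfl
  have r3 : F.graded.rot 0 1 3 = single (-1, 1) (F.rot 0 1 3) := F.graded_rot 0 1 3 rfl
  rw [rho_single] at b0
  rw [r1] at b1
  rw [tau_single] at b2
  rw [r3] at b3
  have x0 := key 0 _ b0
  have x1 := key 1 _ b1
  have x2 := key 2 _ b2
  have x3 := key 3 _ b3
  have hE : ∀ i j, F.con i (F.E j) = eta j i := by
    intro i j
    rw [← F.dual, Framing.con]
    simp only [mul_comm]
  suffices h : (fun a => F.D a ψ) = fun a => -ψ * (F.bField a + F.prime.bField a) from congrFun h a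
  apply F.eq_of_contr'
  intro i
  have hl : ∑ a, F.V i a * F.D a ψ = F.X i ψ := (F.X_apply i ψ).symm
  have hr : ∑ a, F.V i a * (-ψ * (F.bField a + F.prime.bField a))
      = -ψ * (-F.rot 3 0 2 * F.con i (F.E 1) + F.rot 1 0 2 * F.con i (F.E 3)
        - F.rot 2 1 3 * F.con i (F.E 0) + F.rot 0 1 3 * F.con i (F.E 2)) := by
    have e : F.prime.bField = fun a => -F.rot 2 1 3 * F.E 0 a + F.rot 0 1 3 * F.E 2 a := rfl
    rw [e]
    simp only [bField, Framing.con, Fin.sum_univ_four]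
    ring
  rw [hl, hr]
  simp only [hE]
  fin_cases i
  · simp [eta, x0, mul_comm]
  · simp [eta, x1, mul_comm]
  · simp [eta, x2, mul_comm]
  · simp [eta, x3, mul_comm]

/-- The first order part of the Teukolsky operator of spin weight `2`. -/
def twistedGradPlus (f : A) (a : Fin 4) : A := F.D a f + 4 * (F.bField a - F.wconn a) * f

/-- The Teukolsky operator of spin weight `2`. -/
def teukPlus (f : A) : A :=
  (∑ a, ∑ b, F.gi a b * (ccov1 F.D F.Γ (F.twistedGradPlus f) a b
    + 4 * (F.bField a - F.wconn a) * F.twistedGradPlus f b)) - 16 * F.Ψ * f + 4 * F.Λ * f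

/-- The primed operator is built from `D - 4(B' + ω)`. Conjugation by `φ⁴ = Ψ^{-4/3}` adds `4(B +
B')` by `D_cubeRoot`, which leaves `D + 4(B - ω)`, the operator of spin weight `2`. -/
theorem teuk_prime {ψ φ : A} (hφ : φ * ψ = 1) (hψ : ψ ^ 3 = F.Ψ) (f : A) :
    F.prime.teuk (φ ^ 4 * f) = φ ^ 4 * F.teukPlus f := by
  have hd : ∀ a, F.D a φ = φ * (F.bField a + F.prime.bField a) := by
    intro a
    have h1 := congrArg (F.D a) hφ
    rw [Derivation.leibniz, smul_eq_mul, smul_eq_mul, F.D_cubeRoot hφ hψ,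
      Derivation.map_one_eq_zero] at h1
    linear_combination φ * h1 - (F.D a φ - φ * (F.bField a + F.prime.bField a)) * hφ
  have hd4 : ∀ a u, F.D a (φ ^ 4 * u)
      = φ ^ 4 * (F.D a u + 4 * (F.bField a + F.prime.bField a) * u) := by
    intro a u
    rw [show φ ^ 4 * u = φ * (φ * (φ * (φ * u))) by ring]
    simp only [Derivation.leibniz, smul_eq_mul, hd]
    ring
  have hw : F.prime.twistedGrad (φ ^ 4 * f) = fun a => φ ^ 4 * F.twistedGradPlus f a := by
    funext a
    have e : F.prime.twistedGrad (φ ^ 4 * f) a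
        = F.D a (φ ^ 4 * f) - 4 * (F.prime.bField a - -F.wconn a) * (φ ^ 4 * f) := rfl
    rw [e, hd4, twistedGradPlus]
    ring
  have hc : ∀ a b, ccov1 F.prime.D F.prime.Γ (fun a => φ ^ 4 * F.twistedGradPlus f a) a b
      - 4 * (F.prime.bField a - F.prime.wconn a) * (φ ^ 4 * F.twistedGradPlus f b)
      = φ ^ 4 * (ccov1 F.D F.Γ (F.twistedGradPlus f) a b
        + 4 * (F.bField a - F.wconn a) * F.twistedGradPlus f b) := by
    intro a b
    change (F.D a (φ ^ 4 * F.twistedGradPlus f b)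
      - ∑ e, F.Γ e a b * (φ ^ 4 * F.twistedGradPlus f e))
      - 4 * (F.prime.bField a - -F.wconn a) * (φ ^ 4 * F.twistedGradPlus f b) = _
    rw [hd4]
    simp only [ccov1, Fin.sum_univ_four]
    ring
  have hg : F.prime.gi = F.gi := F.toFraming.prime_gi
  have hΨ : F.prime.Ψ = F.Ψ := rfl
  have hΛ : F.prime.Λ = F.Λ := rfl
  rw [teuk, hw]
  simp only [hc, hg, hΨ, hΛ, teukPlus]
  simp only [mul_left_comm _ (φ ^ 4), ← Finset.mul_sum]
  ring

end PrincipalTetrad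
end TypeDRec

/-! ### Vacuum tetrads with a complex conjugation -/

namespace TypeDRec

/-- A vacuum metric with a null tetrad `l, n, m, mt`; the conjugation `σ` exchanges `m` and `mt`. -/
structure VacuumTetrad (A : Type*) [CommRing A] where
  D : Fin 4 → Derivation ℤ A A
  hf : A
  (g gi E : Fin 4 → Fin 4 → A)
  Λ : A
  σ : A →+* A
  isMetric : IsMetric hf g gi
  g_eq : ∀ a b, g a b = etaTr fun i j => E i a * E j b
  two : ∀ u : A, 2 * u = 0 → u = 0
  three : ∀ u : A, 3 * u = 0 → u = 0
  D_comm : ∀ a b f, D a (D b f) = D b (D a f)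
  D_Λ : ∀ a, D a Λ = 0
  σ_D : ∀ a x, D a (σ x) = σ (D a x)
  σ_g : ∀ a b, σ (g a b) = g a b
  σ_gi : ∀ a b, σ (gi a b) = gi a b
  σ_E : ∀ i a, σ (E i a) = E (swapM i) a
  σ_Λ : σ Λ = Λ
  ricci : ∀ a b, ric D (christ D hf g gi) a b = 6 * Λ * g a b

namespace VacuumTetrad

variable {A : Type*} [CommRing A] (T : VacuumTetrad A)

/-- The frame vectors. -/
def V (i a : Fin 4) : A := ∑ b, T.gi a b * T.E i b

/-- Since `g` is invertible and built from the coframe, the coframe matrix has a one-sided inverse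
made of the raised vectors. Being square, it is invertible, and the other order of the product is
the claim. -/
theorem dual (i j : Fin 4) : ∑ a, T.E i a * T.V j a = eta i j := by
  have h : (Matrix.of fun a i => etaTr fun p q => T.V p a * (if q = i then 1 else 0))
      * (Matrix.of fun i b => T.E i b) = 1 := by
    ext a b
    have h1 := T.isMetric.inv a b
    simp only [T.g_eq] at h1
    rw [Matrix.mul_apply, Matrix.one_apply, ← h1]
    simp only [Matrix.of_apply, V, etaTr, Fin.sum_univ_four, Fin.isValue, Fin.reduceEq, if_true,
      if_false]
    ring
  have h' := mul_eq_one_comm.1 h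
  have h2 : ∀ j, _ := fun j => congrFun (congrFun h' i) j
  simp only [Matrix.mul_apply, Matrix.of_apply, etaTr, Matrix.one_apply, Fin.sum_univ_four] at h2
  have h3 : ∀ j, ∑ a, T.E i a * T.V j a = T.E i 0 * T.V j 0 + T.E i 1 * T.V j 1
      + T.E i 2 * T.V j 2 + T.E i 3 * T.V j 3 := fun j => Fin.sum_univ_four _
  have e0 := h2 0
  have e1 := h2 1
  have e2 := h2 2
  have e3 := h2 3
  simp only [Fin.isValue, Fin.reduceEq, if_true, if_false] at e0 e1 e2 e3
  have k0 : ∑ a, T.E i a * T.V 0 a = if i = 1 then 1 else 0 := by rw [h3]; linear_combination e1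
  have k1 : ∑ a, T.E i a * T.V 1 a = if i = 0 then 1 else 0 := by rw [h3]; linear_combination e0
  have k2 : ∑ a, T.E i a * T.V 2 a = -if i = 3 then 1 else 0 := by rw [h3]; linear_combination -e3
  have k3 : ∑ a, T.E i a * T.V 3 a = -if i = 2 then 1 else 0 := by rw [h3]; linear_combination -e2
  fin_cases j
  · refine k0.trans ?_
    fin_cases i <;> simp [eta]
  · refine k1.trans ?_
    fin_cases i <;> simp [eta]
  · refine k2.trans ?_
    fin_cases i <;> simp [eta]
  · refine k3.trans ?_
    fin_cases i <;> simp [eta]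

/-- The framing with the Levi-Civita connection. -/
def framing : Framing A where
  D := T.D
  E := T.E
  V := T.V
  Γ := christ T.D T.hf T.g T.gi
  dual := T.dual
  symm := T.isMetric.christ_symm
  compat c a b := by
    have h := T.isMetric.christ_compat (D := T.D) c a b
    simpa only [T.g_eq] using h

theorem framing_met : T.framing.met = T.g := by
  funext a b
  exact (T.g_eq a b).symm

theorem framing_gi : T.framing.gi = T.gi := by
  funext a b
  have h1 : T.framing.gi a b = ∑ c, ∑ d, T.gi a c * T.g c d * T.gi d b := by
    simp only [Framing.gi, framing, V, etaTr, T.g_eq, T.isMetric.symm_inv b, Fin.sum_univ_four]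
    ring
  have h2 : ∑ c, ∑ d, T.gi a c * T.g c d * T.gi d b
      = ∑ d, (∑ c, T.gi a c * T.g c d) * T.gi d b := by
    rw [Finset.sum_comm]
    simp only [Finset.sum_mul]
  rw [h1, h2]
  simp [T.isMetric.inv]

theorem σ_V (i a : Fin 4) : T.σ (T.V i a) = T.V (swapM i) a := by
  simp only [V, map_sum, map_mul, T.σ_gi, T.σ_E]

theorem σ_half : T.σ T.hf = T.hf := by
  have h := congrArg T.σ T.isMetric.half
  rw [map_mul, map_ofNat, map_one] at h
  exact sub_eq_zero.1 (T.two _ (by linear_combination h - T.isMetric.half))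

theorem σ_christ (c a b : Fin 4) : T.σ (christ T.D T.hf T.g T.gi c a b)
    = christ T.D T.hf T.g T.gi c a b := by
  simp only [christ, map_mul, map_sum, map_add, map_sub, T.σ_half, ← T.σ_D, T.σ_g, T.σ_gi]

/-- The metric, the connection and the coordinate curvature are real, so conjugation acts only
through the frame vectors. -/
theorem σ_rm (i j p q : Fin 4) : T.σ (T.framing.rm i j p q)
    = T.framing.rm (swapM i) (swapM j) (swapM p) (swapM q) := by
  have hr : ∀ a b c d, T.σ (riem T.D (christ T.D T.hf T.g T.gi) a b c d)
      = riem T.D (christ T.D T.hf T.g T.gi) a b c d := by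
    intro a b c d
    have h := map_riem T.σ (christ T.D T.hf T.g T.gi) (D := T.D) (D' := T.D) T.σ_D a b c d
    simp only [σ_christ] at h
    exact h.symm
  have hl : ∀ a b c d, T.σ (rlow T.D (christ T.D T.hf T.g T.gi) T.g a b c d)
      = rlow T.D (christ T.D T.hf T.g T.gi) T.g a b c d := by
    intro a b c d
    simp only [rlow, map_sum, map_mul, hr, T.σ_g]
  have hm : T.framing.rm = T.framing.fr4 (rlow T.D (christ T.D T.hf T.g T.gi) T.g) := by
    rw [Framing.rm, framing_met]
    rfl
  rw [hm]
  simp only [Framing.fr4, Framing.fr3, Framing.fr2, Framing.con, map_sum, map_mul, hl]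
  simp only [show ∀ i a, T.σ (T.framing.V i a) = T.framing.V (swapM i) a from T.σ_V]

theorem σ_rot (k i j : Fin 4) : T.σ (T.framing.rot k i j)
    = T.framing.rot (swapM k) (swapM i) (swapM j) := by
  have hc : ∀ c b, T.σ (ccov1 T.D (christ T.D T.hf T.g T.gi) (T.E i) c b)
      = ccov1 T.D (christ T.D T.hf T.g T.gi) (T.E (swapM i)) c b := by
    intro c b
    simp only [ccov1, map_sub, map_sum, map_mul, ← T.σ_D, T.σ_E, σ_christ]
  have hr : ∀ k i j, T.framing.rot k i j = ∑ c, ∑ b, T.V k c * T.V j b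
      * ccov1 T.D (christ T.D T.hf T.g T.gi) (T.E i) c b := fun _ _ _ => rfl
  simp only [hr, map_sum, map_mul, hc, σ_V]

/-- The frame components of the weight connection. -/
def om (k : Fin 4) : A := T.hf * (T.framing.rot k 0 1 - T.framing.rot k 2 3)
def omt (k : Fin 4) : A := T.hf * (T.framing.rot k 0 1 + T.framing.rot k 2 3)

theorem con_etaTr_E (u : Fin 4 → A) (k : Fin 4) :
    T.framing.con k (fun a => etaTr fun i j => u i * T.E j a) = u k := by
  have h : T.framing.con k (fun a => etaTr fun i j => u i * T.E j a)
      = etaTr fun i j => u i * ∑ a, T.E j a * T.V k a := by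
    simp only [Framing.con, framing, etaTr, Fin.sum_univ_four]
    ring
  rw [h]
  simp only [T.dual]
  exact Framing.etaTr_eta u k

/-- Exchanging `m` and `mt` reverses the sign of the `23` coefficient by antisymmetry, so the
connection forms for `p` and `q` are conjugate. -/
theorem σ_om (k : Fin 4) : T.σ (T.om k) = T.omt (swapM k) := by
  have h := T.framing.rot_antisymm (swapM k) 2 3
  simp only [om, omt, map_mul, map_sub, σ_half, σ_rot]
  rw [h]
  simp only [swapM, Matrix.cons_val]
  ring

/-- A vacuum tetrad that is principal for a Weyl tensor of type D. -/
def principal (Ψ : A) (h0 : T.framing.rm 0 2 0 2 = 0) (h1 : T.framing.rm 0 2 0 1 = 0)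
    (h2 : T.framing.rm 0 2 3 1 = Ψ + 2 * T.Λ) (h3 : T.framing.rm 0 1 3 1 = 0)
    (h4 : T.framing.rm 3 1 3 1 = 0) (hΨ : IsUnit Ψ) : PrincipalTetrad A where
  toFraming := T.framing
  wconn a := etaTr fun i j => T.om i * T.E j a
  wconnt a := etaTr fun i j => T.omt i * T.E j a
  Ψ := Ψ
  Ψt := T.σ Ψ
  Λ := T.Λ
  two := T.two
  three := T.three
  D_comm := T.D_comm
  D_Λ := T.D_Λ
  wconn_eq k := by
    rw [con_etaTr_E, om]
    linear_combination (T.framing.rot k 0 1 - T.framing.rot k 2 3) * T.isMetric.half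
  wconnt_eq k := by
    rw [con_etaTr_E, omt]
    linear_combination (T.framing.rot k 0 1 + T.framing.rot k 2 3) * T.isMetric.half
  ricci a b := by
    rw [framing_met]
    exact T.ricci a b
  rm0202 := h0
  rm0201 := h1
  rm0231 := h2
  rm0131 := h3
  rm3131 := h4
  -- The remaining five curvature conditions are complex conjugates of the given ones.
  rm0303 := by
    have h := T.σ_rm 0 2 0 2
    rw [h0, map_zero] at h
    exact h.symm
  rm0301 := by
    have h := T.σ_rm 0 2 0 1
    rw [h1, map_zero] at h
    exact h.symm
  rm0321 := by
    have h := T.σ_rm 0 2 3 1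
    rw [h2, map_add, map_mul, map_ofNat, T.σ_Λ] at h
    exact h.symm
  rm0121 := by
    have h := T.σ_rm 0 1 3 1
    rw [h3, map_zero] at h
    exact h.symm
  rm2121 := by
    have h := T.σ_rm 3 1 3 1
    rw [h4, map_zero] at h
    exact h.symm
  unit_psi := hΨ
  unit_psit := hΨ.map T.σ

end VacuumTetrad
end TypeDRec

/-! ### Coordinate fields as elements of the ring of smooth functions -/

namespace TypeDRec

variable {U : Set E4}

/-- Evaluation of smooth functions at a point. -/
def evalAt (y : U) : Smooth U →+* ℂ := (Pi.evalRingHom _ y).comp (smoothOn U).val.toRingHom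

theorem evalAt_apply (y : U) (x : Smooth U) : evalAt y x = x.1 y := rfl

/-- A left inverse over the ring is a left inverse at each point, hence the matrix inverse there.
This serves both the background and the perturbed metric. -/
theorem rep_invMetric {g : F2} {gA giA : Fin 4 → Fin 4 → Smooth U} (hg : ∀ a b, Rep (g a b) (gA a b))
    (hi : ∀ a b, ∑ c, giA a c * gA c b = if a = b then 1 else 0) (a b : Fin 4) :
    Rep (invMetric g a b) (giA a b) := by
  intro y
  have h : (Matrix.of fun i j => (giA i j).1 y) * (Matrix.of fun i j => g i j y) = 1 := by
    ext i j
    have h1 := congrArg (evalAt y) (hi i j)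
    rw [map_sum] at h1
    simp only [map_mul, evalAt_apply] at h1
    rw [Matrix.mul_apply, Matrix.one_apply]
    simp only [Matrix.of_apply, hg _ _ y, h1]
    split_ifs <;> rfl
  rw [invMetric, Matrix.inv_eq_left_inv h]
  rfl

/-- The constant function `1/2`. -/
noncomputable def halfFun (U : Set E4) : Smooth U := algebraMap ℂ (Smooth U) (1 / 2)

theorem two_mul_halfFun (U : Set E4) : 2 * halfFun U = 1 := by
  rw [halfFun, ← map_ofNat (algebraMap ℂ (Smooth U)) 2, ← map_mul]
  norm_num

section Curvature

variable (hU : IsOpen U) {g : F2} {gA giA : Fin 4 → Fin 4 → Smooth U}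

theorem rep_christoffel (hg : ∀ a b, Rep (g a b) (gA a b))
    (hi : ∀ a b, Rep (invMetric g a b) (giA a b)) (c a b : Fin 4) :
    Rep (christoffel g c a b) (christ (pdDer hU) (halfFun U) gA giA c a b) :=
  (Rep.const (1 / 2)).mul (Rep.sum fun d => (hi c d).mul
    ((((hg d b).pd hU a).add ((hg d a).pd hU b)).sub ((hg a b).pd hU d)))

variable {Γ : Fin 4 → Fin 4 → Fin 4 → Smooth U}

theorem rep_cov1 (hΓ : ∀ c a b, Rep (christoffel g c a b) (Γ c a b)) {w : F1}
    {x : Fin 4 → Smooth U} (h : ∀ i, Rep (w i) (x i)) (a b : Fin 4) :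
    Rep (cov1 g w a b) (ccov1 (pdDer hU) Γ x a b) :=
  ((h b).pd hU a).sub (Rep.sum fun e => (hΓ e a b).mul (h e))

theorem rep_cov3 (hΓ : ∀ c a b, Rep (christoffel g c a b) (Γ c a b)) {w : F3}
    {x : Fin 4 → Fin 4 → Fin 4 → Smooth U} (h : ∀ i j k, Rep (w i j k) (x i j k)) (a i j k : Fin 4) :
    Rep (cov3 g w a i j k) (ccov3 (pdDer hU) Γ x a i j k) := by
  have e : ccov3 (pdDer hU) Γ x a i j k = pdDer hU a (x i j k)
      - ∑ e, (Γ e a i * x e j k + Γ e a j * x i e k + Γ e a k * x i j e) := by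
    simp only [ccov3, Finset.sum_add_distrib]
    ring
  rw [e]
  exact ((h i j k).pd hU a).sub (Rep.sum fun e => (((hΓ e a i).mul (h e j k)).add
    ((hΓ e a j).mul (h i e k))).add ((hΓ e a k).mul (h i j e)))

theorem rep_cov4 (hΓ : ∀ c a b, Rep (christoffel g c a b) (Γ c a b)) {w : F4}
    {x : Fin 4 → Fin 4 → Fin 4 → Fin 4 → Smooth U} (h : ∀ i j k l, Rep (w i j k l) (x i j k l))
    (a i j k l : Fin 4) : Rep (cov4 g w a i j k l) (ccov4 (pdDer hU) Γ x a i j k l) := by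
  have e : ccov4 (pdDer hU) Γ x a i j k l = pdDer hU a (x i j k l)
      - ∑ e, (Γ e a i * x e j k l + Γ e a j * x i e k l + Γ e a k * x i j e l
        + Γ e a l * x i j k e) := by
    simp only [ccov4, Finset.sum_add_distrib]
    ring
  rw [e]
  exact ((h i j k l).pd hU a).sub (Rep.sum fun e => ((((hΓ e a i).mul (h e j k l)).add
    ((hΓ e a j).mul (h i e k l))).add ((hΓ e a k).mul (h i j e l))).add ((hΓ e a l).mul (h i j k e)))

theorem rep_riemann (hΓ : ∀ c a b, Rep (christoffel g c a b) (Γ c a b)) (a b d c : Fin 4) :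
    Rep (riemann g a b d c) (riem (pdDer hU) Γ a b d c) :=
  (((hΓ c b d).pd hU a).sub ((hΓ c a d).pd hU b)).add
    (Rep.sum fun e => ((hΓ c a e).mul (hΓ e b d)).sub ((hΓ c b e).mul (hΓ e a d)))

theorem rep_ricci (hΓ : ∀ c a b, Rep (christoffel g c a b) (Γ c a b)) (a b : Fin 4) :
    Rep (ricci g a b) (ric (pdDer hU) Γ a b) :=
  Rep.sum fun c => rep_riemann hU hΓ a c b c

theorem rep_scalarCurv (hi : ∀ a b, Rep (invMetric g a b) (giA a b))
    (hΓ : ∀ c a b, Rep (christoffel g c a b) (Γ c a b)) :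
    Rep (scalarCurv g) (∑ a, ∑ b, giA a b * ric (pdDer hU) Γ a b) :=
  Rep.sum fun a => Rep.sum fun b => (hi a b).mul (rep_ricci hU hΓ a b)

theorem rep_einstein (hg : ∀ a b, Rep (g a b) (gA a b))
    (hi : ∀ a b, Rep (invMetric g a b) (giA a b)) (a b : Fin 4) :
    Rep (einstein g a b) (ein (pdDer hU) (halfFun U) gA giA a b) :=
  have hΓ := rep_christoffel hU hg hi
  (rep_ricci hU hΓ a b).sub (((Rep.const (1 / 2)).mul (rep_scalarCurv hU hi hΓ)).mul (hg a b))

end Curvature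

/-- The coframe `l, n, m, \bar m`. -/
def Tetrad.co (θ : Tetrad) : Fin 4 → F1 := ![θ.l, θ.n, θ.m, θ.mb]

/-- A null tetrad of a vacuum metric in the coordinate domain `U`. -/
structure IsVacuumOn (U : Set E4) (g : F2) (θ : Tetrad) (lam : ℝ) : Prop where
  isOpen : IsOpen U
  smooth_g : ∀ a b, ContDiffOn ℝ ∞ (g a b) U
  smooth_co : ∀ i a, ContDiffOn ℝ ∞ (θ.co i a) U
  real_g : ∀ a b y, starRingEnd ℂ (g a b y) = g a b y
  symm_g : ∀ a b y, g a b y = g b a y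
  real_l : ∀ a y, starRingEnd ℂ (θ.l a y) = θ.l a y
  real_n : ∀ a y, starRingEnd ℂ (θ.n a y) = θ.n a y
  det_ne_zero : ∀ y ∈ U, (Matrix.of fun i j => g i j y).det ≠ 0
  metric : ∀ y ∈ U, ∀ a b, g a b y = θ.l a y * θ.n b y + θ.n a y * θ.l b y
    - θ.m a y * θ.mb b y - θ.mb a y * θ.m b y
  einstein : ∀ y ∈ U, ∀ a b, einstein g a b y + (lam : ℂ) * g a b y = 0

namespace IsVacuumOn

variable {g : F2} {θ : Tetrad} {lam : ℝ} (H : IsVacuumOn U g θ lam)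

/-- The metric as a matrix of smooth functions. -/
def gA : Matrix (Fin 4) (Fin 4) (Smooth U) := Matrix.of fun a b => restr (g a b) (H.smooth_g a b)

theorem rep_g (a b : Fin 4) : Rep (g a b) (H.gA a b) := fun _ => rfl

theorem isUnit_det : IsUnit H.gA.det := by
  refine isUnit_smooth fun y => ?_
  have h : evalAt y H.gA.det = (Matrix.of fun i j => g i j y).det := by
    rw [RingHom.map_det]
    rfl
  rw [← evalAt_apply, h]
  exact H.det_ne_zero y y.2

/-- The inverse metric. -/
noncomputable def giA : Matrix (Fin 4) (Fin 4) (Smooth U) := H.gA⁻¹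

theorem isMetric : IsMetric (halfFun U) H.gA H.giA where
  half := two_mul_halfFun U
  symm a b := Rep.ext fun y => H.symm_g a b y
  symm_inv a b := by
    have h : H.gA.transpose = H.gA := by
      funext a b
      exact Rep.ext (x := H.gA b a) (x' := H.gA a b) fun y => H.symm_g b a y
    have h2 := Matrix.transpose_nonsing_inv H.gA
    rw [h] at h2
    exact (congrFun (congrFun h2 a) b).symm
  inv a b := by
    have h := congrFun (congrFun (Matrix.nonsing_inv_mul _ H.isUnit_det) a) b
    rwa [Matrix.mul_apply, Matrix.one_apply] at h

theorem rep_gi (a b : Fin 4) : Rep (invMetric g a b) (H.giA a b) :=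
  rep_invMetric H.rep_g H.isMetric.inv a b

/-- The trace of the Einstein equations gives scalar curvature `4λ`, so the Ricci tensor is `λ g`;
the normalization is `Λ = λ/6`. -/
theorem ric_eq (a b : Fin 4) : ric (pdDer H.isOpen) (christ (pdDer H.isOpen) (halfFun U) H.gA H.giA) a b
    = 6 * algebraMap ℂ (Smooth U) (lam / 6) * H.gA a b := by
  set R := ric (pdDer H.isOpen) (christ (pdDer H.isOpen) (halfFun U) H.gA H.giA) with hR
  set l := algebraMap ℂ (Smooth U) lam with hl
  have h6 : 6 * algebraMap ℂ (Smooth U) (lam / 6) = l := by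
    rw [hl, ← map_ofNat (algebraMap ℂ (Smooth U)) 6, ← map_mul]
    congr 1
    ring
  rw [h6]
  have he : ∀ a b, R a b - halfFun U * (∑ c, ∑ d, H.giA c d * R c d) * H.gA a b
      + l * H.gA a b = 0 := fun a b =>
    ((rep_einstein H.isOpen H.rep_g H.rep_gi a b).add ((Rep.const (lam : ℂ)).mul (H.rep_g a b))).unique
      (f' := fun _ => 0) (x' := 0) (fun _ => rfl) fun y hy => H.einstein y hy a b
  set S := ∑ c, ∑ d, H.giA c d * R c d with hS
  have t4 : ∑ c, ∑ d, H.giA c d * H.gA c d = 4 := by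
    have : ∀ c, ∑ d, H.giA c d * H.gA c d = 1 := by
      intro c
      have := H.isMetric.inv c c
      rw [if_pos rfl] at this
      rw [← this]
      exact Finset.sum_congr rfl fun d _ => by rw [H.isMetric.symm c d]
    simp [this]
  have h0 : S - halfFun U * S * 4 + l * 4 = 0 := by
    rw [← t4]
    have : ∑ c, ∑ d, H.giA c d * (R c d - halfFun U * S * H.gA c d + l * H.gA c d) = 0 := by
      simp [he]
    rw [← this]
    simp only [mul_add, mul_sub, Finset.sum_add_distrib, Finset.sum_sub_distrib, Finset.mul_sum,
      mul_left_comm, hS]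
  linear_combination he a b - halfFun U * H.gA a b * h0
    + (2 * l * H.gA a b - 2 * halfFun U * S * H.gA a b) * H.isMetric.half

end IsVacuumOn
end TypeDRec

/-! ### Weyl scalars as frame components of the curvature -/

namespace TypeDRec

theorem sum_reverse {A : Type*} [AddCommMonoid A] (f : Fin 4 → Fin 4 → Fin 4 → Fin 4 → A) :
    ∑ d, ∑ c, ∑ b, ∑ a, f a b c d = ∑ a, ∑ b, ∑ c, ∑ d, f a b c d := by
  have h3 : ∀ g : Fin 4 → Fin 4 → Fin 4 → A,
      ∑ c, ∑ b, ∑ a, g a b c = ∑ a, ∑ b, ∑ c, g a b c := fun g => by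
    rw [Finset.sum_comm, Finset.sum_congr rfl fun b _ => Finset.sum_comm, Finset.sum_comm]
  rw [Finset.sum_congr rfl fun d _ => h3 fun a b c => f a b c d, Finset.sum_comm,
    Finset.sum_congr rfl fun a _ => Finset.sum_comm]
  exact Finset.sum_congr rfl fun a _ => Finset.sum_congr rfl fun b _ => Finset.sum_comm

namespace Framing

variable {A : Type*} [CommRing A] (F : Framing A)

theorem fr4_eq_sum (t : Fin 4 → Fin 4 → Fin 4 → Fin 4 → A) (i j p q : Fin 4) :
    F.fr4 t i j p q = ∑ a, ∑ b, ∑ c, ∑ d, t a b c d * F.V i a * F.V j b * F.V p c * F.V q d := by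
  rw [← sum_reverse]
  simp only [fr4, fr3, fr2, con, Finset.mul_sum]
  refine Finset.sum_congr rfl fun d _ => Finset.sum_congr rfl fun c _ =>
    Finset.sum_congr rfl fun b _ => Finset.sum_congr rfl fun a _ => ?_
  ring

theorem con_mul_left (i : Fin 4) (x : A) (t : Fin 4 → A) :
    F.con i (fun a => x * t a) = x * F.con i t := by
  simp only [con, Finset.mul_sum, mul_left_comm]

theorem con_mul_right (i : Fin 4) (x : A) (t : Fin 4 → A) :
    F.con i (fun a => t a * x) = F.con i t * x := by
  simp only [con, Finset.sum_mul, mul_assoc]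

theorem fr4_met_mul_met (i j p q : Fin 4) :
    F.fr4 (fun a b c d => F.met a c * F.met b d) i j p q = eta i p * eta j q := by
  rw [← F.fr2_met, ← F.fr2_met]
  simp only [fr4, fr3, fr2, con_mul_left, con_mul_right]

theorem fr4_met_mul_met' (i j p q : Fin 4) :
    F.fr4 (fun a b c d => F.met a d * F.met b c) i j p q = eta i q * eta j p := by
  rw [← F.fr2_met, ← F.fr2_met]
  simp only [fr4, fr3, fr2, con_mul_left, con_mul_right]

end Framing

theorem VacuumTetrad.rm_sub_eta {A : Type*} [CommRing A] (T : VacuumTetrad A) (i j p q : Fin 4) :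
    T.framing.rm i j p q - 2 * T.Λ * (eta i p * eta j q - eta i q * eta j p)
      = ∑ a, ∑ b, ∑ c, ∑ d, (rlow T.D T.framing.Γ T.g a b c d
          - 2 * T.Λ * (T.g a c * T.g b d - T.g a d * T.g b c))
        * T.framing.V i a * T.framing.V j b * T.framing.V p c * T.framing.V q d := by
  rw [← T.framing.fr4_met_mul_met, ← T.framing.fr4_met_mul_met', Framing.rm,
    T.framing_met, Framing.fr4_eq_sum, Framing.fr4_eq_sum, Framing.fr4_eq_sum]
  simp only [Finset.mul_sum, ← Finset.sum_sub_distrib]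
  refine Finset.sum_congr rfl fun a _ => Finset.sum_congr rfl fun b _ =>
    Finset.sum_congr rfl fun c _ => Finset.sum_congr rfl fun d _ => ?_
  have h : rlow T.framing.D T.framing.Γ T.g a b c d = rlow T.D T.framing.Γ T.g a b c d := rfl
  rw [h]
  ring

namespace Rep

variable {U : Set E4}

theorem ofNat (n : ℕ) [n.AtLeastTwo] :
    Rep (fun _ => (OfNat.ofNat n : ℂ)) (OfNat.ofNat n : Smooth U) := fun _ => rfl

theorem intCast (n : ℤ) : Rep (fun _ => (n : ℂ)) (n : Smooth U) := fun y => by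
  have := map_intCast (evalAt y) n
  exact this.symm

end Rep

namespace IsVacuumOn

variable {U : Set E4} {g : F2} {θ : Tetrad} {lam : ℝ} (H : IsVacuumOn U g θ lam)

/-- The coframe as a matrix of smooth functions. -/
def coA (i a : Fin 4) : Smooth U := restr (θ.co i a) (H.smooth_co i a)

theorem rep_co (i a : Fin 4) : Rep (θ.co i a) (H.coA i a) := fun _ => rfl

theorem conj_gA (a b : Fin 4) : conjHom U (H.gA a b) = H.gA a b :=
  (H.rep_g a b).conj.unique (H.rep_g a b) fun y _ => H.real_g a b y

theorem conj_giA (a b : Fin 4) : conjHom U (H.giA a b) = H.giA a b := by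
  have h : (Matrix.of fun a b => conjHom U (H.giA a b)) * H.gA = 1 := by
    funext a b
    have h1 := congrArg (conjHom U) (H.isMetric.inv a b)
    simp only [map_sum, map_mul, conj_gA] at h1
    rw [Matrix.mul_apply, Matrix.one_apply]
    refine h1.trans ?_
    split_ifs <;> simp
  have h2 := Matrix.inv_eq_left_inv h
  exact (congrFun (congrFun h2 a) b).symm

theorem conj_coA (i a : Fin 4) : conjHom U (H.coA i a) = H.coA (swapM i) a := by
  refine (H.rep_co i a).conj.unique (H.rep_co _ a) fun y _ => ?_
  fin_cases i
  · exact H.real_l a y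
  · exact H.real_n a y
  · rfl
  · exact Complex.conj_conj _

/-- The vacuum tetrad over the ring of smooth functions. -/
noncomputable def tet : VacuumTetrad (Smooth U) where
  D := pdDer H.isOpen
  hf := halfFun U
  g := H.gA
  gi := H.giA
  E := H.coA
  Λ := algebraMap ℂ (Smooth U) (lam / 6)
  σ := conjHom U
  isMetric := H.isMetric
  g_eq a b := (H.rep_g a b).unique
    (((((H.rep_co 0 a).mul (H.rep_co 1 b)).add ((H.rep_co 1 a).mul (H.rep_co 0 b))).sub
      ((H.rep_co 2 a).mul (H.rep_co 3 b))).sub ((H.rep_co 3 a).mul (H.rep_co 2 b)))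
    fun y hy => H.metric y hy a b
  two u h := smooth_cancel two_ne_zero u (by exact_mod_cast h)
  three u h := smooth_cancel three_ne_zero u (by exact_mod_cast h)
  D_comm := pdDer_comm H.isOpen
  D_Λ a := pdDer_const H.isOpen a _
  σ_D := pdDer_conj H.isOpen
  σ_g := H.conj_gA
  σ_gi := H.conj_giA
  σ_E := H.conj_coA
  σ_Λ := (Rep.const (lam / 6 : ℂ)).conj.unique (Rep.const (lam / 6 : ℂ)) fun y _ => by
    rw [map_div₀, Complex.conj_ofReal, map_ofNat]
  ricci := H.ric_eq

theorem rep_Γ (c a b : Fin 4) : Rep (christoffel g c a b) (H.tet.framing.Γ c a b) :=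
  rep_christoffel H.isOpen H.rep_g H.rep_gi c a b

theorem rep_up (i a : Fin 4) : Rep (Tetrad.up g (θ.co i) a) (H.tet.framing.V i a) :=
  Rep.sum fun b => (H.rep_gi a b).mul (H.rep_co i b)

theorem rep_rot (k i j : Fin 4) :
    Rep (Tetrad.rot g (θ.co j) (θ.co k) (θ.co i)) (H.tet.framing.rot k i j) :=
  Rep.sum fun c => Rep.sum fun b => ((H.rep_up k c).mul (H.rep_up j b)).mul
    (rep_cov1 H.isOpen H.rep_Γ (H.rep_co i) c b)

/-- With `R_{ab} = 6Λ g_{ab}` and scalar curvature `24Λ`, the Ricci terms contribute `-6Λ` and the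
scalar term `4Λ`, hence the coefficient `-2Λ`. -/
theorem rep_weyl (a b c d : Fin 4) : Rep (weyl g a b c d)
    (rlow H.tet.D H.tet.framing.Γ H.tet.g a b c d
      - 2 * H.tet.Λ * (H.tet.g a c * H.tet.g b d - H.tet.g a d * H.tet.g b c)) := by
  have hR : ∀ a b, Rep (ricci g a b) (6 * H.tet.Λ * H.tet.g a b) := fun a b => by
    rw [← H.tet.ricci]
    exact rep_ricci H.isOpen H.rep_Γ a b
  have t4 : ∑ c, ∑ d, H.giA c d * H.gA c d = 4 := by
    have : ∀ c, ∑ d, H.giA c d * H.gA c d = 1 := by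
      intro c
      have := H.isMetric.inv c c
      rw [if_pos rfl] at this
      rw [← this]
      exact Finset.sum_congr rfl fun d _ => by rw [H.isMetric.symm c d]
    simp [this]
  have hS : Rep (scalarCurv g) (24 * H.tet.Λ) := by
    have h1 : Rep (scalarCurv g) (∑ a, ∑ b, H.giA a b * (6 * H.tet.Λ * H.tet.g a b)) :=
      Rep.sum fun a => Rep.sum fun b => (H.rep_gi a b).mul (hR a b)
    have h2 : ∑ a, ∑ b, H.giA a b * (6 * H.tet.Λ * H.tet.g a b)
        = 6 * H.tet.Λ * ∑ c, ∑ d, H.giA c d * H.gA c d := by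
      simp only [Finset.mul_sum, mul_left_comm]
      rfl
    rw [h2, t4] at h1
    convert h1 using 1
    ring
  have h6 : algebraMap ℂ (Smooth U) (1 / 6) * 6 = 1 := by
    rw [← map_ofNat (algebraMap ℂ (Smooth U)) 6, ← map_mul]
    norm_num
  have hl : Rep (fun y => ∑ e, riemann g a b c e y * g e d y)
      (rlow H.tet.D H.tet.framing.Γ H.tet.g a b c d) :=
    Rep.sum fun e => (rep_riemann H.isOpen H.rep_Γ a b c e).mul (H.rep_g e d)
  have h := (hl.sub ((Rep.const (1 / 2)).mul (((((H.rep_g a c).mul (hR d b)).sub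
    ((H.rep_g a d).mul (hR c b))).sub ((H.rep_g b c).mul (hR d a))).add
      ((H.rep_g b d).mul (hR c a))))).add (((Rep.const (1 / 6)).mul hS).mul
        (((H.rep_g a c).mul (H.rep_g d b)).sub ((H.rep_g a d).mul (H.rep_g c b))))
  have h2 := H.isMetric.half
  rw [halfFun] at h2
  have sy : ∀ a b, H.tet.g a b = H.tet.g b a := H.isMetric.symm
  have h' : Rep (weyl g a b c d) _ := h
  convert h' using 1
  rw [sy d b, sy d a, sy c b, sy c a]
  change _ = _ - _ * (H.tet.g a c * _ - H.tet.g a d * _ - H.tet.g b c * _ + H.tet.g b d * _)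
    + _ * (H.tet.g a c * H.gA d b - H.tet.g a d * H.gA c b)
  change ∀ a b, H.gA a b = H.gA b a at sy
  rw [sy d b, sy c b]
  change _ = _ - _ * (H.tet.g a c * _ - H.tet.g a d * _ - H.tet.g b c * _ + H.tet.g b d * _)
    + _ * (H.tet.g a c * H.tet.g b d - H.tet.g a d * H.tet.g b c)
  linear_combination (6 * H.tet.Λ * (H.tet.g a c * H.tet.g b d - H.tet.g a d * H.tet.g b c)) * h2
    - 4 * H.tet.Λ * (H.tet.g a c * H.tet.g b d - H.tet.g a d * H.tet.g b c) * h6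

theorem rep_weylContr (i j p q : Fin 4) :
    Rep (Tetrad.weylContr g (θ.co i) (θ.co j) (θ.co p) (θ.co q))
      (H.tet.framing.rm i j p q - 2 * H.tet.Λ * (eta i p * eta j q - eta i q * eta j p)) := by
  rw [H.tet.rm_sub_eta]
  exact Rep.sum fun a => Rep.sum fun b => Rep.sum fun c => Rep.sum fun d =>
      ((((H.rep_weyl a b c d).mul (H.rep_up i a)).mul (H.rep_up j b)).mul (H.rep_up p c)).mul
        (H.rep_up q d)

end IsVacuumOn
end TypeDRec

/-! ### Exact perturbation along a null direction -/

namespace TypeDRec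

section PerturbedInverse

variable {A : Type*} [CommRing A] {hf : A} {g gi h : Fin 4 → Fin 4 → A}

/-- The Neumann series for the inverse of `g + r h` stops after the linear term because `h g⁻¹ h =
0`. -/
theorem IsMetric.perturbed_inv (H : IsMetric hf g gi)
    (hn : ∀ a b, ∑ c, ∑ d, h a c * gi c d * h d b = 0) (r : A) (a b : Fin 4) :
    ∑ c, (gi a c - r * raise gi h a c) * (g c b + r * h c b) = if a = b then 1 else 0 := by
  set G : Matrix (Fin 4) (Fin 4) A := Matrix.of g with hG
  set I : Matrix (Fin 4) (Fin 4) A := Matrix.of gi with hI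
  set K : Matrix (Fin 4) (Fin 4) A := Matrix.of h with hK
  have h1 : I * G = 1 := by
    funext a b
    rw [Matrix.mul_apply, Matrix.one_apply]
    exact H.inv a b
  have h2 : G * I = 1 := mul_eq_one_comm.1 h1
  have h3 : K * I * K = 0 := by
    funext a b
    simp only [Matrix.mul_apply, Finset.sum_mul]
    rw [Finset.sum_comm]
    exact hn a b
  have h4 : raise gi h = I * K * I := by
    funext a b
    simp only [Matrix.mul_apply, Finset.sum_mul]
    rw [Finset.sum_comm]
    rfl
  have h5 : (I - r • (I * K * I)) * (G + r • K) = 1 := by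
    have e : (I - r • (I * K * I)) * (G + r • K)
        = I * G + r • (I * K - I * K * (I * G)) - (r * r) • (I * (K * I * K)) := by
      simp only [sub_mul, mul_add, smul_mul_assoc, mul_smul_comm, smul_sub, mul_assoc, smul_smul]
      abel
    rw [e, h1, h3]
    simp
  have h6 := congrFun (congrFun h5 a) b
  rw [Matrix.mul_apply, Matrix.one_apply] at h6
  rw [← h6, h4]
  rfl

end PerturbedInverse

namespace Framing

variable {A : Type*} [CommRing A] (F : Framing A)

theorem sum_gi_E (i j : Fin 4) : ∑ a, ∑ b, F.gi a b * (F.E i a * F.E j b) = eta i j := by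
  rw [F.sum_gi]
  simp only [con_mul_left, con_mul_right]
  have h : ∀ i j, F.con i (F.E j) = eta j i := fun i j => by
    rw [← F.dual j i]
    exact Finset.sum_congr rfl fun a _ => mul_comm _ _
  simp only [h]
  fin_cases i <;> fin_cases j <;> simp [etaTr, eta]

end Framing

namespace PrincipalTetrad

variable {A : Type*} [CommRing A] (F : PrincipalTetrad A)

theorem pert_symm (f : A) (a b : Fin 4) : F.pert f a b = F.pert f b a := by
  simp only [pert]
  ring

/-- All contractions among `l` and `m` vanish. This makes `pert` trace free and, in `pert_null`, of
square zero. -/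
theorem trace_pert (f : A) : ∑ a, ∑ b, F.gi a b * F.pert f a b = 0 := by
  have e : ∑ a, ∑ b, F.gi a b * F.pert f a b
      = F.potX f * (∑ a, ∑ b, F.gi a b * (F.E 0 a * F.E 0 b))
        - F.potY f * (∑ a, ∑ b, F.gi a b * (F.E 0 a * F.E 2 b)
          + ∑ a, ∑ b, F.gi a b * (F.E 2 a * F.E 0 b))
        + F.potZ f * ∑ a, ∑ b, F.gi a b * (F.E 2 a * F.E 2 b) := by
    simp only [pert, Finset.mul_sum, ← Finset.sum_add_distrib, ← Finset.sum_sub_distrib]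
    exact Finset.sum_congr rfl fun a _ => Finset.sum_congr rfl fun b _ => by ring
  rw [e, F.sum_gi_E, F.sum_gi_E, F.sum_gi_E, F.sum_gi_E]
  simp [eta]

theorem pert_null (f : A) (a b : Fin 4) :
    ∑ c, ∑ d, F.pert f a c * F.gi c d * F.pert f d b = 0 := by
  have e : ∑ c, ∑ d, F.pert f a c * F.gi c d * F.pert f d b
      = (F.potX f * F.E 0 a - F.potY f * F.E 2 a) * (F.potX f * F.E 0 b - F.potY f * F.E 2 b)
          * (∑ c, ∑ d, F.gi c d * (F.E 0 c * F.E 0 d))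
        + (F.potX f * F.E 0 a - F.potY f * F.E 2 a) * (F.potZ f * F.E 2 b - F.potY f * F.E 0 b)
          * (∑ c, ∑ d, F.gi c d * (F.E 0 c * F.E 2 d))
        + (F.potZ f * F.E 2 a - F.potY f * F.E 0 a) * (F.potX f * F.E 0 b - F.potY f * F.E 2 b)
          * (∑ c, ∑ d, F.gi c d * (F.E 2 c * F.E 0 d))
        + (F.potZ f * F.E 2 a - F.potY f * F.E 0 a) * (F.potZ f * F.E 2 b - F.potY f * F.E 0 b)
          * ∑ c, ∑ d, F.gi c d * (F.E 2 c * F.E 2 d) := by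
    simp only [pert, Finset.mul_sum, ← Finset.sum_add_distrib]
    exact Finset.sum_congr rfl fun a _ => Finset.sum_congr rfl fun b _ => by ring
  rw [e, F.sum_gi_E, F.sum_gi_E, F.sum_gi_E, F.sum_gi_E]
  simp [eta]

end PrincipalTetrad

namespace IsVacuumOn

variable {U : Set E4} {g : F2} {θ : Tetrad} {lam : ℝ} (H : IsVacuumOn U g θ lam)

/-- Along the line the inverse metric is exact, so the field equations equal `ε²` times a polynomial
in `ε` at each point, and the derivative at zero vanishes. -/
theorem linEinsteinAt {h : F2} {k : Fin 4 → Fin 4 → Smooth U} (hh : ∀ a b, Rep (h a b) (-k a b))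
    (hs : ∀ a b, k a b = k b a) (ht : ∑ a, ∑ b, H.giA a b * k a b = 0)
    (hn : ∀ a b, ∑ c, ∑ d, k a c * H.giA c d * k d b = 0)
    (hlin : ∀ a b, clin (pdDer H.isOpen)
      (christ (pdDer H.isOpen) (halfFun U) H.gA H.giA) H.giA k a b
        + 12 * algebraMap ℂ (Smooth U) (lam / 6) * k a b = 0)
    {y : E4} (hy : y ∈ U) : LinEinsteinAt g lam h y := by
  intro a b
  obtain ⟨p, hp⟩ := exists_remainder (D := pdDer H.isOpen)
    (Λ := algebraMap ℂ (Smooth U) (lam / 6)) H.isMetric hs ht H.ric_eq hlin a b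
  set q := p.map (evalAt ⟨y, hy⟩) with hq
  have hval : (fun ε : ℝ => TypeDRec.einstein (fun i j z => g i j z + (ε : ℂ) * h i j z) a b y
        + (lam : ℂ) * (g a b y + (ε : ℂ) * h a b y))
      = fun ε : ℝ => (ε : ℂ) ^ 2 * q.eval (-(ε : ℂ)) := by
    funext ε
    -- The sign compensates that `h` is represented by `-k`.
    set r : Smooth U := -algebraMap ℂ (Smooth U) ε with hr
    have h1 : ∀ i j, Rep (fun z => g i j z + (ε : ℂ) * h i j z) (H.gA i j + r * k i j) :=
      fun i j => by
        have h2 := (H.rep_g i j).add ((Rep.const (ε : ℂ)).mul (hh i j))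
        have e : r * k i j = algebraMap ℂ (Smooth U) ε * -k i j := by
          rw [hr]
          ring
        rw [e]
        exact h2
    have h2 := rep_invMetric (giA := fun a b => H.giA a b - r * raise H.giA k a b) h1
      (H.isMetric.perturbed_inv hn r)
    have h3 := (rep_einstein H.isOpen h1 h2 a b).add ((Rep.const (lam : ℂ)).mul (h1 a b))
    have h4 := hp r fun a => by rw [hr, map_neg, pdDer_const, neg_zero]
    have h6 : 6 * algebraMap ℂ (Smooth U) (lam / 6) = algebraMap ℂ (Smooth U) lam := by
      rw [← map_ofNat (algebraMap ℂ (Smooth U)) 6, ← map_mul]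
      congr 1
      ring
    have h5 : r ^ 2 * p.eval r = _ := h4.symm
    rw [h6] at h5
    refine (h3 ⟨y, hy⟩).trans ?_
    rw [← evalAt_apply, ← h5, map_mul, map_pow, ← Polynomial.eval₂_at_apply, ← Polynomial.eval_map]
    have h7 : evalAt ⟨y, hy⟩ r = -(ε : ℂ) := by
      rw [hr, map_neg]
      rfl
    rw [h7, neg_sq]
  rw [hval]
  have hd : HasDerivAt (fun z : ℂ => z ^ 2 * q.eval (-z)) 0 ((0 : ℝ) : ℂ) := by
    have hq' : HasDerivAt (fun z : ℂ => q.eval (-z)) _ ((0 : ℝ) : ℂ) :=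
      (q.hasDerivAt (-((0 : ℝ) : ℂ))).comp _ (hasDerivAt_neg _)
    exact ((hasDerivAt_pow 2 ((0 : ℝ) : ℂ)).mul hq').congr_deriv (by simp)
  exact hd.comp_ofReal

end IsVacuumOn
end TypeDRec

/-! ### Spin coefficients and the Kegeles–Cohen perturbation in coordinates -/

namespace TypeDRec

section ConstMul

variable {A : Type*} [CommRing A] {D : Fin 4 → Derivation ℤ A A} (Γ : Fin 4 → Fin 4 → Fin 4 → A)
  (gi : Fin 4 → Fin 4 → A) {c : A}

theorem cdiv4_const_mul (hc : ∀ a, D a c = 0) (t : Fin 4 → Fin 4 → Fin 4 → Fin 4 → A)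
    (i j k : Fin 4) :
    cdiv4 D Γ gi (fun i j k l => c * t i j k l) i j k = c * cdiv4 D Γ gi t i j k := by
  simp only [cdiv4, ccov4, Derivation.leibniz, hc, smul_eq_mul, mul_left_comm _ c, ← Finset.mul_sum]
  simp only [mul_zero, add_zero, ← mul_sub, mul_left_comm _ c, ← Finset.mul_sum]

theorem cdiv3_const_mul (hc : ∀ a, D a c = 0) (t : Fin 4 → Fin 4 → Fin 4 → A) (i j : Fin 4) :
    cdiv3 D Γ gi (fun i j k => c * t i j k) i j = c * cdiv3 D Γ gi t i j := by
  simp only [cdiv3, ccov3, Derivation.leibniz, hc, smul_eq_mul, mul_left_comm _ c, ← Finset.mul_sum]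
  simp only [mul_zero, add_zero, ← mul_sub, mul_left_comm _ c, ← Finset.mul_sum]

end ConstMul

/-- A null tetrad of a vacuum metric of Petrov type D, principal on the coordinate domain `U`. -/
structure IsTypeDOn (U : Set E4) (g : F2) (θ : Tetrad) (lam : ℝ) : Prop
    extends IsVacuumOn U g θ lam where
  principal : ∀ y ∈ U, θ.Psi0 g y = 0 ∧ θ.Psi1 g y = 0 ∧ θ.Psi2 g y ≠ 0 ∧ θ.Psi3 g y = 0
    ∧ θ.Psi4 g y = 0

namespace IsTypeDOn

variable {U : Set E4} {g : F2} {θ : Tetrad} {lam : ℝ} (H : IsTypeDOn U g θ lam)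

/-- The Weyl scalar `Ψ₂`. -/
noncomputable def psi : Smooth U := H.tet.framing.rm 0 2 3 1 - 2 * H.tet.Λ

theorem rep_psi : Rep (θ.Psi2 g) H.psi := by
  have e : H.psi = H.tet.framing.rm 0 2 3 1
      - 2 * H.tet.Λ * (eta 0 3 * eta 2 1 - eta 0 1 * eta 2 3) := by
    simp only [psi, eta, Matrix.cons_val]
    ring
  rw [e]
  exact H.rep_weylContr 0 2 3 1

theorem rm_eq_zero {i j p q : Fin 4}
    (h : ∀ y ∈ U, Tetrad.weylContr g (θ.co i) (θ.co j) (θ.co p) (θ.co q) y = 0)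
    (e : (eta i p * eta j q - eta i q * eta j p : Smooth U) = 0) :
    H.tet.framing.rm i j p q = 0 := by
  have h1 := H.rep_weylContr i j p q
  rw [e, mul_zero, sub_zero] at h1
  exact h1.unique (f' := fun _ => 0) (x' := 0) (fun _ => rfl) h

/-- The principal tetrad over the ring of smooth functions. -/
noncomputable def tetrad : PrincipalTetrad (Smooth U) :=
  H.tet.principal H.psi
    (H.rm_eq_zero (fun y hy => (H.principal y hy).1) (by simp [eta]))
    (H.rm_eq_zero (fun y hy => (H.principal y hy).2.1) (by simp [eta]))
    (by rw [psi]; ring)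
    (H.rm_eq_zero (fun y hy => (H.principal y hy).2.2.2.1) (by simp [eta]))
    (H.rm_eq_zero (fun y hy => (H.principal y hy).2.2.2.2) (by simp [eta]))
    (isUnit_smooth fun y => by rw [← H.rep_psi y]; exact (H.principal y y.2).2.2.1)

theorem tetrad_gi : H.tetrad.gi = H.giA := H.tet.framing_gi

theorem tetrad_D : H.tetrad.D = pdDer H.isOpen := rfl

theorem tetrad_Γ : H.tetrad.Γ = christ (pdDer H.isOpen) (halfFun U) H.gA H.giA := rfl

theorem tetrad_psi : H.tetrad.Ψ = H.psi := rfl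

theorem tetrad_Λ : H.tetrad.Λ = algebraMap ℂ (Smooth U) (lam / 6) := rfl

theorem rep_E (i a : Fin 4) : Rep (θ.co i a) (H.tetrad.E i a) := H.rep_co i a

theorem rep_V (i a : Fin 4) : Rep (Tetrad.up g (θ.co i) a) (H.tetrad.V i a) := H.rep_up i a

theorem rep_rho : Rep (θ.rho g) (H.tetrad.rot 3 0 2) := H.rep_rot 3 0 2
theorem rep_tau : Rep (θ.tau g) (H.tetrad.rot 1 0 2) := H.rep_rot 1 0 2

theorem rep_conj_rho : Rep (fun y => starRingEnd ℂ (θ.rho g y)) (H.tetrad.rot 2 0 3) := by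
  have h := H.rep_rho.conj
  rwa [show conjHom U (H.tetrad.rot 3 0 2) = H.tetrad.rot 2 0 3 from H.tet.σ_rot 3 0 2] at h

theorem rep_conj_tau' : Rep (fun y => starRingEnd ℂ (θ.tau' g y)) (H.tetrad.rot 0 1 2) := by
  have h := (H.rep_rot 0 1 3).conj
  have e : conjHom U (H.tet.framing.rot 0 1 3) = H.tet.framing.rot 0 1 2 := H.tet.σ_rot 0 1 3
  rw [e] at h
  exact h

/-- Antisymmetry rewrites the `m`, `\bar m` term as minus the `23` coefficient. Thus `ε` and `β` are
components of the weight connection, and `ε'` and `β'` are negatives of its other two. -/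
theorem rep_om (k : Fin 4) : Rep (fun y => (1 / 2) * (Tetrad.rot g θ.n (θ.co k) θ.l y
    + Tetrad.rot g θ.m (θ.co k) θ.mb y)) (H.tet.om k) := by
  have h := (Rep.const (U := U) (1 / 2)).mul ((H.rep_rot k 0 1).add (H.rep_rot k 3 2))
  rw [H.tet.framing.rot_antisymm k 3 2, ← sub_eq_add_neg] at h
  exact h

theorem rep_om' (k : Fin 4) : Rep (fun y => (1 / 2) * (Tetrad.rot g θ.l (θ.co k) θ.n y
    + Tetrad.rot g θ.mb (θ.co k) θ.m y)) (-H.tet.om k) := by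
  have h := (Rep.const (U := U) (1 / 2)).mul ((H.rep_rot k 1 0).add (H.rep_rot k 2 3))
  have e : -H.tet.om k = algebraMap ℂ (Smooth U) (1 / 2)
      * (H.tet.framing.rot k 1 0 + H.tet.framing.rot k 2 3) := by
    rw [H.tet.framing.rot_antisymm k 1 0, VacuumTetrad.om,
      show H.tet.hf = algebraMap ℂ (Smooth U) (1 / 2) from rfl]
    ring
  rw [e]
  exact h

theorem rep_eps : Rep (θ.eps g) (H.tet.om 0) := H.rep_om 0
theorem rep_beta : Rep (θ.beta g) (H.tet.om 2) := H.rep_om 2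
theorem rep_eps' : Rep (θ.eps' g) (-H.tet.om 1) := H.rep_om' 1
theorem rep_beta' : Rep (θ.beta' g) (-H.tet.om 3) := H.rep_om' 3

theorem rep_omega (a : Fin 4) : Rep (θ.omega g a) (H.tetrad.wconn a) := by
  have h := (((H.rep_eps.mul (H.rep_co 1 a)).sub (H.rep_eps'.mul (H.rep_co 0 a))).add
    (H.rep_beta'.mul (H.rep_co 2 a))).sub (H.rep_beta.mul (H.rep_co 3 a))
  have e : H.tet.om 0 * H.coA 1 a - -H.tet.om 1 * H.coA 0 a + -H.tet.om 3 * H.coA 2 a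
      - H.tet.om 2 * H.coA 3 a = etaTr fun i j => H.tet.om i * H.coA j a := by
    rw [etaTr]
    ring
  rw [e] at h
  exact h

theorem con_wconn (k : Fin 4) : H.tetrad.con k H.tetrad.wconn = H.tet.om k := H.tet.con_etaTr_E _ k

theorem con_wconnt (k : Fin 4) : H.tetrad.con k H.tetrad.wconnt = H.tet.omt k := H.tet.con_etaTr_E _ k

theorem conj_om (k : Fin 4) : conjHom U (H.tet.om k) = H.tet.omt (swapM k) := H.tet.σ_om k

theorem rep_D {f : F0} {u : Smooth U} (hf : Rep f u) (a : Fin 4) :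
    Rep (pd a f) (H.tetrad.D a u) := hf.pd H.isOpen a

attribute [irreducible] IsTypeDOn.tetrad

theorem rep_bForm (a : Fin 4) : Rep (θ.bForm g a) (H.tetrad.bField a) :=
  (H.rep_rho.neg.mul (H.rep_E 1 a)).add (H.rep_tau.mul (H.rep_E 3 a))

theorem rep_gam (a : Fin 4) : Rep (θ.gam g a) (H.tetrad.bField a - H.tetrad.wconn a) :=
  (H.rep_bForm a).sub (H.rep_omega a)

variable {f : F0} {u : Smooth U}

theorem rep_thorn (hf : Rep f u) (p q : ℤ) : Rep (θ.thorn g p q f) (H.tetrad.wder 0 p q u) := by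
  have hX : Rep (fun y => ∑ a, Tetrad.up g θ.l a y * pd a f y) (H.tetrad.X 0 u) := by
    rw [Framing.X_apply]
    exact Rep.sum fun a => (H.rep_V 0 a).mul (H.rep_D hf a)
  have h := (hX.sub (((Rep.intCast p).mul H.rep_eps).mul hf)).sub
    (((Rep.intCast q).mul H.rep_eps.conj).mul hf)
  have e : conjHom U (H.tet.om 0) = H.tet.omt 0 := H.conj_om 0
  rw [PrincipalTetrad.wder, con_wconn, con_wconnt, add_mul, ← sub_sub]
  rw [e] at h
  exact h

theorem rep_eth (hf : Rep f u) (p q : ℤ) : Rep (θ.eth g p q f) (H.tetrad.wder 2 p q u) := by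
  have hX : Rep (fun y => ∑ a, Tetrad.up g θ.m a y * pd a f y) (H.tetrad.X 2 u) := by
    rw [Framing.X_apply]
    exact Rep.sum fun a => (H.rep_V 2 a).mul (H.rep_D hf a)
  have h := (hX.sub (((Rep.intCast p).mul H.rep_beta).mul hf)).add
    (((Rep.intCast q).mul H.rep_beta'.conj).mul hf)
  have e : H.tetrad.wder 2 p q u = H.tetrad.X 2 u - p * H.tet.om 2 * u
      + q * conjHom U (-H.tet.om 3) * u := by
    rw [PrincipalTetrad.wder, con_wconn, con_wconnt, map_neg, H.conj_om]
    simp only [swapM, Matrix.cons_val]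
    ring
  rw [e]
  exact h

theorem rep_kcA (hf : Rep f u) : Rep (θ.kcA g f) (H.tetrad.potA u) :=
  (H.rep_thorn hf (-4) 0).add (((Rep.ofNat 3).mul H.rep_rho).mul hf)

theorem rep_kcB (hf : Rep f u) : Rep (θ.kcB g f) (H.tetrad.potB u) :=
  (H.rep_eth hf (-4) 0).add (((Rep.ofNat 3).mul H.rep_tau).mul hf)

/-- By `wder_potB` the two halves of the mixed bracket are `y` plus corrections in `A` and `B` that
cancel between them. The bracket is therefore `2y`. -/
theorem rep_kegelesCohen (hf : Rep f u) (a b : Fin 4) :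
    Rep (θ.kegelesCohen g f a b) (-H.tetrad.pert u a b) := by
  have hA := H.rep_kcA hf
  have hB := H.rep_kcB hf
  have h := ((((H.rep_E 0 a).mul (H.rep_E 0 b)).mul
      ((H.rep_eth hB (-3) (-1)).sub (H.rep_tau.mul hB))).neg.sub
    (((H.rep_E 2 a).mul (H.rep_E 2 b)).mul
      ((H.rep_thorn hA (-3) 1).sub (H.rep_rho.mul hA)))).add
    (((Rep.const (1 / 2)).mul (((H.rep_E 0 a).mul (H.rep_E 2 b)).add
      ((H.rep_E 2 a).mul (H.rep_E 0 b)))).mul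
      (((H.rep_thorn hB (-3) (-1)).sub ((H.rep_rho.sub H.rep_conj_rho).mul hB)).add
        ((H.rep_eth hA (-3) 1).sub ((H.rep_tau.sub H.rep_conj_tau').mul hA))))
  have h' : Rep (θ.kegelesCohen g f a b) _ := h
  convert h' using 1
  have h2 := two_mul_halfFun U
  rw [show algebraMap ℂ (Smooth U) (1 / 2) = halfFun U from rfl, H.tetrad.wder_potB]
  simp only [PrincipalTetrad.pert, PrincipalTetrad.potX, PrincipalTetrad.potY, PrincipalTetrad.potZ]
  generalize H.tetrad = F at *
  linear_combination -(F.E 0 a * F.E 2 b + F.E 2 a * F.E 0 b) * (F.wder 2 (-3) 1 (F.potA u)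
    + (F.rot 2 0 3 - 2 * F.rot 3 0 2) * F.potB u + F.rot 1 0 2 * F.potA u) * h2

end IsTypeDOn
end TypeDRec

/-! ### The Teukolsky operators and the reconstruction in coordinates -/

namespace TypeDRec
namespace IsTypeDOn

variable {U : Set E4} {g : F2} {θ : Tetrad} {lam : ℝ} (H : IsTypeDOn U g θ lam)
  {f : F0} {u : Smooth U}

theorem rep_christ (c a b : Fin 4) : Rep (christoffel g c a b) (H.tetrad.Γ c a b) := by
  rw [H.tetrad_Γ]
  exact rep_christoffel H.isOpen H.rep_g H.rep_gi c a b

theorem rep_inv (a b : Fin 4) : Rep (invMetric g a b) (H.tetrad.gi a b) := by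
  rw [H.tetrad_gi]
  exact H.rep_gi a b

theorem rep_ccov1 {w : F1} {x : Fin 4 → Smooth U} (h : ∀ i, Rep (w i) (x i)) (a b : Fin 4) :
    Rep (cov1 g w a b) (ccov1 H.tetrad.D H.tetrad.Γ x a b) := by
  rw [H.tetrad_D]
  exact rep_cov1 H.isOpen H.rep_christ h a b

theorem rep_waveOp (hf : Rep f u) {p : ℤ} {c : Smooth U} (hc : Rep (fun _ => (p : ℂ)) c)
    {w : Fin 4 → Smooth U}
    (hw : ∀ b, w b = H.tetrad.D b u + c * (H.tetrad.bField b - H.tetrad.wconn b) * u) :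
    Rep (θ.waveOp g p f) (∑ a, ∑ b, H.tetrad.gi a b * (ccov1 H.tetrad.D H.tetrad.Γ w a b
      + c * (H.tetrad.bField a - H.tetrad.wconn a) * w b)) := by
  have hw' : ∀ b, Rep (fun z => pd b f z + (p : ℂ) * θ.gam g b z * f z) (w b) := fun b => by
    rw [hw]
    exact (H.rep_D hf b).add ((hc.mul (H.rep_gam b)).mul hf)
  exact Rep.sum fun a => Rep.sum fun b => (H.rep_inv a b).mul
    ((H.rep_ccov1 hw' a b).add ((hc.mul (H.rep_gam a)).mul (hw' b)))

theorem rep_teukolsky_aux (hf : Rep f u) {s : ℤ} {x : Smooth U} (hx : Rep (θ.waveOp g (2 * s) f) x) :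
    Rep (θ.teukolsky g lam s f) (x - 16 * H.tetrad.Ψ * u + 4 * H.tetrad.Λ * u) := by
  have h4 : 4 * H.tetrad.Λ = algebraMap ℂ (Smooth U) (2 / 3) * algebraMap ℂ (Smooth U) lam := by
    rw [H.tetrad_Λ, ← map_ofNat (algebraMap ℂ (Smooth U)) 4, ← map_mul, ← map_mul]
    congr 1
    ring
  rw [h4, H.tetrad_psi]
  exact (hx.sub (((Rep.ofNat 16).mul H.rep_psi).mul hf)).add
    (((Rep.const (2 / 3)).mul (Rep.const (lam : ℂ))).mul hf)

theorem rep_teukolsky_neg (hf : Rep f u) : Rep (θ.teukolsky g lam (-2) f) (H.tetrad.teuk u) := by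
  refine H.rep_teukolsky_aux hf ?_
  have hc : Rep (fun _ => ((2 * (-2) : ℤ) : ℂ)) (-4 : Smooth U) := by
    have e : (-4 : Smooth U) = ((2 * (-2) : ℤ) : Smooth U) := by norm_num
    rw [e]
    exact Rep.intCast _
  have h := H.rep_waveOp hf hc (w := H.tetrad.twistedGrad u) fun b => by
    rw [PrincipalTetrad.twistedGrad]
    ring
  have e : ∑ a, ∑ b, H.tetrad.gi a b * (ccov1 H.tetrad.D H.tetrad.Γ (H.tetrad.twistedGrad u) a b
        - 4 * (H.tetrad.bField a - H.tetrad.wconn a) * H.tetrad.twistedGrad u b)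
      = ∑ a, ∑ b, H.tetrad.gi a b * (ccov1 H.tetrad.D H.tetrad.Γ (H.tetrad.twistedGrad u) a b
        + -4 * (H.tetrad.bField a - H.tetrad.wconn a) * H.tetrad.twistedGrad u b) :=
    Finset.sum_congr rfl fun a _ => Finset.sum_congr rfl fun b _ => by ring
  rw [e]
  exact h

theorem rep_teukolsky_pos (hf : Rep f u) : Rep (θ.teukolsky g lam 2 f) (H.tetrad.teukPlus u) := by
  refine H.rep_teukolsky_aux hf ?_
  have hc : Rep (fun _ => ((2 * 2 : ℤ) : ℂ)) (4 : Smooth U) := by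
    have e : (4 : Smooth U) = ((2 * 2 : ℤ) : Smooth U) := by norm_num
    rw [e]
    exact Rep.intCast _
  exact H.rep_waveOp hf hc fun b => rfl

variable {ψ : F0} {x v : Smooth U}

theorem _root_.TypeDRec.Rep.zpow_neg_four (hx : Rep ψ x) (hv : v * x = 1) :
    Rep (fun y => ψ y ^ (-4 : ℤ)) (v ^ 4) := fun y => by
  have h := congrArg (evalAt y) hv
  rw [map_mul, map_one, evalAt_apply, evalAt_apply, ← hx y] at h
  rw [← evalAt_apply, map_pow, evalAt_apply, eq_inv_of_mul_eq_one_left h, inv_pow]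
  exact zpow_neg _ 4

theorem rep_recon {s : ℤ} (hx : Rep ψ x) (hv : v * x = 1) {t : Fin 4 → Fin 4 → Fin 4 → Fin 4 → Smooth U}
    (ht : ∀ a c d b, Rep (θ.hertz ψ s f a c d b) (halfFun U * t a c d b)) (a b : Fin 4) :
    Rep (θ.recon g ψ s f a b) (halfFun U * cdiv3 H.tetrad.D H.tetrad.Γ H.tetrad.gi
      (fun a c b => v ^ 4 * cdiv4 H.tetrad.D H.tetrad.Γ H.tetrad.gi t a c b) a b) := by
  have hD : ∀ a, H.tetrad.D a (halfFun U) = 0 := fun a => by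
    rw [H.tetrad_D]
    exact pdDer_const H.isOpen a _
  rw [← cdiv3_const_mul _ _ hD]
  have h4 : ∀ a c b, Rep (θ.hertzDiv g ψ s f a c b) (halfFun U * (v ^ 4
      * cdiv4 H.tetrad.D H.tetrad.Γ H.tetrad.gi t a c b)) := by
    intro a c b
    rw [mul_left_comm, ← cdiv4_const_mul _ _ hD]
    refine (hx.zpow_neg_four hv).mul (Rep.sum fun d => Rep.sum fun e => (H.rep_inv d e).mul ?_)
    rw [H.tetrad_D]
    exact rep_cov4 H.isOpen H.rep_christ ht e a c d b
  refine Rep.sum fun c => Rep.sum fun e => (H.rep_inv c e).mul ?_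
  rw [H.tetrad_D] at h4 ⊢
  exact rep_cov3 H.isOpen H.rep_christ h4 e a c b

theorem rep_recon_neg (hx : Rep ψ x) (hv : v * x = 1) (hx3 : x ^ 3 = H.tetrad.Ψ) (hf : Rep f u)
    (a b : Fin 4) : Rep (θ.recon g ψ (-2) f a b) (-H.tetrad.pert u a b) := by
  have h := H.rep_recon (s := -2) (f := f) hx hv (t := H.tetrad.hertzField (x ^ 4 * u)) ?_ a b
  · have e : -H.tetrad.pert u a b = halfFun U * cdiv3 H.tetrad.D H.tetrad.Γ H.tetrad.gi (fun a c b =>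
        v ^ 4 * cdiv4 H.tetrad.D H.tetrad.Γ H.tetrad.gi (H.tetrad.hertzField (x ^ 4 * u)) a c b) a b := by
      rw [H.tetrad.recon_hertzField u hv hx3]
      linear_combination H.tetrad.pert u a b * two_mul_halfFun U
    rw [e]
    exact h
  · intro a c d b
    have hM : ∀ a b, Rep (θ.M0 a b) (H.tetrad.mForm a b) := fun a b =>
      ((H.rep_E 0 a).mul (H.rep_E 2 b)).sub ((H.rep_E 0 b).mul (H.rep_E 2 a))
    have h1 := (((Rep.const (1 / 2)).mul (((hM a c).mul (hM d b)).add
      ((hM b c).mul (hM d a)))).mul (hx.pow 4)).mul hf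
    rw [mul_assoc, mul_assoc] at h1
    rw [PrincipalTetrad.hertzField]
    exact h1

/-- `²M` is minus the form `l ∧ m` of the primed tetrad, and the sign drops out of the product.
Inserting `1 = Ψ^{4/3}Ψ^{-4/3}` exhibits `Ψ^{-4/3}Φ` as the Debye potential. -/
theorem rep_recon_pos (hx : Rep ψ x) (hv : v * x = 1) (hx3 : x ^ 3 = H.tetrad.Ψ) (hf : Rep f u)
    (a b : Fin 4) : Rep (θ.recon g ψ 2 f a b) (-H.tetrad.prime.pert (v ^ 4 * u) a b) := by
  have h := H.rep_recon (s := 2) (f := f) hx hv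
    (t := H.tetrad.prime.hertzField (x ^ 4 * (v ^ 4 * u))) ?_ a b
  · have h2 := H.tetrad.prime.recon_hertzField (v ^ 4 * u) hv hx3 a b
    rw [show H.tetrad.prime.gi = H.tetrad.gi from H.tetrad.toFraming.prime_gi] at h2
    have h3 : cdiv3 H.tetrad.D H.tetrad.Γ H.tetrad.gi (fun a c b => v ^ 4 * cdiv4 H.tetrad.D
        H.tetrad.Γ H.tetrad.gi (H.tetrad.prime.hertzField (x ^ 4 * (v ^ 4 * u))) a c b) a b
        = -2 * H.tetrad.prime.pert (v ^ 4 * u) a b := h2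
    have e : -H.tetrad.prime.pert (v ^ 4 * u) a b = halfFun U * cdiv3 H.tetrad.D H.tetrad.Γ
        H.tetrad.gi (fun a c b => v ^ 4 * cdiv4 H.tetrad.D H.tetrad.Γ H.tetrad.gi
          (H.tetrad.prime.hertzField (x ^ 4 * (v ^ 4 * u))) a c b) a b := by
      rw [h3]
      linear_combination H.tetrad.prime.pert (v ^ 4 * u) a b * two_mul_halfFun U
    rw [e]
    exact h
  · intro a c d b
    have hM : ∀ a b, Rep (θ.M2 a b) (-H.tetrad.prime.mForm a b) := fun a b => by
      have e : -H.tetrad.prime.mForm a b = H.tetrad.E 3 a * H.tetrad.E 1 b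
          - H.tetrad.E 3 b * H.tetrad.E 1 a := by
        change -(H.tetrad.E 1 a * H.tetrad.E 3 b - H.tetrad.E 1 b * H.tetrad.E 3 a) = _
        ring
      rw [e]
      exact ((H.rep_E 3 a).mul (H.rep_E 1 b)).sub ((H.rep_E 3 b).mul (H.rep_E 1 a))
    have h1 := (((Rep.const (1 / 2)).mul (((hM a c).mul (hM d b)).add
      ((hM b c).mul (hM d a)))).mul (hx.pow 0)).mul hf
    have e : halfFun U * H.tetrad.prime.hertzField (x ^ 4 * (v ^ 4 * u)) a c d b
        = halfFun U * (-H.tetrad.prime.mForm a c * -H.tetrad.prime.mForm d b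
          + -H.tetrad.prime.mForm b c * -H.tetrad.prime.mForm d a) * x ^ 0 * u := by
      have h4 : x ^ 4 * v ^ 4 = 1 := by rw [← mul_pow, mul_comm, hv, one_pow]
      rw [PrincipalTetrad.hertzField, ← mul_assoc (x ^ 4), h4]
      ring
    rw [e]
    exact h1

end IsTypeDOn
end TypeDRec

/-! ### The local theorem and independence of the tetrad -/

namespace TypeDRec
namespace IsTypeDOn

variable {U : Set E4} {g : F2} {θ : Tetrad} {lam : ℝ} (H : IsTypeDOn U g θ lam)

/-- `F` only has to share the metric data, so the statement covers both the tetrad and its primed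
version. -/
theorem linEinsteinAt_pert {F : PrincipalTetrad (Smooth U)} (hD : F.D = H.tetrad.D)
    (hΓ : F.Γ = H.tetrad.Γ) (hgi : F.gi = H.tetrad.gi) (hΛ : F.Λ = H.tetrad.Λ) {u : Smooth U}
    (h0 : F.teuk u = 0) {h : F2} (hh : ∀ a b, Rep (h a b) (-F.pert u a b)) {y : E4} (hy : y ∈ U) :
    LinEinsteinAt g lam h y := by
  rw [tetrad_D] at hD
  rw [tetrad_Γ] at hΓ
  rw [tetrad_gi] at hgi
  rw [tetrad_Λ] at hΛ
  refine H.toIsVacuumOn.linEinsteinAt hh (F.pert_symm u) ?_ ?_ ?_ hy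
  · rw [← hgi]
    exact F.trace_pert u
  · rw [← hgi]
    exact F.pert_null u
  · rw [← hgi, ← hD, ← hΛ]
    rw [← hgi, ← hD] at hΓ
    rw [← hΓ]
    exact F.clin_pert u h0

/-- The reconstructed perturbation in a coordinate domain. -/
theorem recon_spec (H : IsTypeDOn U g θ lam) {ψ f : F0} (hψ : ContDiffOn ℝ ∞ ψ U) (hψ3 : ∀ y ∈ U, ψ y ^ 3 = θ.Psi2 g y)
    (hf : ContDiffOn ℝ ∞ f U) {s : ℤ} (hs : s = 2 ∨ s = -2)
    (h0 : ∀ y ∈ U, θ.teukolsky g lam s f y = 0) :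
    (∀ a b, ContDiffOn ℝ ∞ (θ.recon g ψ s f a b) U)
      ∧ (∀ y ∈ U, (∀ a b, θ.recon g ψ s f a b y = θ.recon g ψ s f b a y)
        ∧ LinEinsteinAt g lam (θ.recon g ψ s f) y)
      ∧ (s = -2 → ∀ y ∈ U, ∀ a b, θ.recon g ψ s f a b y = θ.kegelesCohen g f a b y) := by
  have hx := rep_restr hψ
  have hu := rep_restr hf
  generalize restr ψ hψ = x at hx
  generalize restr f hf = u at hu
  have hx3 : x ^ 3 = H.tetrad.Ψ := by
    rw [tetrad_psi]
    exact (hx.pow 3).unique H.rep_psi hψ3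
  obtain ⟨v, hv⟩ : ∃ v, v * x = 1 := by
    refine IsUnit.exists_left_inv (isUnit_smooth fun y h => ?_)
    have h1 := hψ3 y y.2
    rw [hx y, h] at h1
    exact (H.principal y y.2).2.2.1 (by rw [← h1]; simp)
  have key : ∀ (F : PrincipalTetrad (Smooth U)) (w : Smooth U),
      (∀ a b, Rep (θ.recon g ψ s f a b) (-F.pert w a b)) →
      (∀ a b, ContDiffOn ℝ ∞ (θ.recon g ψ s f a b) U)
        ∧ ∀ y ∈ U, ∀ a b, θ.recon g ψ s f a b y = θ.recon g ψ s f b a y := by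
    intro F w h
    refine ⟨fun a b => (h a b).contDiffOn, fun y hy a b => (h a b).eq ?_ hy⟩
    rw [F.pert_symm]
    exact h b a
  rcases hs with rfl | rfl
  · have hr := H.rep_recon_pos hx hv hx3 hu
    have h1 : H.tetrad.teukPlus u = 0 :=
      (H.rep_teukolsky_pos hu).unique (f' := fun _ => 0) (x' := 0) (fun _ => rfl) h0
    have h2 : H.tetrad.prime.teuk (v ^ 4 * u) = 0 := by
      rw [H.tetrad.teuk_prime hv hx3, h1, mul_zero]
    have hk := key _ _ hr
    exact ⟨hk.1, fun y hy => ⟨hk.2 y hy, H.linEinsteinAt_pert (F := H.tetrad.prime) rfl rfl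
      H.tetrad.toFraming.prime_gi rfl h2 hr hy⟩, fun h => absurd h (by norm_num)⟩
  · have hr := H.rep_recon_neg hx hv hx3 hu
    have h1 : H.tetrad.teuk u = 0 :=
      (H.rep_teukolsky_neg hu).unique (f' := fun _ => 0) (x' := 0) (fun _ => rfl) h0
    have hk := key _ _ hr
    exact ⟨hk.1, fun y hy => ⟨hk.2 y hy, H.linEinsteinAt_pert (F := H.tetrad) rfl rfl rfl rfl
      h1 hr hy⟩, fun _ y hy a b => (hr a b).eq (H.rep_kegelesCohen hu a b) hy⟩

end IsTypeDOn

section Independence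

variable {U : Set E4} {g : F2}

theorem cov3_congr (hU : IsOpen U) {t t' : F3} (h : ∀ i j k, ∀ y ∈ U, t i j k y = t' i j k y)
    (a i j k : Fin 4) {y : E4} (hy : y ∈ U) : cov3 g t a i j k y = cov3 g t' a i j k y := by
  simp only [cov3, pd_congr hU (h i j k) a hy, h _ _ _ y hy]

theorem cov4_congr (hU : IsOpen U) {t t' : F4}
    (h : ∀ i j k l, ∀ y ∈ U, t i j k l y = t' i j k l y) (a i j k l : Fin 4) {y : E4} (hy : y ∈ U) :
    cov4 g t a i j k l y = cov4 g t' a i j k l y := by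
  simp only [cov4, pd_congr hU (h i j k l) a hy, h _ _ _ _ y hy]

/-- The tetrad enters the reconstruction only through the Hertz potential. -/
theorem recon_congr (hU : IsOpen U) {θ θ' : Tetrad} {ψ f f' : F0} {s : ℤ}
    (h : ∀ a c d b, ∀ y ∈ U, θ.hertz ψ s f a c d b y = θ'.hertz ψ s f' a c d b y) (a b : Fin 4)
    {y : E4} (hy : y ∈ U) : θ.recon g ψ s f a b y = θ'.recon g ψ s f' a b y := by
  have h3 : ∀ a c b, ∀ y ∈ U, θ.hertzDiv g ψ s f a c b y = θ'.hertzDiv g ψ s f' a c b y := by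
    intro a c b y hy
    simp only [Tetrad.hertzDiv, cov4_congr hU h _ _ _ _ _ hy]
  simp only [Tetrad.recon, cov3_congr hU h3 _ _ _ _ hy]

/-- The moduli cancel in the two-forms: `⁰M` scales by `ζ` and `²M` by `ζ⁻¹`. Their squares scale by
`ζ^{-s}`, which cancels the factor of the potential. -/
theorem hertz_eq_of_gauge {θ θ' : Tetrad} {ψ f f' : F0} {s : ℤ} (hs : s = 2 ∨ s = -2) {y : E4}
    {ζ : ℂ} (hζ : ζ ≠ 0) (hl : ∀ a, θ.l a y = ‖ζ‖ * θ'.l a y)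
    (hn : ∀ a, θ.n a y = (‖ζ‖ : ℂ)⁻¹ * θ'.n a y)
    (hm : ∀ a, θ.m a y = ζ / ‖ζ‖ * θ'.m a y) (hf : f y = ζ ^ s * f' y) (a c d b : Fin 4) :
    θ.hertz ψ s f a c d b y = θ'.hertz ψ s f' a c d b y := by
  have hz : (‖ζ‖ : ℂ) ≠ 0 := by exact_mod_cast norm_ne_zero_iff.2 hζ
  have hcz : starRingEnd ℂ ζ ≠ 0 := (map_ne_zero _).2 hζ
  have hb : ∀ a, θ.mb a y = ‖ζ‖ / ζ * θ'.mb a y := fun a => by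
    rw [Tetrad.mb, hm, map_mul, map_div₀, Complex.conj_ofReal, Tetrad.mb]
    congr 1
    rw [div_eq_div_iff hz hζ, mul_comm, Complex.mul_conj, Complex.normSq_eq_norm_sq]
    push_cast
    ring
  rcases hs with rfl | rfl
  · have hM : ∀ a b, θ.M2 a b y = ζ⁻¹ * θ'.M2 a b y := fun a b => by
      simp only [Tetrad.M2, hb, hn]
      field_simp
    simp only [Tetrad.hertz, Tetrad.WExt, if_true, Tetrad.W4, hM, hf]
    rw [zpow_ofNat]
    field_simp
  · have hM : ∀ a b, θ.M0 a b y = ζ * θ'.M0 a b y := fun a b => by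
      simp only [Tetrad.M0, hl, hm]
      field_simp
    simp only [Tetrad.hertz, Tetrad.WExt, show ¬((-2 : ℤ) = 2) by norm_num, if_false, Tetrad.W0, hM,
      hf]
    rw [zpow_neg, zpow_ofNat]
    field_simp

end Independence

end TypeDRec

/-! ### From the manifold to coordinate domains -/

namespace TypeDRec

section Manifold

theorem isOpen_chartDom {M : Type*} [TopologicalSpace M] (e : OpenPartialHomeomorph M E4) {U : Set M}
    (hU : IsOpen U) :
    IsOpen (chartDom e U) :=
  e.isOpen_inter_preimage_symm hU

variable {M : Type*} [TopologicalSpace M] [ChartedSpace E4 M] {e : OpenPartialHomeomorph M E4}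

theorem bijective_mfderiv_symm (he : e ∈ IsManifold.maximalAtlas (𝓡 4) ∞ M) {y : E4}
    (hy : y ∈ e.target) : Function.Bijective (mfderiv (𝓡 4) (𝓡 4) e.symm y) := by
  have h : e.MDifferentiable (𝓡 4) (𝓡 4) :=
    ⟨(contMDiffOn_of_mem_maximalAtlas he).mdifferentiableOn (by simp),
      (contMDiffOn_symm_of_mem_maximalAtlas he).mdifferentiableOn (by simp)⟩
  exact h.symm.mfderiv_bijective hy

theorem LorentzMetric.nondegenerate (g : LorentzMetric M) (x : M) {w : TangentSpace (𝓡 4) x}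
    (h : ∀ v, g.val x v w = 0) : w = 0 := by
  obtain ⟨b, hb⟩ := g.signature x
  have hr : ∀ i, b.repr w i = 0 := by
    intro i
    have h1 := h (b i)
    rw [← b.sum_repr w, map_sum] at h1
    simp only [map_smul, hb, smul_eq_mul, mul_ite, mul_zero, Finset.sum_ite_eq, Finset.mem_univ,
      if_true] at h1
    split_ifs at h1
    · simpa using h1
    · simpa using h1
  rw [← b.sum_repr w]
  simp [hr]

/-- A kernel vector of the component matrix is carried by the bijective differential of the inverse
chart to a tangent vector orthogonal to everything, which the signature forbids. -/
theorem LorentzMetric.det_comp_ne_zero (g : LorentzMetric M)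
    (he : e ∈ IsManifold.maximalAtlas (𝓡 4) ∞ M) {y : E4} (hy : y ∈ e.target) :
    (Matrix.of fun i j => g.comp e i j y).det ≠ 0 := by
  set G : Matrix (Fin 4) (Fin 4) ℝ :=
    Matrix.of fun i j => g.val (e.symm y) (coordVec e y i) (coordVec e y j) with hG
  have hdet : (Matrix.of fun i j => g.comp e i j y).det = ((G.det : ℝ) : ℂ) :=
    (RingHom.map_det Complex.ofRealHom G).symm
  rw [hdet, Complex.ofReal_ne_zero]
  intro h0
  obtain ⟨v, hv, hGv⟩ := Matrix.exists_mulVec_eq_zero_iff.2 h0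
  obtain ⟨L, hL⟩ : ∃ L : E4 →L[ℝ] TangentSpace (𝓡 4) (e.symm y),
      L = mfderiv (𝓡 4) (𝓡 4) e.symm y := ⟨_, rfl⟩
  have hbij : Function.Bijective (fun u : E4 => L u) := by
    rw [hL]
    exact bijective_mfderiv_symm he hy
  have hc : ∀ a, coordVec e y a = L (EuclideanSpace.single a (1 : ℝ)) := fun a => by
    rw [hL]
    rfl
  have hsum : ∀ u : E4, L u = ∑ a, u a • coordVec e y a := by
    intro u
    have hu : u = ∑ a, u a • (EuclideanSpace.single a (1 : ℝ) : E4) := by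
      ext i
      simp [Finset.sum_apply, Pi.single_apply]
    conv_lhs => rw [hu]
    rw [map_sum]
    simp only [map_smul, hc]
  have hw : L (WithLp.toLp 2 v : E4) = 0 := by
    refine g.nondegenerate _ fun t => ?_
    obtain ⟨u, rfl⟩ := hbij.2 t
    change g.val (e.symm y) (L u) _ = 0
    rw [hsum u, map_sum, sum_apply]
    refine Finset.sum_eq_zero fun a _ => ?_
    have h1 := congrFun hGv a
    rw [Matrix.mulVec, dotProduct] at h1
    rw [map_smul, smul_apply, hsum, map_sum]
    simp only [map_smul, smul_eq_mul]
    have h2 : ∑ j, v j * g.val (e.symm y) (coordVec e y a) (coordVec e y j) = 0 := by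
      simpa [hG, mul_comm] using h1
    rw [h2, mul_zero]
  have h3 : (WithLp.toLp 2 v : E4) = 0 := hbij.1 (hw.trans (map_zero L).symm)
  exact hv (by simpa using congrArg WithLp.ofLp h3)

theorem contDiffOn_comp_symm (he : e ∈ IsManifold.maximalAtlas (𝓡 4) ∞ M) {U : Set M} {f : M → ℂ}
    (hf : ContMDiffOn (𝓡 4) 𝓘(ℝ, ℂ) ∞ f U) : ContDiffOn ℝ ∞ (f ∘ e.symm) (chartDom e U) := by
  rw [← contMDiffOn_iff_contDiffOn]
  exact hf.comp ((contMDiffOn_symm_of_mem_maximalAtlas he).mono Set.inter_subset_left)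
    fun y hy => hy.2

variable {g : LorentzMetric M} {κ : Type*}

theorem TypeD.isTypeDOn (D : TypeD g κ) {lam : ℝ} (hg : g.IsVacuum lam)
    (he : e ∈ IsManifold.maximalAtlas (𝓡 4) ∞ M) (i : κ) :
    IsTypeDOn (chartDom e (D.dom i)) (g.comp e) ((D.frame i).comp e) lam where
  isOpen := isOpen_chartDom e (D.isOpen_dom i)
  smooth_g a b := (g.smooth e he a b).mono Set.inter_subset_left
  smooth_co j a := by
    obtain ⟨h0, h1, h2⟩ := (D.isNull i).smooth e he a
    fin_cases j
    · exact h0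
    · exact h1
    · exact h2
    · exact Complex.conjCLE.contDiff.comp_contDiffOn h2
  real_g a b y := Complex.conj_ofReal _
  symm_g a b y := congrArg _ (g.symm _ _ _)
  real_l a y := Complex.conj_ofReal _
  real_n a y := Complex.conj_ofReal _
  det_ne_zero y hy := g.det_comp_ne_zero he hy.1
  metric y hy a b := (D.isNull i).metric _ hy.2 _ _
  einstein y hy := hg e he y hy.1
  principal := D.isPrincipal i e he

theorem WeightedScalar.perturbation_independent {D : TypeD g κ} {s : ℤ} (hs : s = 2 ∨ s = -2)
    (Φ : WeightedScalar D s) (ψ : M → ℂ) (e : OpenPartialHomeomorph M E4) (i j : κ) {y : E4}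
    (hy : y ∈ chartDom e (D.dom i ∩ D.dom j)) (a b : Fin 4) :
    Φ.perturbation ψ i e a b y = Φ.perturbation ψ j e a b y := by
  refine recon_congr (isOpen_chartDom e ((D.isOpen_dom i).inter (D.isOpen_dom j)))
    (fun a c d b y hy => ?_) a b hy
  refine hertz_eq_of_gauge hs (D.trans_ne_zero i j _ hy.2) (fun a => ?_) (fun a => ?_)
    (fun a => D.trans_m i j _ hy.2 _) (Φ.trans i j _ hy.2) a c d b
  · have h := D.trans_l i j _ hy.2 (coordVec e y a)
    simp only [Coframe.comp]
    rw [h]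
    push_cast
    rfl
  · have h := D.trans_n i j _ hy.2 (coordVec e y a)
    simp only [Coframe.comp]
    rw [h]
    push_cast
    rfl

end Manifold

end TypeDRec

theorem mainTheorem6 {M : Type*} [TopologicalSpace M] [ChartedSpace E4 M]
    [IsManifold (𝓡 4) ∞ M] (g : LorentzMetric M) (lam : ℝ) (hg : g.IsVacuum lam)
    {κ : Type*} (D : TypeD g κ) (ψ : M → ℂ) (hψ : D.IsCubeRoot ψ)
    (s : ℤ) (hs : s = 2 ∨ s = -2) (Φ : WeightedScalar D s) (hΦ : Φ.SolvesTeukolsky lam) :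
    ∀ e ∈ IsManifold.maximalAtlas (𝓡 4) ∞ M,
      -- in every chart `h` is smooth and symmetric and solves the linearized equations
      (∀ i, (∀ a b, ContDiffOn ℝ ∞ (Φ.perturbation ψ i e a b) (chartDom e (D.dom i)))
        ∧ ∀ y ∈ chartDom e (D.dom i),
          (∀ a b, Φ.perturbation ψ i e a b y = Φ.perturbation ψ i e b a y)
          ∧ LinEinsteinAt (g.comp e) lam (Φ.perturbation ψ i e) y)
      -- `h` does not depend on the tetrad
      ∧ (∀ i j, ∀ y ∈ chartDom e (D.dom i ∩ D.dom j), ∀ a b,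
          Φ.perturbation ψ i e a b y = Φ.perturbation ψ j e a b y)
      -- for `s = -2` it is the Kegeles–Cohen perturbation
      ∧ (s = -2 → ∀ i, ∀ y ∈ chartDom e (D.dom i), ∀ a b,
          Φ.perturbation ψ i e a b y
            = ((D.frame i).comp e).kegelesCohen (g.comp e) (Φ.val i ∘ e.symm) a b y) := by
  intro e he
  have key : ∀ i, _ := fun i => (D.isTypeDOn hg he i).recon_spec
    (contDiffOn_comp_symm he (hψ.smooth.contMDiffOn (s := D.dom i)))
    (fun y hy => hψ.pow_three i e he y hy) (contDiffOn_comp_symm he (Φ.smooth i)) hs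
    (fun y hy => hΦ i e he y hy)
  exact ⟨fun i => ⟨(key i).1, (key i).2.1⟩, fun i j y hy a b =>
    Φ.perturbation_independent hs ψ e i j hy a b, fun h i => (key i).2.2 h⟩
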